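/- Let $p$ be an odd prime and let $(K,\mathcal O,k)$ be a $p$-modular system: $\mathcal O$ is a complete discrete valuation ring with field of fractions $K$ of characteristic $0$ and algebraically closed residue field $k$ of characteristic $p$. Let $D$ be a cyclic group of order $p^{l}$ with $l\ge 1$, assume that $K$ contains a primitive $p^{l}$-th root of unity, and let $D_i$ be the subgroup of $D$ of order $p^i$ for $0\le i\le l$. All modules are finitely generated. A $kD$-module $W$ (or $\mathcal OD$-lattice) is endo-permutation if its endomorphism module, with the conjugation action of $D$, has a basis permuted by $D$; a $kD$-module is capped if it has an indecomposable direct summand with vertex $D$. Let $\mathbf D_k(D)$ be the (underlying set of the) Dade group, i.e. the set of isomorphism classes of indecomposable capped endo-permutation $kD$-modules. For $Q\le D$ and a $kD$-module $V$, let $\Omega_{D/Q}(V)$ be the kernel of a relative $Q$-projective cover of $V$. For $\alpha_0,\dots,\alpha_{l-1}\in\{0,1\}$ put $$W_D(\alpha_0,\dots,\alpha_{l-1})=\Omega_{D/D_0}^{\alpha_0}\circ\Omega_{D/D_1}^{\alpha_1}\circ\cdots\circ\Omega_{D/D_{l-1}}^{\alpha_{l-1}}(k).$$ Every indecomposable capped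 endo-permutation $kD$-module $W$ lifts to an endo-permutation $\mathcal OD$-lattice $\widetilde W$ on which every element of $D$ acts with determinant $1$; $\widetilde W$ is unique up to isomorphism, and the $K$-character $\rho_W$ afforded by $\widetilde W$ satisfies $\rho_W(u)\in\mathbb Z\setminus\{0\}$ for all $u\in D$. Let $\omega_W(u)\in\{\pm1\}$ be the sign of $\rho_W(u)$. For $1\le i\le l$ let $u_i$ be a generator of $D_i$. Then the map $$\Psi_l:\mathbf D_k(D)\to\{\pm1\}^{l},\qquad [W]\mapsto(\omega_W(u_1),\dots,\omega_W(u_l)),$$ is well defined, bijective, and independent of the choice of the generators $u_1,\dots,u_l$. Furthermore, each $W_D(\alpha_0,\dots,\alpha_{l-1})$ exists and is an indecomposable capped endo-permutation $kD$-module, and if $W\cong W_D(\alpha_0,\dots,\alpha_{l-1})$, then for every $1\le i\le l$ $$\omega_W(u_i)=(-1)^{\alpha_0+\alpha_1+\cdots+\alpha_{i-1}}.$$ -/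

import Mathlib

open scoped TensorProduct

universe u v

namespace CyclicDade

noncomputable section

section General

variable {R : Type u} [CommRing R] {G : Type v} [Group G]

/-- Extension of scalars of a representation along `R → S`; for a lattice over a discrete valuation
ring this gives its reduction (`S` the residue field) and the representation over the fraction
field that it affords. -/
def baseChange {M : Type u} [AddCommGroup M] [Module R M] (S : Type u) [CommRing S] [Algebra R S]
    (σ : Representation R G M) : Representation S G (S ⊗[R] M) where
  toFun g := (σ g).baseChange S
  map_one' := by simp [Module.End.one_eq_id]
  map_mul' g h := by simp [LinearMap.baseChange_mul]

/-- A permutation module: it has a finite basis that is permuted by the group. -/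
def IsPermutation {V : Type u} [AddCommGroup V] [Module R V] (ρ : Representation R G V) : Prop :=
  ∃ (ι : Type) (_ : Fintype ι) (b : Module.Basis ι R V), ∀ (g : G) (i : ι), ∃ j, ρ g (b i) = b j

/-- Endo-permutation: the endomorphism module, with the conjugation action
`g · f = ρ g ∘ f ∘ ρ g⁻¹`, is a permutation module. -/
def IsEndoPermutation {V : Type u} [AddCommGroup V] [Module R V] (ρ : Representation R G V) :
    Prop :=
  IsPermutation (ρ.linHom ρ)

/-- `τ` is (isomorphic to) a direct summand of `ρ`. -/
def IsSummand {V W : Type*} [AddCommGroup V] [Module R V] [AddCommGroup W] [Module R W]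
    (τ : Representation R G W) (ρ : Representation R G V) : Prop :=
  ∃ (i : τ.IntertwiningMap ρ) (r : ρ.IntertwiningMap τ), ∀ w, r (i w) = w

/-- Indecomposable: nonzero, and not a direct sum of two nonzero invariant submodules. -/
def IsIndecomposable {V : Type u} [AddCommGroup V] [Module R V] (ρ : Representation R G V) :
    Prop :=
  Nontrivial V ∧ ∀ U X : Subrepresentation ρ,
    IsCompl U.toSubmodule X.toSubmodule → U.toSubmodule = ⊥ ∨ X.toSubmodule = ⊥

/-- Relative `Q`-projectivity: a direct summand of a module induced from `Q`. -/
def IsRelProjective (Q : Subgroup G) {V : Type u} [AddCommGroup V] [Module R V]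
    (ρ : Representation R G V) : Prop :=
  ∃ N : Rep.{u} R Q, Module.Finite R N ∧ IsSummand ρ (Representation.ind Q.subtype N.ρ)

/-- `Q` is a vertex of the (indecomposable) module: it is minimal among the subgroups relative to
which the module is projective. -/
def IsVertex (Q : Subgroup G) {V : Type u} [AddCommGroup V] [Module R V]
    (ρ : Representation R G V) : Prop :=
  IsRelProjective Q ρ ∧ ∀ Q' : Subgroup G, Q' < Q → ¬ IsRelProjective Q' ρ

/-- Capped: some indecomposable direct summand has the whole group as a vertex. -/
def IsCapped {V : Type u} [AddCommGroup V] [Module R V] (ρ : Representation R G V) : Prop :=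
  ∃ A : Rep.{u} R G, IsIndecomposable A.ρ ∧ IsVertex ⊤ A.ρ ∧ IsSummand A.ρ ρ

/-- A finitely generated indecomposable capped endo-permutation module. -/
structure IsDadeModule {V : Type u} [AddCommGroup V] [Module R V] (ρ : Representation R G V) :
    Prop where
  finite : Module.Finite R V
  indecomposable : IsIndecomposable ρ
  endoPermutation : IsEndoPermutation ρ
  capped : IsCapped ρ

/-- `π : X → V` is a relative `Q`-projective cover: `X` is finitely generated and relatively
`Q`-projective, `π` is surjective and splits over `Q`, and `π` is (right) minimal, that is, every
endomorphism `φ` of `X` with `π ∘ φ = π` is an automorphism. -/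
structure IsRelProjectiveCover (Q : Subgroup G) {X V : Type u} [AddCommGroup X] [Module R X]
    [AddCommGroup V] [Module R V] {τ : Representation R G X} {ρ : Representation R G V}
    (π : τ.IntertwiningMap ρ) : Prop where
  finite : Module.Finite R X
  relProjective : IsRelProjective Q τ
  surjective : Function.Surjective π
  split : ∃ s : V →ₗ[R] X, (∀ q ∈ Q, ∀ v, s (ρ q v) = τ q (s v)) ∧ ∀ v, π (s v) = v
  minimal : ∀ φ : τ.IntertwiningMap τ, π.comp φ = π → Function.Bijective φ

/-- `L` is isomorphic to `Ω_{G/Q}(V)`, the kernel of a relative `Q`-projective cover of `V`. -/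
def IsRelHeller (Q : Subgroup G) {L V : Type u} [AddCommGroup L] [Module R L]
    [AddCommGroup V] [Module R V] (lam : Representation R G L) (ρ : Representation R G V) : Prop :=
  ∃ (X : Rep.{u} R G) (π : X.ρ.IntertwiningMap ρ) (ι : lam.IntertwiningMap X.ρ),
    IsRelProjectiveCover Q π ∧ Function.Injective ι ∧
      LinearMap.range ι.toLinearMap = LinearMap.ker π.toLinearMap

end General

section DadeGroup

variable (k : Type u) [Field k] (P : Type v) [Group P]

/-- Isomorphism of indecomposable capped endo-permutation `kP`-modules. -/
def isoSetoid : Setoid {A : Rep.{u} k P // IsDadeModule A.ρ} where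
  r A B := Nonempty (A.1.ρ.Equiv B.1.ρ)
  iseqv :=
    { refl := fun A => ⟨Representation.Equiv.refl A.1.ρ⟩
      symm := fun ⟨e⟩ => ⟨e.symm⟩
      trans := fun ⟨e⟩ ⟨f⟩ => ⟨e.trans f⟩ }

/-- The (underlying set of the) Dade group of `P`: the isomorphism classes of indecomposable capped
endo-permutation `kP`-modules. -/
def DadeGroup : Type (max (u + 1) v) := Quotient (isoSetoid k P)

end DadeGroup

section Signs

variable (O : Type u) [CommRing O] (K : Type u) [Field K] [Algebra O K]
  {k : Type u} [Field k] [Algebra O k] {P : Type v} [Group P]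

/-- `σ` is an endo-permutation `OP`-lattice of determinant one that lifts `ρ`: it is finitely
generated and free over `O`, it is endo-permutation, `k ⊗ σ ≅ ρ`, and every group element acts with
determinant one. -/
structure IsDetOneLift {O : Type u} [CommRing O] {k : Type u} [Field k] [Algebra O k]
    {M V : Type u} [AddCommGroup M] [Module O M]
    [AddCommGroup V] [Module k V] (σ : Representation O P M) (ρ : Representation k P V) :
    Prop where
  finite : Module.Finite O M
  free : Module.Free O M
  endoPermutation : IsEndoPermutation σ
  lifts : Nonempty ((baseChange k σ).Equiv ρ)
  det_eq_one : ∀ g, LinearMap.det (σ g) = 1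

open Classical in
/-- The sign `ω_W(g)`: it is `1` if the value at `g` of the `K`-character afforded by the
determinant-one lift of `W` is a positive integer, and `-1` otherwise. -/
def omega {V : Type u} [AddCommGroup V] [Module k V] (ρ : Representation k P V) (g : P) : ℤˣ :=
  if ∃ M : Rep.{u} O P, IsDetOneLift M.ρ ρ ∧
      ∃ n : ℤ, 0 < n ∧ (baseChange K M.ρ).character g = n
  then 1 else -1

theorem IsDetOneLift.of_equiv {O : Type u} [CommRing O] {k : Type u} [Field k] [Algebra O k]
    {M V W : Type u} [AddCommGroup M] [Module O M] [AddCommGroup V] [Module k V]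
    [AddCommGroup W] [Module k W]
    {σ : Representation O P M} {ρ : Representation k P V} {τ : Representation k P W}
    (h : IsDetOneLift σ ρ) (e : ρ.Equiv τ) : IsDetOneLift σ τ :=
  ⟨h.finite, h.free, h.endoPermutation, h.lifts.map fun f => f.trans e, h.det_eq_one⟩

theorem omega_congr {V W : Type u} [AddCommGroup V] [Module k V] [AddCommGroup W] [Module k W]
    {ρ : Representation k P V} {τ : Representation k P W} (e : ρ.Equiv τ) (g : P) :
    omega O K ρ g = omega O K τ g := by
  have h : ∀ M : Rep.{u} O P, IsDetOneLift M.ρ ρ ↔ IsDetOneLift M.ρ τ :=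
    fun M => ⟨fun h => h.of_equiv e, fun h => h.of_equiv e.symm⟩
  classical
  unfold omega
  exact if_congr (by simp only [h]) rfl rfl

/-- The sign `ω_W(g)` as a function of the class `[W]`. -/
def DadeGroup.omega (g : P) (w : DadeGroup k P) : ℤˣ :=
  Quotient.lift (s := isoSetoid k P) (fun A => CyclicDade.omega O K A.1.ρ g)
    (fun _ _ ⟨e⟩ => omega_congr O K e g) w

/-- The map `Ψ : [W] ↦ (ω_W(u₁), …, ω_W(u_l))` (the element `u_{i+1}` has index `i : Fin l`). -/
def Psi (k : Type u) [Field k] [Algebra O k] {l : ℕ} (x : Fin l → P) (w : DadeGroup k P) :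
    Fin l → ℤˣ :=
  fun i => DadeGroup.omega O K (x i) w

end Signs

section Cyclic

variable (p : ℕ) (D : Type v) [CommGroup D]

/-- `D_i`: the subgroup of elements of order dividing `p ^ i`; if `D` is cyclic of order `p ^ l` and
`i ≤ l`, it is the unique subgroup of `D` of order `p ^ i`. -/
def cycSubgroup (i : ℕ) : Subgroup D := (powMonoidHom (p ^ i) : D →* D).ker

variable {D}

theorem card_cycSubgroup [IsCyclic D] {p l i : ℕ} (hp : p.Prime) (hD : Nat.card D = p ^ l)
    (hi : i ≤ l) : Nat.card (cycSubgroup p D i) = p ^ i := by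
  have : Finite D := Nat.finite_of_card_ne_zero (by rw [hD]; exact pow_ne_zero _ hp.ne_zero)
  unfold cycSubgroup
  rw [IsCyclic.card_powMonoidHom_ker, hD]
  exact Nat.gcd_eq_right (pow_dvd_pow p hi)

/-- `x 0, …, x (l - 1)` generate `D_1, …, D_l`, respectively. -/
def AreGenerators {l : ℕ} (x : Fin l → D) : Prop :=
  ∀ i : Fin l, Subgroup.zpowers (x i) = cycSubgroup p D (i + 1)

/-- `ρ` is isomorphic to
`W_D(α_0, …, α_{l-1}) = Ω_{D/D_0}^{α_0} ∘ ⋯ ∘ Ω_{D/D_{l-1}}^{α_{l-1}} (k)`: there are modules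
`V_l = k, V_{l-1}, …, V_0 = ρ` such that `V_i = Ω_{D/D_i}(V_{i+1})` if `α_i = 1` and
`V_i = V_{i+1}` if `α_i = 0` (up to isomorphism). -/
def IsWD {k : Type u} [Field k] {l : ℕ} (α : Fin l → Fin 2) {V : Type u} [AddCommGroup V]
    [Module k V] (ρ : Representation k D V) : Prop :=
  ∃ A : Fin (l + 1) → Rep.{u} k D,
    Nonempty ((A (Fin.last l)).ρ.Equiv (Representation.trivial k D k)) ∧
    Nonempty ((A 0).ρ.Equiv ρ) ∧
    ∀ i : Fin l,
      (α i = 0 → Nonempty ((A i.castSucc).ρ.Equiv (A i.succ).ρ)) ∧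
      (α i = 1 → IsRelHeller (cycSubgroup p D i) (A i.castSucc).ρ (A i.succ).ρ)

end Cyclic

end

end CyclicDade

/-! The proof translates everything into divisors of `X ^ p ^ l - 1`. Let `g` generate the cyclic
group `D`. Modules of `D` that are free over `R` and generated by one element are the quotients
`R[X] ⧸ (f)` with `f` monic dividing `X ^ p ^ l - 1` and `g` acting by `X`. Over the residue field
`k` they are the Jordan blocks `k[X] ⧸ ((X - 1) ^ n)`, `n ≤ p ^ l`, that is, all indecomposable
modules. By Higman's criterion (`isRelProjective_iff`) such a block is relatively projective for a
proper subgroup exactly if `p ∣ n` (`isRelProjective_of_dvd_natDegree`,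
`IsRelProjective.index_dvd_finrank`), so that capped means `p ∤ n`. If `f * F = X ^ p ^ m - 1`, then
the kernel of `R[X] ⧸ (X ^ p ^ m - 1) → R[X] ⧸ (f)` is `R[X] ⧸ (F)`, and over `k` this is the
translation `Ω` relative to the subgroup of index `p ^ m` (`isRelHeller_cyclicRep`), unique by
`IsRelHeller.equiv`. Hence `W_D(α)` is `k[X] ⧸ (f)` for the polynomial `f = stdPoly` obtained by
iterating `f ↦ (X ^ p ^ m - 1) / f` (`isWD_iff`); it is defined over `ℤ`, so that `O[X] ⧸ (f)` is a
lift.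

Over every local ring considered, `End (R[X] ⧸ (f))` is a permutation module for all these `f`,
because the property of having an endomorphism module that is a summand of a permutation module
passes to syzygies: from a sequence `0 → T' → A → T → 0` with `A` projective, `End T'` is a summand
of `End T × Hom(T', A)` (`exists_end_summand`, `IsPermSummand.conjRoot_cofactor`), and over a local
ring whose residue field has characteristic `p` such summands are permutation modules
(`IsPermSummand.isPermEnd`).

Conversely, if `End (k[X] ⧸ ((X - 1) ^ n))` is a permutation module, then `n ≤ p ^ j` or
`(p - 1) * p ^ j ≤ n` for all `j` (`le_or_le_of_isPermSummand_conjRoot`). For `n ≤ p ^ l` this says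
that `n ≤ p ^ (l - 1)` or `p ^ l - n ≤ p ^ (l - 1)`, and in the second case the syzygy of size
`p ^ l - n` is again of this kind; by induction on `l` every capped block is standard
(`exists_natDegree_stdPoly_eq`). The same induction identifies the lattices of determinant one
(`exists_stdPolyIn_eq`), since such a lattice of rank at most `p ^ (l - 1)` is inflated from the
quotient of order `p ^ (l - 1)` (`dvd_X_pow_sub_one_of_natDegree_le`); so the lift is unique.

The character of the standard lattice at `g ^ s` is the integer `stdTrace`: a translation relative
to the subgroup of index `p ^ m` replaces it by its difference from `p ^ m` if `p ^ m ∣ s`, and from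
`0` otherwise. As long as `p ^ m ∣ s` the value is the rank of a lattice, hence positive, and each
later translation changes the sign (`stdTrace_add`, `omega_generator`). The sign vector thus lists
the parities of the partial sums of the `α i`, and these determine the `α i`
(`bijective_partialSigns`). -/

namespace CyclicDade

/-! ### Permutation modules of cyclic groups and their direct summands -/

section PermutationSummands

variable {R : Type*} [CommRing R] {V : Type*} [AddCommGroup V] [Module R V]

/-- A permuted basis of an endomorphism: the endomorphism-level form of `IsPermutation` for a cyclic
group, `a` being the action of a generator. -/
def IsPermEnd (a : Module.End R V) : Prop :=
  ∃ (ι : Type) (_ : Fintype ι) (b : Module.Basis ι R V), ∀ i, ∃ j, a (b i) = b j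

/-- `(V, a)` is a direct summand of `R^ι` with the endomorphism given by a permutation `σ` of `ι`
of `p`-power order. -/
def IsPermSummand (p : ℕ) (a : Module.End R V) : Prop :=
  ∃ (ι : Type) (_ : Fintype ι) (σ : Equiv.Perm ι) (N : ℕ) (i : V →ₗ[R] (ι → R))
    (r : (ι → R) →ₗ[R] V), σ ^ p ^ N = 1 ∧ (∀ v, i (a v) = i v ∘ σ) ∧
      (∀ f, r (f ∘ σ) = a (r f)) ∧ ∀ v, r (i v) = v

theorem IsPermEnd.isPermSummand [Nontrivial R] {p N : ℕ} (hp : 0 < p) {a : Module.End R V}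
    (h : IsPermEnd a) (ha : a ^ p ^ N = 1) : IsPermSummand p a := by
  classical
  obtain ⟨ι, _, b, hb⟩ := h
  choose τ hτ using hb
  have hpow : ∀ m i, (a ^ m) (b i) = b (τ^[m] i) := by
    intro m
    induction m with
    | zero => intro i; simp
    | succ m ih => intro i; rw [pow_succ', Module.End.mul_apply, ih, hτ, Function.iterate_succ_apply']
  have hq : ∀ i, τ^[p ^ N] i = i := fun i => b.injective (by rw [← hpow, ha]; rfl)
  have hq1 : p ^ N = (p ^ N - 1) + 1 := (Nat.succ_pred_eq_of_pos (pow_pos hp N)).symm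
  let σ : Equiv.Perm ι :=
    ⟨τ^[p ^ N - 1], τ, fun i => by
      rw [← Function.iterate_succ_apply' τ, Nat.succ_eq_add_one, ← hq1, hq], fun i => by
      rw [← Function.iterate_succ_apply τ, Nat.succ_eq_add_one, ← hq1, hq]⟩
  have hσsymm : ∀ m i, ((σ⁻¹) ^ m : Equiv.Perm ι) i = τ^[m] i := by
    intro m
    induction m with
    | zero => intro i; rfl
    | succ m ih =>
      intro i
      rw [pow_succ', Equiv.Perm.mul_apply, ih, Function.iterate_succ_apply']; rfl
  refine ⟨ι, inferInstance, σ, N, b.equivFun.toLinearMap, b.equivFun.symm.toLinearMap, ?_, ?_, ?_, ?_⟩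
  · rw [← inv_inj, inv_one, ← inv_pow]
    ext i
    rw [hσsymm, hq]; rfl
  · intro v
    have key : b.equivFun.toLinearMap ∘ₗ a = (LinearMap.funLeft R R σ) ∘ₗ b.equivFun.toLinearMap := by
      refine b.ext fun i => ?_
      ext j
      simp only [LinearMap.comp_apply, hτ, LinearEquiv.coe_coe, Module.Basis.equivFun_self,
        LinearMap.funLeft_apply]
      have : τ i = j ↔ i = σ j := by
        constructor
        · rintro rfl; exact (σ.apply_symm_apply i).symm
        · rintro rfl; exact σ.symm_apply_apply j
      simp only [this]
    exact LinearMap.congr_fun key v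
  · intro f
    have key : b.equivFun.symm.toLinearMap ∘ₗ (LinearMap.funLeft R R σ) =
        a ∘ₗ b.equivFun.symm.toLinearMap := by
      refine (Pi.basisFun R ι).ext fun i => ?_
      have : (LinearMap.funLeft R R σ) (Pi.single i 1) = Pi.single (τ i) 1 := by
        ext j
        have : j = τ i ↔ σ j = i := by
          constructor
          · rintro rfl; exact σ.apply_symm_apply i
          · rintro rfl; exact (σ.symm_apply_apply j).symm
        simp [LinearMap.funLeft_apply, Pi.single_apply, this]
      simp only [Pi.basisFun_apply, LinearMap.comp_apply, this, LinearEquiv.coe_coe,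
        Module.Basis.equivFun_symm_apply, Pi.single_apply, ite_smul, one_smul, zero_smul,
        Finset.sum_ite_eq', Finset.mem_univ, if_true, hτ]
    exact LinearMap.congr_fun key f
  · intro v; simp

theorem IsPermSummand.of_summand {p : ℕ} {W : Type*} [AddCommGroup W] [Module R W]
    {a : Module.End R V} {c : Module.End R W} (h : IsPermSummand p c)
    (i : V →ₗ[R] W) (r : W →ₗ[R] V) (hi : ∀ v, i (a v) = c (i v)) (hr : ∀ w, r (c w) = a (r w))
    (hri : ∀ v, r (i v) = v) : IsPermSummand p a := by
  obtain ⟨ι, _, σ, N, i', r', hσ, hi', hr', hri'⟩ := h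
  exact ⟨ι, inferInstance, σ, N, i' ∘ₗ i, r ∘ₗ r', hσ, fun v => by simp [hi, hi'],
    fun f => by simp [hr', hr], fun v => by simp [hri', hri]⟩

theorem IsPermSummand.prod {p : ℕ} {W : Type*} [AddCommGroup W] [Module R W]
    {a : Module.End R V} {c : Module.End R W} (h : IsPermSummand p a) (h' : IsPermSummand p c) :
    IsPermSummand p (LinearMap.prodMap a c) := by
  obtain ⟨ι, _, σ, N, i, r, hσ, hi, hr, hri⟩ := h
  obtain ⟨ι', _, σ', N', i', r', hσ', hi', hr', hri'⟩ := h'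
  refine ⟨ι ⊕ ι', inferInstance, Equiv.sumCongr σ σ', N + N',
    (LinearEquiv.sumArrowLequivProdArrow ι ι' R R).symm.toLinearMap ∘ₗ LinearMap.prodMap i i',
    LinearMap.prodMap r r' ∘ₗ (LinearEquiv.sumArrowLequivProdArrow ι ι' R R).toLinearMap,
    ?_, ?_, ?_, ?_⟩
  · have h1 : σ ^ p ^ (N + N') = 1 := by rw [pow_add, pow_mul, hσ, one_pow]
    have h2 : σ' ^ p ^ (N + N') = 1 := by rw [add_comm, pow_add, pow_mul, hσ', one_pow]
    have : ∀ m : ℕ, (Equiv.sumCongr σ σ' : Equiv.Perm (ι ⊕ ι')) ^ m =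
        Equiv.sumCongr (σ ^ m) (σ' ^ m) := by
      intro m
      exact (map_pow (Equiv.Perm.sumCongrHom ι ι') (σ, σ') m).symm
    rw [this, h1, h2]; ext x; cases x <;> rfl
  · intro v
    ext x
    cases x <;> simp [hi, hi']
  · intro f
    ext
    · simp only [LinearMap.comp_apply, LinearMap.prodMap_apply]
      exact hr fun x => f (Sum.inl x)
    · simp only [LinearMap.comp_apply, LinearMap.prodMap_apply]
      exact hr' fun x => f (Sum.inr x)
  · intro v; ext <;> simp [hri, hri']

theorem IsPermSummand.iterate_inj {ι : Type*} {σ : Equiv.Perm ι} {a : Module.End R V}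
    {i : V →ₗ[R] (ι → R)} (hi : ∀ v, i (a v) = i v ∘ σ) (m : ℕ) (v : V) :
    i ((a ^ m) v) = i v ∘ (σ ^ m : Equiv.Perm ι) := by
  induction m with
  | zero => rfl
  | succ m ih => rw [pow_succ', Module.End.mul_apply, hi, ih, pow_succ]; rfl

theorem IsPermSummand.iterate_surj {ι : Type*} {σ : Equiv.Perm ι} {a : Module.End R V}
    {r : (ι → R) →ₗ[R] V} (hr : ∀ f, r (f ∘ σ) = a (r f)) (m : ℕ) (f : ι → R) :
    r (f ∘ (σ ^ m : Equiv.Perm ι)) = (a ^ m) (r f) := by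
  induction m generalizing f with
  | zero => rfl
  | succ m ih => rw [pow_succ', pow_succ, Module.End.mul_apply]; exact (ih (f ∘ σ)).trans (by
      rw [hr, ← Module.End.mul_apply, ← pow_succ, pow_succ', Module.End.mul_apply])

theorem IsPermSummand.pow {p : ℕ} {a : Module.End R V} (h : IsPermSummand p a) (m : ℕ) :
    IsPermSummand p (a ^ m) := by
  obtain ⟨ι, _, σ, N, i, r, hσ, hi, hr, hri⟩ := h
  refine ⟨ι, inferInstance, σ ^ m, N, i, r, ?_, fun v => iterate_inj hi m v,
    fun f => iterate_surj hr m f, hri⟩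
  rw [← pow_mul, mul_comm, pow_mul, hσ, one_pow]

theorem IsPermSummand.exists_pow_eq_one {p : ℕ} {a : Module.End R V} (h : IsPermSummand p a) :
    ∃ N, a ^ p ^ N = 1 := by
  obtain ⟨ι, _, σ, N, i, r, hσ, hi, hr, hri⟩ := h
  refine ⟨N, LinearMap.ext fun v => ?_⟩
  rw [← hri ((a ^ p ^ N) v), iterate_inj hi, hσ]
  exact hri v

theorem dvd_of_zpow_fixed {p i N : ℕ} (hp : p.Prime) {ι : Type*} {σ : Equiv.Perm ι}
    (hσ : σ ^ p ^ N = 1) {x : ι} (hx : (σ ^ p ^ i : Equiv.Perm ι) x ≠ x) {z : ℤ}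
    (hz : (σ ^ z : Equiv.Perm ι) x = x) : ((p ^ (i + 1) : ℕ) : ℤ) ∣ z := by
  obtain ⟨j, hj, hgcd⟩ := (Nat.dvd_prime_pow hp).1 (Nat.gcd_dvd_right z.natAbs (p ^ N))
  have hfix : ∀ m : ℤ, (p ^ j : ℕ) ∣ m.natAbs → (σ ^ m : Equiv.Perm ι) x = x := by
    have hmul : ∀ m c : ℤ, (σ ^ m : Equiv.Perm ι) x = x → (σ ^ (m * c) : Equiv.Perm ι) x = x := by
      intro m c hm
      rw [zpow_mul]
      exact Equiv.Perm.zpow_apply_eq_self_of_apply_eq_self hm c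
    intro m hm
    have h2 : (σ ^ ((p ^ N : ℕ) : ℤ) : Equiv.Perm ι) x = x := by rw [zpow_natCast, hσ]; rfl
    have h3 : ((p ^ j : ℕ) : ℤ) =
        z * Int.gcdA z (p ^ N : ℕ) + (p ^ N : ℕ) * Int.gcdB z (p ^ N : ℕ) := by
      rw [← Int.gcd_eq_gcd_ab, ← hgcd]; rfl
    obtain ⟨c, rfl⟩ : ((p ^ j : ℕ) : ℤ) ∣ m := Int.natCast_dvd.2 hm
    apply hmul
    rw [h3, zpow_add, Equiv.Perm.mul_apply, hmul _ _ h2, hmul _ _ hz]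
  by_cases hij : j ≤ i
  · refine absurd ?_ hx
    rw [← zpow_natCast]
    exact hfix _ (by rw [Int.natAbs_natCast]; exact pow_dvd_pow p hij)
  · have : p ^ j ∣ z.natAbs := hgcd ▸ Nat.gcd_dvd_left _ _
    exact Int.natCast_dvd.2 ((pow_dvd_pow p (by omega)).trans this)

theorem exists_norm_of_fixed {p i N : ℕ} (hp : p.Prime) {ι : Type*} {σ : Equiv.Perm ι}
    (hσ : σ ^ p ^ N = 1) {f w : ι → R} (hf : f ∘ σ = f)
    (hw : f = w ∘ (σ ^ p ^ i : Equiv.Perm ι) - w) :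
    ∃ w' : ι → R, f = ∑ t ∈ Finset.range (p ^ (i + 1)), w' ∘ (σ ^ t : Equiv.Perm ι) := by
  classical
  have hfz : ∀ (z : ℤ) x, f ((σ ^ z : Equiv.Perm ι) x) = f x := by
    intro z x
    induction z using Int.induction_on generalizing x with
    | zero => rfl
    | succ n ih => rw [zpow_add_one, Equiv.Perm.mul_apply, ih]; exact congrFun hf x
    | pred n ih =>
      rw [zpow_sub_one, Equiv.Perm.mul_apply, ih]
      conv_rhs => rw [← σ.apply_symm_apply x]
      exact (congrFun hf (σ.symm x)).symm
  let rep : ι → ι := fun x => (Quotient.mk (Equiv.Perm.SameCycle.setoid σ) x).out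
  have hrep : ∀ x, ∃ c : ℤ, (σ ^ c : Equiv.Perm ι) (rep x) = x := fun x =>
    Quotient.exact (Quotient.out_eq (Quotient.mk (Equiv.Perm.SameCycle.setoid σ) x))
  have hrepz : ∀ (z : ℤ) x, rep ((σ ^ z : Equiv.Perm ι) x) = rep x := by
    intro z x
    refine congrArg Quotient.out (Quotient.sound (s := Equiv.Perm.SameCycle.setoid σ) ?_)
    exact Equiv.Perm.SameCycle.symm ⟨z, rfl⟩
  let w' : ι → R := fun x =>
    if ∃ s : ℤ, (σ ^ (((p ^ (i + 1) : ℕ) : ℤ) * s) : Equiv.Perm ι) (rep x) = x then f x else 0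
  refine ⟨w', funext fun x => ?_⟩
  rw [Finset.sum_apply]
  by_cases hx : (σ ^ p ^ i : Equiv.Perm ι) x = x
  · have h0 : f x = 0 := by rw [hw]; simp [hx]
    rw [h0, Finset.sum_eq_zero]
    intro t _
    have := hfz t x
    simp only [zpow_natCast] at this
    simp [w', this, h0]
  · obtain ⟨c, hc⟩ := hrep x
    have hpos : (0 : ℤ) < (p ^ (i + 1) : ℕ) := by exact_mod_cast pow_pos hp.pos _
    obtain ⟨t0, ht0⟩ : ∃ t0 : ℕ, (t0 : ℤ) = (-c) % (p ^ (i + 1) : ℕ) :=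
      ⟨((-c) % (p ^ (i + 1) : ℕ)).toNat, Int.toNat_of_nonneg (Int.emod_nonneg _ hpos.ne')⟩
    have ht0lt : t0 < p ^ (i + 1) := by
      have := Int.emod_lt_of_pos (-c) hpos
      rw [← ht0] at this; exact_mod_cast this
    have hdiv : ((p ^ (i + 1) : ℕ) : ℤ) ∣ t0 + c := by
      rw [ht0]
      have := Int.emod_add_mul_ediv (-c) (p ^ (i + 1) : ℕ)
      exact ⟨-((-c) / (p ^ (i + 1) : ℕ)), by linarith⟩
    rw [Finset.sum_eq_single t0]
    · obtain ⟨s, hs⟩ := hdiv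
      have hr := hrepz t0 x
      have hfx := hfz t0 x
      rw [zpow_natCast] at hr hfx
      have : ∃ s : ℤ, (σ ^ (((p ^ (i + 1) : ℕ) : ℤ) * s) : Equiv.Perm ι)
          (rep ((σ ^ t0 : Equiv.Perm ι) x)) = (σ ^ t0 : Equiv.Perm ι) x := by
        refine ⟨s, ?_⟩
        rw [hr, ← hs, zpow_add, Equiv.Perm.mul_apply, hc, zpow_natCast]
      simp only [w', Function.comp_apply, if_pos this, hfx]
    · intro t ht hne
      simp only [w', Function.comp_apply]
      rw [if_neg]
      rintro ⟨s, hs⟩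
      have hr := hrepz t x
      rw [zpow_natCast] at hr
      rw [hr] at hs
      apply hne
      have hfix : (σ ^ (((p ^ (i + 1) : ℕ) : ℤ) * s - c - t) : Equiv.Perm ι) x = x := by
        have h2 : (σ ^ (-c) : Equiv.Perm ι) x = rep x := by
          rw [zpow_neg]; exact Equiv.Perm.inv_eq_iff_eq.2 hc.symm
        rw [show ((p ^ (i + 1) : ℕ) : ℤ) * s - c - t = -t + (((p ^ (i + 1) : ℕ) : ℤ) * s + -c) by ring,
          zpow_add, Equiv.Perm.mul_apply, zpow_add, Equiv.Perm.mul_apply, h2, hs, zpow_neg,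
          zpow_natCast, ← Equiv.Perm.mul_apply, inv_mul_cancel, Equiv.Perm.one_apply]
      have hd := dvd_of_zpow_fixed hp hσ hx hfix
      have hd2 : ((p ^ (i + 1) : ℕ) : ℤ) ∣ (t : ℤ) - t0 := by
        have h4 := dvd_sub (dvd_mul_right ((p ^ (i + 1) : ℕ) : ℤ) s) (dvd_add hd hdiv)
        rwa [show ((p ^ (i + 1) : ℕ) : ℤ) * s - (((p ^ (i + 1) : ℕ) : ℤ) * s - c - t + (t0 + c)) =
          t - t0 by ring] at h4
      have hlt := Finset.mem_range.1 ht
      exact (Nat.ModEq.eq_of_lt_of_lt ((Nat.modEq_iff_dvd.2 hd2)) ht0lt hlt).symm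
    · intro h; exact absurd (Finset.mem_range.2 ht0lt) h

/-- In a permutation module of a cyclic `p`-group with generator `a`, a fixed vector that lies in
the image of `a ^ p ^ i - 1` is supported on orbits of length at least `p ^ (i + 1)`, hence is the
sum of the first `p ^ (i + 1)` translates of a vector. -/
theorem IsPermSummand.exists_norm {p : ℕ} (hp : p.Prime) {a : Module.End R V}
    (h : IsPermSummand p a) (i : ℕ) {v w : V} (hv : a v = v) (hw : v = (a ^ p ^ i) w - w) :
    ∃ w' : V, v = ∑ t ∈ Finset.range (p ^ (i + 1)), (a ^ t) w' := by
  obtain ⟨ι, _, σ, N, i', r, hσ, hi, hr, hri⟩ := h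
  obtain ⟨f, hf⟩ := exists_norm_of_fixed (f := i' v) (w := i' w) hp hσ (by rw [← hi, hv])
    (by conv_lhs => rw [hw, map_sub, iterate_inj hi])
  refine ⟨r f, ?_⟩
  rw [← hri v, hf, map_sum]
  exact Finset.sum_congr rfl fun t _ => iterate_surj hr t f

end PermutationSummands

section BaseChangeSummands

variable {R S : Type*} [CommRing R] [CommRing S] [Algebra R S] {V V' : Type*} [AddCommGroup V]
  [Module R V] [AddCommGroup V'] [Module R V'] [Module S V'] [IsScalarTower R S V']

theorem IsPermEnd.of_isBaseChange {j : V →ₗ[R] V'} (hj : IsBaseChange S j) {a : Module.End R V}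
    {a' : Module.End S V'} (haa : ∀ v, j (a v) = a' (j v)) (h : IsPermEnd a) : IsPermEnd a' := by
  obtain ⟨ι, _, b, hb⟩ := h
  refine ⟨ι, inferInstance, hj.basis b, fun i => ?_⟩
  obtain ⟨k, hk⟩ := hb i
  exact ⟨k, by rw [hj.basis_apply, hj.basis_apply, ← haa, hk]⟩

theorem IsPermSummand.exists_baseChange {j : V →ₗ[R] V'} (hj : IsBaseChange S j) {ι : Type*}
    (i : V →ₗ[R] (ι → R)) :
    ∃ i' : V' →ₗ[S] (ι → S), ∀ v, i' (j v) = algebraMap R S ∘ i v :=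
  ⟨hj.lift (((Algebra.linearMap R S).compLeft ι) ∘ₗ i), fun v => by rw [hj.lift_eq]; rfl⟩

theorem IsPermSummand.of_isBaseChange {p : ℕ} {j : V →ₗ[R] V'} (hj : IsBaseChange S j)
    {a : Module.End R V} {a' : Module.End S V'} (haa : ∀ v, j (a v) = a' (j v))
    (h : IsPermSummand p a) : IsPermSummand p a' := by
  classical
  obtain ⟨ι, _, σ, N, i, r, hσ, hi, hr, hri⟩ := h
  obtain ⟨i', hi'⟩ := exists_baseChange hj i
  let r' : (ι → S) →ₗ[S] V' := (Pi.basisFun S ι).constr S fun x => j (r (Pi.single x 1))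
  have hr' : ∀ f : ι → R, r' (algebraMap R S ∘ f) = j (r f) := by
    intro f
    conv_rhs => rw [← Finset.univ_sum_single f, map_sum, map_sum]
    rw [Module.Basis.constr_apply_fintype]
    refine Finset.sum_congr rfl fun x _ => ?_
    rw [Module.Basis.equivFun_apply, Pi.basisFun_repr, Function.comp_apply, algebraMap_smul,
      ← map_smul, ← map_smul, ← Pi.single_smul, smul_eq_mul, mul_one]
  refine ⟨ι, inferInstance, σ, N, i', r', hσ, ?_, ?_, ?_⟩
  · intro v
    induction v using hj.inductionOn with
    | zero => simp
    | tmul v => rw [← haa, hi', hi', hi]; rfl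
    | smul s v hv => rw [map_smul, map_smul, hv, map_smul]; rfl
    | add v w hv hw => rw [map_add, map_add, hv, hw, map_add]; rfl
  · intro f
    have : r' ∘ₗ LinearMap.funLeft S S σ = a' ∘ₗ r' := by
      refine (Pi.basisFun S ι).ext fun x => ?_
      have h1 : (Pi.single x 1 : ι → S) = algebraMap R S ∘ Pi.single x 1 := by
        ext y; by_cases h : y = x <;> simp [h]
      rw [Pi.basisFun_apply, LinearMap.comp_apply, LinearMap.comp_apply, h1, hr', ← haa, ← hr, ← hr']
      rfl
    exact LinearMap.congr_fun this f
  · intro v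
    induction v using hj.inductionOn with
    | zero => simp
    | tmul v => rw [hi', hr', hri]
    | smul s v hv => rw [map_smul, map_smul, hv]
    | add v w hv hw => rw [map_add, map_add, hv, hw]

/-- Fixed points of a permutation module lift along a surjective extension of scalars. -/
theorem IsPermSummand.exists_fixed_lift {p : ℕ} (hS : Function.Surjective (algebraMap R S))
    {j : V →ₗ[R] V'} (hj : IsBaseChange S j) {a : Module.End R V} {a' : Module.End S V'}
    (haa : ∀ v, j (a v) = a' (j v)) (h : IsPermSummand p a) {v' : V'} (hv' : a' v' = v') :
    ∃ v, a v = v ∧ j v = v' := by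
  classical
  obtain ⟨ι, _, σ, N, i, r, hσ, hi, hr, hri⟩ := h
  obtain ⟨i', hi'⟩ := exists_baseChange hj i
  have hjs : Function.Surjective j := by
    intro w
    induction w using hj.inductionOn with
    | zero => exact ⟨0, map_zero j⟩
    | tmul v => exact ⟨v, rfl⟩
    | smul s v hv =>
      obtain ⟨x, rfl⟩ := hv
      obtain ⟨s, rfl⟩ := hS s
      exact ⟨s • x, by rw [map_smul, algebraMap_smul]⟩
    | add v w hv hw =>
      obtain ⟨x, rfl⟩ := hv
      obtain ⟨y, rfl⟩ := hw
      exact ⟨x + y, map_add _ _ _⟩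
  obtain ⟨v0, rfl⟩ := hjs v'
  obtain ⟨sec, hsec⟩ := hS.hasRightInverse
  let f : ι → R := sec ∘ i' (j v0)
  have hf : f ∘ σ = f := by
    have : i' (j v0) ∘ σ = i' (j v0) := by
      conv_rhs => rw [← hv', ← haa, hi', hi]
      rw [hi']; rfl
    calc f ∘ σ = sec ∘ (i' (j v0) ∘ σ) := rfl
      _ = f := by rw [this]
  refine ⟨r f, by rw [← hr, hf], ?_⟩
  have hker : ∀ g : ι → R, (∀ x, algebraMap R S (g x) = 0) → j (r g) = 0 := by
    intro g hg
    rw [← Finset.univ_sum_single g, map_sum, map_sum]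
    refine Finset.sum_eq_zero fun x _ => ?_
    have : (Pi.single x (g x) : ι → R) = g x • Pi.single x 1 := by
      rw [← Pi.single_smul, smul_eq_mul, mul_one]
    rw [this, map_smul, map_smul, ← algebraMap_smul S (g x), hg, zero_smul]
  have := hker (f - i v0) fun x => by
    simp only [Pi.sub_apply, map_sub, f, Function.comp_apply, hsec _, hi', sub_self]
  rw [map_sub, map_sub, hri, sub_eq_zero] at this
  exact this

end BaseChangeSummands

open Polynomial

/-! ### Jordan blocks of permutation modules -/

section Jordan

variable {k : Type*} [Field k] {V : Type*} [AddCommGroup V] [Module k V]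

/-- Jordan decomposition of a unipotent endomorphism `a`: as a `k[X]`-module, with `X` acting by
`a`, the space is a direct sum of modules `k[X] ⧸ (X - 1) ^ n i`, generated by vectors `e i`. -/
theorem exists_jordan_decomposition [FiniteDimensional k V] {a : Module.End k V} {m : ℕ}
    (ha : (a - 1) ^ m = 0) :
    ∃ (ι : Type) (_ : Fintype ι) (e : ι → V) (n : ι → ℕ), (∀ i, 0 < n i) ∧
      (∀ v, ∃ P : ι → k[X], v = ∑ i, aeval a (P i) (e i)) ∧
      ∀ P : ι → k[X], ∑ i, aeval a (P i) (e i) = 0 ↔ ∀ i, (X - 1) ^ n i ∣ P i := by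
  classical
  have haX : aeval a ((X - 1 : k[X]) ^ m) = 0 := by simp [ha]
  have hX1 : Prime (X - 1 : k[X]) := by simpa using prime_X_sub_C (1 : k)
  have hne : ((X - 1 : k[X]) ^ m) ≠ 0 := pow_ne_zero _ hX1.ne_zero
  have hkill : ∀ v : Module.AEval' a, ((X - 1 : k[X]) ^ m) • v = 0 := by
    intro v
    obtain ⟨v, rfl⟩ := (Module.AEval'.of a).surjective v
    exact (Module.AEval.of_aeval_smul (a := a) _ v).symm.trans (by rw [haX, zero_smul, map_zero])
  have htor : Module.IsTorsion k[X] (Module.AEval' a) := by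
    intro v
    exact ⟨⟨_, mem_nonZeroDivisors_of_ne_zero hne⟩, hkill v⟩
  obtain ⟨ι, _, p, hp, e, ⟨φ⟩⟩ := Module.equiv_directSum_of_isTorsion htor
  have hpe : ∀ i, ∃ n, n ≤ m ∧ Associated (p i ^ e i) ((X - 1) ^ n) := by
    intro i
    refine (dvd_prime_pow hX1 m).1 ?_
    have h1 := hkill (φ.symm (DirectSum.lof k[X] ι _ i (Submodule.Quotient.mk 1)))
    rw [← map_smul, LinearEquiv.map_eq_zero_iff, ← map_smul] at h1
    have h2 := congrArg (DirectSum.component k[X] ι _ i) h1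
    rw [DirectSum.component.lof_self, map_zero, ← Submodule.Quotient.mk_smul,
      Submodule.Quotient.mk_eq_zero, smul_eq_mul, mul_one, Submodule.mem_span_singleton] at h2
    obtain ⟨c, hc⟩ := h2
    exact ⟨c, by rw [← hc, smul_eq_mul, mul_comm]⟩
  choose n hn hassoc using hpe
  let ε : ι → V := fun i => (Module.AEval'.of a).symm
    (φ.symm (DirectSum.lof k[X] ι (fun i => k[X] ⧸ Submodule.span k[X] {p i ^ e i}) i
      (Submodule.Quotient.mk 1)))
  have hsum : ∀ P : ι → k[X], ∑ i, aeval a (P i) (ε i) = (Module.AEval'.of a).symm (φ.symm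
      (∑ i, DirectSum.lof k[X] ι (fun i => k[X] ⧸ Submodule.span k[X] {p i ^ e i}) i
        (Submodule.Quotient.mk (P i)))) := by
    intro P
    rw [map_sum, map_sum]
    refine Finset.sum_congr rfl fun i _ => ?_
    rw [show (Submodule.Quotient.mk (P i) : k[X] ⧸ Submodule.span k[X] {p i ^ e i}) =
      P i • Submodule.Quotient.mk 1 by rw [← Submodule.Quotient.mk_smul, smul_eq_mul, mul_one],
      map_smul, map_smul]
    exact (Module.AEval.of_symm_smul (a := a) (P i) _).symm
  have hsurj : ∀ v, ∃ P : ι → k[X], v = ∑ i, aeval a (P i) (ε i) := by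
    intro v
    have : ∀ i, ∃ P : k[X], Submodule.Quotient.mk P = (φ (Module.AEval'.of a v)) i :=
      fun i => Submodule.Quotient.mk_surjective _ _
    choose P hP using this
    refine ⟨P, ?_⟩
    rw [hsum]
    simp only [hP]
    rw [show (∑ i, DirectSum.lof k[X] ι (fun i => k[X] ⧸ Submodule.span k[X] {p i ^ e i}) i
      (φ (Module.AEval'.of a v) i)) = φ (Module.AEval'.of a v) from DirectSum.sum_univ_of _]
    simp
  have hker : ∀ P : ι → k[X], ∑ i, aeval a (P i) (ε i) = 0 ↔ ∀ i, (X - 1) ^ n i ∣ P i := by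
    intro P
    rw [hsum, LinearEquiv.map_eq_zero_iff, LinearEquiv.map_eq_zero_iff]
    have : ∀ i, DirectSum.component k[X] ι _ i
        (∑ i, DirectSum.lof k[X] ι (fun i => k[X] ⧸ Submodule.span k[X] {p i ^ e i}) i
        (Submodule.Quotient.mk (P i))) = Submodule.Quotient.mk (P i) := by
      intro i
      rw [map_sum, Finset.sum_eq_single i]
      · rw [DirectSum.component.lof_self]
      · intro j _ hj
        rw [DirectSum.component.of, dif_neg hj]
      · intro h; exact absurd (Finset.mem_univ i) h
    constructor
    · intro h i
      have h1 := this i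
      rw [h, map_zero] at h1
      have h2 := (Submodule.Quotient.mk_eq_zero _).1 h1.symm
      rw [Submodule.mem_span_singleton] at h2
      obtain ⟨c, hc⟩ := h2
      exact (hassoc i).symm.dvd.trans ⟨c, by rw [← hc, smul_eq_mul, mul_comm]⟩
    · intro h
      refine Finset.sum_eq_zero fun i _ => ?_
      rw [(Submodule.Quotient.mk_eq_zero _).2, map_zero]
      obtain ⟨c, hc⟩ := (hassoc i).dvd.trans (h i)
      exact Submodule.mem_span_singleton.2 ⟨c, by rw [hc, smul_eq_mul, mul_comm]⟩
  -- discard the zero summands and move the index type to `Type`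
  let ι' := {i : ι // 0 < n i}
  let eqv := Fintype.equivFin ι'
  have hext : ∀ P : Fin (Fintype.card ι') → k[X], ∑ x, aeval a (P x) (ε (eqv.symm x).1) =
      ∑ i, aeval a (if h : 0 < n i then P (eqv ⟨i, h⟩) else 0) (ε i) := by
    intro P
    rw [← Finset.sum_subset (Finset.subset_univ (Finset.univ.filter fun i => 0 < n i))]
    · rw [Finset.sum_subtype (p := fun i => 0 < n i) _ (by simp)]
      refine Fintype.sum_equiv eqv.symm _ _ fun x => ?_
      rw [dif_pos (eqv.symm x).2]
      simp
    · intro i _ hi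
      rw [dif_neg (by simpa using hi)]
      simp
  refine ⟨Fin (Fintype.card ι'), inferInstance, fun x => ε (eqv.symm x).1,
    fun x => n (eqv.symm x).1, fun x => (eqv.symm x).2, ?_, ?_⟩
  · intro v
    obtain ⟨P, rfl⟩ := hsurj v
    refine ⟨fun x => P (eqv.symm x).1, ?_⟩
    rw [hext, ← sub_eq_zero, ← Finset.sum_sub_distrib]
    simp only [← LinearMap.sub_apply, ← map_sub]
    rw [hker]
    intro i
    by_cases h : 0 < n i
    · simp [h]
    · have : n i = 0 := by omega
      simp [this]
  · intro P
    rw [hext, hker]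
    constructor
    · intro h x
      have := h (eqv.symm x).1
      rw [dif_pos (eqv.symm x).2] at this
      simpa using this
    · intro h i
      split_ifs with hi
      · simpa using h (eqv ⟨i, hi⟩)
      · exact dvd_zero _

theorem geom_sum_eq_sub_one_pow (p : ℕ) [Fact p.Prime] [CharP k p] (m : ℕ) :
    ∑ t ∈ Finset.range (p ^ m), (X : k[X]) ^ t = (X - 1) ^ (p ^ m - 1) := by
  have hX1 : (X - 1 : k[X]) ≠ 0 := by simpa using X_sub_C_ne_zero (1 : k)
  refine mul_right_cancel₀ hX1 ?_
  rw [geom_sum_mul, ← pow_succ, Nat.sub_add_cancel (Nat.one_le_pow _ _ (Fact.out : p.Prime).pos),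
    sub_pow_char_pow, one_pow]

theorem unipotent_of_pow_eq_one {p : ℕ} [Fact p.Prime] [CharP k p] {a : Module.End k V} {N : ℕ}
    (ha : a ^ p ^ N = 1) : (a - 1) ^ p ^ N = 0 := by
  have : aeval a ((X - 1 : k[X]) ^ p ^ N) = aeval a (X ^ p ^ N - 1 : k[X]) := by
    rw [sub_pow_char_pow, one_pow]
  simpa [ha] using this

/-- The Jordan blocks of a direct summand of a permutation module of a cyclic `p`-group over a field
of characteristic `p` have `p`-power sizes. -/
theorem IsPermSummand.exists_jordan_decomposition {p : ℕ} [Fact p.Prime] [CharP k p]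
    [FiniteDimensional k V] {a : Module.End k V} (h : IsPermSummand p a) :
    ∃ (ι : Type) (_ : Fintype ι) (e : ι → V) (n : ι → ℕ),
      (∀ v, ∃ P : ι → k[X], v = ∑ i, aeval a (P i) (e i)) ∧
      ∀ P : ι → k[X], ∑ i, aeval a (P i) (e i) = 0 ↔ ∀ i, X ^ p ^ n i - 1 ∣ P i := by
  classical
  have hp : p.Prime := Fact.out
  obtain ⟨N, hN⟩ := h.exists_pow_eq_one
  obtain ⟨ι, _, e, n, hpos, hsurj, hker⟩ :=
    CyclicDade.exists_jordan_decomposition (unipotent_of_pow_eq_one hN)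
  have hX1 : Prime (X - 1 : k[X]) := by simpa using prime_X_sub_C (1 : k)
  have hpow : ∀ i, ∃ m, n i = p ^ m := by
    intro i
    by_contra hcon
    push Not at hcon
    obtain ⟨j, hj1, hj2⟩ : ∃ j, p ^ j ≤ n i ∧ n i < p ^ (j + 1) :=
      ⟨Nat.log p (n i), Nat.pow_log_le_self p (hpos i).ne',
        Nat.lt_pow_succ_log_self hp.one_lt _⟩
    have hj1 : p ^ j < n i := lt_of_le_of_ne hj1 (hcon j).symm
    have hsingle : ∀ Q : k[X], aeval a Q (e i) = ∑ l, aeval a (if l = i then Q else 0) (e l) := by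
      intro Q
      rw [Finset.sum_eq_single i]
      · rw [if_pos rfl]
      · intro l _ hl; rw [if_neg hl]; simp
      · intro hi; exact absurd (Finset.mem_univ i) hi
    -- in a block of size strictly between `p ^ j` and `p ^ (j + 1)`, the socle is fixed and lies in
    -- the image of `(X - 1) ^ p ^ j`, but not in that of `(X - 1) ^ (p ^ (j + 1) - 1)`
    obtain ⟨w', hw'⟩ := h.exists_norm hp j (v := aeval a ((X - 1 : k[X]) ^ (n i - 1)) (e i))
      (w := aeval a ((X - 1 : k[X]) ^ (n i - 1 - p ^ j)) (e i)) (by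
        rw [← sub_eq_zero]
        have : a (aeval a ((X - 1 : k[X]) ^ (n i - 1)) (e i)) -
            aeval a ((X - 1 : k[X]) ^ (n i - 1)) (e i) = aeval a ((X - 1 : k[X]) ^ n i) (e i) := by
          conv_rhs => rw [← Nat.sub_add_cancel (hpos i), pow_succ']
          simp
        rw [this, hsingle, hker]
        intro l
        split_ifs with hl
        · subst hl; rfl
        · exact dvd_zero _) (by
        have : (X - 1 : k[X]) ^ (n i - 1) =
            (X ^ p ^ j - 1) * (X - 1 : k[X]) ^ (n i - 1 - p ^ j) := by
          rw [← one_pow (p ^ j), ← sub_pow_char_pow, one_pow, ← pow_add]; congr 1; omega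
        rw [this]
        simp)
    have hnorm : ∑ t ∈ Finset.range (p ^ (j + 1)), (a ^ t) w' =
        aeval a ((X - 1 : k[X]) ^ (p ^ (j + 1) - 1)) w' := by
      rw [← geom_sum_eq_sub_one_pow p, map_sum, LinearMap.sum_apply]
      simp
    rw [hnorm] at hw'
    obtain ⟨P, rfl⟩ := hsurj w'
    rw [hsingle, map_sum, ← sub_eq_zero, ← Finset.sum_sub_distrib] at hw'
    simp only [← Module.End.mul_apply, ← map_mul, ← LinearMap.sub_apply, ← map_sub] at hw'
    have h1 := (hker _).1 hw' i
    rw [if_pos rfl] at h1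
    have h2 : (X - 1 : k[X]) ^ n i ∣ (X - 1) ^ (p ^ (j + 1) - 1) * P i :=
      (pow_dvd_pow _ (by omega)).mul_right _
    have h3 := (dvd_sub_left h2).1 h1
    rw [pow_dvd_pow_iff hX1.ne_zero hX1.not_isUnit] at h3
    have := hpos i
    omega
  choose m hm using hpow
  refine ⟨ι, inferInstance, e, m, hsurj, fun P => ?_⟩
  rw [hker]
  refine forall_congr' fun i => ?_
  rw [hm, sub_pow_char_pow, one_pow]

end Jordan

section Lattices

variable {O : Type u} [CommRing O] [IsLocalRing O]

local notation "kk" => IsLocalRing.ResidueField O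

/-- Over a local ring of residue characteristic `p`, a direct summand of a permutation lattice of a
cyclic `p`-group is a permutation lattice: the generators of the Jordan blocks of its reduction
lift to elements with the same stabilizers. -/
theorem IsPermSummand.isPermEnd {p : ℕ} [Fact p.Prime] [CharP (IsLocalRing.ResidueField O) p]
    {M : Type*} [AddCommGroup M] [Module O M] [Module.Finite O M] [Module.Free O M]
    {a : Module.End O M} (h : IsPermSummand p a) : IsPermEnd a := by
  classical
  have hp : p.Prime := Fact.out
  have hbc : IsBaseChange kk (TensorProduct.mk O kk M 1) := TensorProduct.isBaseChange O M kk
  have haa : ∀ v, TensorProduct.mk O kk M 1 (a v) = (a.baseChange kk) (TensorProduct.mk O kk M 1 v) :=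
    fun v => by simp
  obtain ⟨ι, _, e, n, hsurj, hker⟩ := (h.of_isBaseChange hbc haa).exists_jordan_decomposition
  have hfix : ∀ i, (a.baseChange kk ^ p ^ n i) (e i) = e i := by
    intro i
    have h0 := (hker fun l => if l = i then X ^ p ^ n i - 1 else 0).2 fun l => by
      split_ifs with hl
      · subst hl; rfl
      · exact dvd_zero _
    rw [Finset.sum_eq_single i (fun l _ hl => by rw [if_neg hl]; simp)
      (fun hi => absurd (Finset.mem_univ i) hi), if_pos rfl] at h0
    simpa [sub_eq_zero] using h0
  have hpowbc : ∀ m v, TensorProduct.mk O kk M 1 ((a ^ m) v) =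
      (a.baseChange kk ^ m) (TensorProduct.mk O kk M 1 v) := by
    intro m v
    induction m with
    | zero => rfl
    | succ m ih => rw [pow_succ', pow_succ', Module.End.mul_apply, Module.End.mul_apply, haa, ih]
  have hlift : ∀ i, ∃ v, (a ^ p ^ n i) v = v ∧ TensorProduct.mk O kk M 1 v = e i := fun i =>
    (h.pow (p ^ n i)).exists_fixed_lift Ideal.Quotient.mk_surjective hbc (hpowbc _) (hfix i)
  choose ε hε hεe using hlift
  have hmonic : ∀ i, (X ^ p ^ n i - 1 : kk[X]).Monic :=
    fun i => by simpa using monic_X_pow_sub_C (1 : kk) (pow_pos hp.pos (n i)).ne'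
  have hdeg : ∀ i, (X ^ p ^ n i - 1 : kk[X]).natDegree = p ^ n i :=
    fun i => by simpa using natDegree_X_pow_sub_C (n := p ^ n i) (r := (1 : kk))
  let f : (Σ i, Fin (p ^ n i)) → kk ⊗[O] M := fun x => (a.baseChange kk ^ (x.2 : ℕ)) (e x.1)
  have haev : ∀ c : (Σ i, Fin (p ^ n i)) → kk, ∑ x, c x • f x =
      ∑ i, aeval (a.baseChange kk) (∑ t : Fin (p ^ n i), C (c ⟨i, t⟩) * X ^ (t : ℕ)) (e i) := by
    intro c
    rw [Fintype.sum_sigma]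
    refine Finset.sum_congr rfl fun i _ => ?_
    rw [map_sum, LinearMap.sum_apply]
    refine Finset.sum_congr rfl fun t _ => ?_
    simp [f, Module.algebraMap_end_apply]
  have hli : LinearIndependent kk f := by
    rw [Fintype.linearIndependent_iff]
    intro c hc x
    rw [haev, hker] at hc
    have h0 := Polynomial.eq_zero_of_dvd_of_natDegree_lt (hc x.1) (by
      rw [hdeg]
      refine lt_of_le_of_lt (natDegree_sum_le_of_forall_le (n := p ^ n x.1 - 1) _ _ fun t _ => ?_)
        (Nat.sub_lt (pow_pos hp.pos _) one_pos)
      exact (natDegree_C_mul_X_pow_le _ _).trans (by have := t.2; omega))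
    have := congrArg (fun P => coeff P (x.2 : ℕ)) h0
    simp only [finsetSum_coeff, coeff_C_mul, coeff_X_pow, coeff_zero] at this
    rw [Finset.sum_eq_single x.2] at this
    · simpa using this
    · intro t _ ht
      rw [if_neg (fun h => ht (Fin.ext h.symm)), mul_zero]
    · intro hx; exact absurd (Finset.mem_univ _) hx
  have hspan : ⊤ ≤ Submodule.span kk (Set.range f) := by
    intro v _
    obtain ⟨P, rfl⟩ := hsurj v
    have h1 : ∑ i, aeval (a.baseChange kk) (P i) (e i) =
        ∑ x, ((P x.1) %ₘ (X ^ p ^ n x.1 - 1)).coeff (x.2 : ℕ) • f x := by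
      rw [haev fun x => ((P x.1) %ₘ (X ^ p ^ n x.1 - 1)).coeff (x.2 : ℕ), ← sub_eq_zero,
        ← Finset.sum_sub_distrib]
      refine Eq.trans (Finset.sum_congr rfl fun i _ => ?_) ((hker fun i => P i -
        ∑ t : Fin (p ^ n i), C ((P i %ₘ (X ^ p ^ n i - 1)).coeff (t : ℕ)) * X ^ (t : ℕ)).2 ?_)
      · rw [map_sub, LinearMap.sub_apply]
      intro i
      have : ∑ t : Fin (p ^ n i), C ((P i %ₘ (X ^ p ^ n i - 1)).coeff (t : ℕ)) * X ^ (t : ℕ) =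
          P i %ₘ (X ^ p ^ n i - 1) := by
        rw [Fin.sum_univ_eq_sum_range
          (fun t => C ((P i %ₘ (X ^ p ^ n i - 1)).coeff t) * X ^ t) (p ^ n i)]
        refine (as_sum_range_C_mul_X_pow' _ ?_).symm
        have := natDegree_modByMonic_lt (P i) (hmonic i) (by
          intro h1
          have := hdeg i
          rw [h1, natDegree_one] at this
          exact (pow_pos hp.pos (n i)).ne this)
        rwa [hdeg] at this
      rw [this]
      exact ⟨P i /ₘ (X ^ p ^ n i - 1), by
        rw [sub_eq_iff_eq_add, add_comm]; exact (modByMonic_add_div _ _).symm⟩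
    rw [h1]
    exact Submodule.sum_mem _ fun x _ => Submodule.smul_mem _ _ (Submodule.subset_span ⟨x, rfl⟩)
  let b := Module.Basis.mk hli hspan
  let F : (Σ i, Fin (p ^ n i)) → M := fun x => (a ^ (x.2 : ℕ)) (ε x.1)
  have hF : ∀ x, (1 : kk) ⊗ₜ[O] F x = b x := by
    intro x
    rw [Module.Basis.mk_apply]
    exact (hpowbc _ _).trans (by rw [hεe])
  have hFspan := IsLocalRing.span_eq_top_of_tmul_eq_basis F b hF
  have hcard : Module.finrank O ((Σ i, Fin (p ^ n i)) → O) ≤ Module.finrank O M := by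
    rw [Module.finrank_fintype_fun_eq_card, ← Module.finrank_eq_card_basis b,
      Module.finrank_baseChange]
  have hbij := OrzechProperty.bijective_of_surjective_of_finrank_le (Fintype.linearCombination O F)
    (by rw [← LinearMap.range_eq_top, Fintype.range_linearCombination, hFspan]) hcard
  let B := (Pi.basisFun O (Σ i, Fin (p ^ n i))).map (LinearEquiv.ofBijective _ hbij)
  have hB : ∀ x, B x = F x := by
    intro x
    simp [B]
  refine ⟨_, inferInstance, B, fun x => ?_⟩
  simp only [hB]
  have hstep : a (F x) = (a ^ ((x.2 : ℕ) + 1)) (ε x.1) := by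
    rw [pow_succ', Module.End.mul_apply]
  by_cases ht : (x.2 : ℕ) + 1 < p ^ n x.1
  · exact ⟨⟨x.1, ⟨_, ht⟩⟩, hstep⟩
  · refine ⟨⟨x.1, ⟨0, pow_pos hp.pos _⟩⟩, ?_⟩
    rw [hstep, show (x.2 : ℕ) + 1 = p ^ n x.1 by have := x.2.2; omega, hε]
    simp [F]

end Lattices

/-! ### Endomorphisms of a syzygy -/

section RelativeSyzygy

variable {R G : Type*} [CommRing R] [Group G] [Fintype G] {A T T' : Type*}
  [AddCommGroup A] [Module R A] [AddCommGroup T] [Module R T] [AddCommGroup T'] [Module R T']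
  {ρA : Representation R G A} {ρT : Representation R G T} {ρT' : Representation R G T'}

theorem sum_linHom_equivariant (φ : A →ₗ[R] T) (g : G) (v : A) :
    (∑ x, ρA.linHom ρT x φ) (ρA g v) = ρT g ((∑ x, ρA.linHom ρT x φ) v) := by
  simp only [LinearMap.sum_apply, map_sum]
  refine Fintype.sum_equiv (Equiv.mulLeft g⁻¹) _ _ fun x => ?_
  simp [Representation.linHom_apply, map_mul]

/-- `h ↦ α ∘ h ∘ β` on spaces of linear maps. -/
def sandwich {U V W X : Type*} [AddCommGroup U] [Module R U] [AddCommGroup V] [Module R V]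
    [AddCommGroup W] [Module R W] [AddCommGroup X] [Module R X]
    (α : W →ₗ[R] X) (β : U →ₗ[R] V) : (V →ₗ[R] W) →ₗ[R] (U →ₗ[R] X) where
  toFun h := α ∘ₗ h ∘ₗ β
  map_add' _ _ := by ext; simp
  map_smul' _ _ := by ext; simp

@[simp] theorem sandwich_apply {U V W X : Type*} [AddCommGroup U] [Module R U] [AddCommGroup V]
    [Module R V] [AddCommGroup W] [Module R W] [AddCommGroup X] [Module R X]
    (α : W →ₗ[R] X) (β : U →ₗ[R] V) (h : V →ₗ[R] W) (u : U) : sandwich α β h u = α (h (β u)) := rfl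

/-- If `0 → T' → A → T → 0` is a sequence of `RG`-modules that splits over `R` and `A` is projective
(`θ` is an `R`-endomorphism of `A` of trace one), then `End T'` is a direct summand of
`End T × Hom(T', A)`. Indeed both `End T' × Hom(A, T)` and `End T × Hom(T', A)` are isomorphic to
the pullback of `Hom(T', A) → Hom(T', T) ← Hom(A, T)`. -/
theorem exists_end_summand (ι : T' →ₗ[R] A) (π : A →ₗ[R] T) (s : T →ₗ[R] A) (κ : A →ₗ[R] T')
    (θ : Module.End R A)
    (hι : ∀ g v, ι (ρT' g v) = ρA g (ι v)) (hπ : ∀ g v, π (ρA g v) = ρT g (π v))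
    (hπι : ∀ v, π (ι v) = 0) (hκι : ∀ v, κ (ι v) = v) (hπs : ∀ v, π (s v) = v)
    (hsum : ∀ v, ι (κ v) + s (π v) = v) (hθ : ∀ v, ∑ g, ρA g (θ (ρA g⁻¹ v)) = v) :
    ∃ (i : Module.End R T' →ₗ[R] Module.End R T × (T' →ₗ[R] A))
      (r : Module.End R T × (T' →ₗ[R] A) →ₗ[R] Module.End R T'),
      (∀ g h, i (ρT'.linHom ρT' g h) = LinearMap.prodMap (ρT.linHom ρT g) (ρT'.linHom ρA g) (i h)) ∧
      (∀ g h, r (LinearMap.prodMap (ρT.linHom ρT g) (ρT'.linHom ρA g) h) = ρT'.linHom ρT' g (r h)) ∧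
      ∀ h, r (i h) = h := by
  -- `σ₂` lifts the composite `Hom(T', A) → Hom(T', T)` along the restriction
  -- `Hom(A, T) → Hom(T', T)`; averaging an `R`-linear lift against `θ` makes it equivariant
  let σ₂ : (T' →ₗ[R] A) →ₗ[R] (A →ₗ[R] T) :=
    ∑ x, (ρT'.linHom ρA).linHom (ρA.linHom ρT) x (sandwich (π ∘ₗ θ) κ)
  -- `σ₁` lifts the restriction `Hom(A, T) → Hom(T', T)` along `Hom(T', A) → Hom(T', T)`
  let σ₁ : (A →ₗ[R] T) →ₗ[R] (T' →ₗ[R] A) :=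
    ∑ x, (ρA.linHom ρT).linHom (ρT'.linHom ρA) x (sandwich s (θ ∘ₗ ι))
  have hσ₂ : ∀ g a, σ₂ (ρT'.linHom ρA g a) = ρA.linHom ρT g (σ₂ a) := sum_linHom_equivariant _
  have hσ₁ : ∀ g b, σ₁ (ρA.linHom ρT g b) = ρT'.linHom ρA g (σ₁ b) := sum_linHom_equivariant _
  have hσ₂ι : ∀ a v, σ₂ a (ι v) = π (a v) := by
    intro a v
    conv_rhs => rw [← hθ (a v), map_sum]
    simp only [σ₂, LinearMap.sum_apply]
    refine Finset.sum_congr rfl fun x _ => ?_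
    simp [Representation.linHom_apply, ← hι, hκι, hπ]
  have hσ₁π : ∀ b v, π (σ₁ b v) = b (ι v) := by
    intro b v
    conv_rhs => rw [← hθ (ι v), map_sum]
    simp only [σ₁, LinearMap.sum_apply, map_sum]
    refine Finset.sum_congr rfl fun x _ => ?_
    simp [Representation.linHom_apply, hι, hπ, hπs]
  let i : Module.End R T' →ₗ[R] Module.End R T × (T' →ₗ[R] A) :=
    LinearMap.prod (-(sandwich LinearMap.id s ∘ₗ σ₂ ∘ₗ sandwich ι LinearMap.id))
      (sandwich ι LinearMap.id)
  let β : Module.End R T × (T' →ₗ[R] A) →ₗ[R] (A →ₗ[R] T) :=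
    sandwich LinearMap.id π ∘ₗ LinearMap.fst R _ _ + σ₂ ∘ₗ LinearMap.snd R _ _
  let r : Module.End R T × (T' →ₗ[R] A) →ₗ[R] Module.End R T' :=
    sandwich κ LinearMap.id ∘ₗ (LinearMap.snd R _ _ - σ₁ ∘ₗ β)
  have hβ : ∀ g h, β (LinearMap.prodMap (ρT.linHom ρT g) (ρT'.linHom ρA g) h) =
      ρA.linHom ρT g (β h) := by
    intro g h
    simp only [β, LinearMap.add_apply, LinearMap.comp_apply, LinearMap.fst_apply,
      LinearMap.snd_apply, LinearMap.prodMap_apply, map_add, hσ₂]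
    congr 1
    ext v
    simp [Representation.linHom_apply, hπ]
  have hιr : ∀ h v, ι (r h v) = h.2 v - σ₁ (β h) v := by
    intro h v
    have h0 : π (h.2 v - σ₁ (β h) v) = 0 := by
      rw [map_sub, hσ₁π]
      simp [β, hσ₂ι, hπι]
    conv_rhs => rw [← hsum (h.2 v - σ₁ (β h) v), h0, map_zero, add_zero]
    rfl
  have hιinj : Function.Injective ι := Function.LeftInverse.injective hκι
  refine ⟨i, r, ?_, ?_, ?_⟩
  · intro g h
    have e2 : ι ∘ₗ (ρT'.linHom ρT' g h) = ρT'.linHom ρA g (ι ∘ₗ h) := by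
      ext v; simp [Representation.linHom_apply, hι]
    have e1 : ∀ h' : Module.End R T', ∀ v, σ₂ (ι ∘ₗ h') v = σ₂ (ι ∘ₗ h') (s (π v)) := by
      intro h' v
      conv_lhs => rw [← hsum v, map_add, hσ₂ι]
      simp [hπι]
    refine Prod.ext ?_ e2
    refine LinearMap.ext fun v => ?_
    change -(σ₂ (ι ∘ₗ (ρT'.linHom ρT' g h)) (s v)) = (ρT.linHom ρT g (-(σ₂ (ι ∘ₗ h) ∘ₗ s))) v
    rw [e2, hσ₂]
    simp only [Representation.linHom_apply, LinearMap.comp_apply, LinearMap.neg_apply, map_neg]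
    rw [e1 h, hπ, hπs]
  · intro g h
    refine LinearMap.ext fun v => hιinj ?_
    rw [hιr, hβ, hσ₁]
    simp [Representation.linHom_apply, hι, hιr]
  · intro h
    refine LinearMap.ext fun v => hιinj ?_
    rw [hιr]
    have h0 : β (i h) = 0 := by
      refine LinearMap.ext fun v => ?_
      change -(σ₂ (ι ∘ₗ h) (s (π v))) + σ₂ (ι ∘ₗ h) v = 0
      have : σ₂ (ι ∘ₗ h) (ι (κ v)) = 0 := by rw [hσ₂ι]; simp [hπι]
      nth_rw 2 [← hsum v]
      rw [map_add, this, zero_add, neg_add_cancel]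
    rw [h0, map_zero]
    simp [i]

/-- If `A` is free of rank one over `RG` with generator `z` (and coordinate functional `c`), then
the translates of the maps `T' → R z` given by a basis of the dual of `T'` form a permuted basis of
`Hom(T', A)`. -/
theorem isPermSummand_linHom_free {G : Type} [Group G] [Fintype G] {p N : ℕ}
    (hG : Fintype.card G = p ^ N) {ρA : Representation R G A} {ρT' : Representation R G T'}
    [Module.Free R T'] [Module.Finite R T'] (c : A →ₗ[R] R) (z : A)
    (hc : ∀ v, ∑ g, c (ρA g⁻¹ v) • ρA g z = v) (g : G) :
    IsPermSummand p (ρT'.linHom ρA g) := by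
  classical
  cases subsingleton_or_nontrivial R
  · have := Module.subsingleton R (T' →ₗ[R] A)
    exact ⟨Empty, inferInstance, 1, 0, 0, 0, by simp, fun _ => Subsingleton.elim _ _,
      fun _ => Subsingleton.elim _ _, fun _ => Subsingleton.elim _ _⟩
  let b := Module.finBasis R T'
  let σ : Equiv.Perm (G × Fin (Module.finrank R T')) :=
    Equiv.prodCongr (Equiv.mulLeft g⁻¹) (Equiv.refl _)
  have hσ : ∀ m, ∀ x, (σ ^ m : Equiv.Perm _) x = ((g⁻¹) ^ m * x.1, x.2) := by
    intro m
    induction m with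
    | zero => intro x; simp
    | succ m ih => intro x; rw [pow_succ', Equiv.Perm.mul_apply, ih, pow_succ', mul_assoc]; rfl
  let i : (T' →ₗ[R] A) →ₗ[R] (G × Fin (Module.finrank R T') → R) :=
    { toFun := fun a x => c (ρA x.1⁻¹ (a (ρT' x.1 (b x.2))))
      map_add' := fun _ _ => by ext; simp
      map_smul' := fun _ _ => by ext; simp }
  let r : (G × Fin (Module.finrank R T') → R) →ₗ[R] (T' →ₗ[R] A) :=
    { toFun := fun f => ∑ x : G, (∑ j, f (x, j) • b.coord j ∘ₗ ρT' x⁻¹).smulRight (ρA x z)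
      map_add' := fun f f' => by
        ext v
        simp [Finset.sum_add_distrib, add_smul]
      map_smul' := fun t f => by
        ext v
        simp [Finset.smul_sum, ← smul_smul, ← Finset.mul_sum] }
  refine ⟨_, inferInstance, σ, N, i, r, ?_, ?_, ?_, ?_⟩
  · ext1 x
    rw [hσ, ← hG, pow_card_eq_one, one_mul]; rfl
  · intro a
    funext x
    simp [i, σ, Representation.linHom_apply, map_mul]
  · intro f
    ext v
    simp only [r, LinearMap.coe_mk, AddHom.coe_mk, LinearMap.sum_apply, Representation.linHom_apply,
      LinearMap.comp_apply, map_sum]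
    refine Fintype.sum_equiv (Equiv.mulLeft g⁻¹) _ _ fun x => ?_
    simp [σ, map_mul]
  · intro a
    ext v
    conv_rhs => rw [← hc (a v)]
    simp only [r, i, LinearMap.coe_mk, AddHom.coe_mk, LinearMap.sum_apply, LinearMap.smulRight_apply,
      LinearMap.smul_apply, LinearMap.comp_apply]
    refine Finset.sum_congr rfl fun x _ => ?_
    congr 1
    conv_rhs => rw [← ρT'.self_inv_apply x v, ← b.sum_repr (ρT' x⁻¹ v)]
    simp only [map_sum, map_smul,
      Module.Basis.coord_apply, smul_eq_mul]
    exact Finset.sum_congr rfl fun _ _ => mul_comm _ _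

/-- The trace is additive in short exact sequences that split linearly. -/
theorem trace_eq_add {R A T T' : Type*} [CommRing R] [AddCommGroup A] [Module R A] [AddCommGroup T]
    [Module R T] [AddCommGroup T'] [Module R T'] [Module.Free R A] [Module.Finite R A]
    [Module.Free R T] [Module.Finite R T] [Module.Free R T'] [Module.Finite R T']
    (ι : T' →ₗ[R] A) (π : A →ₗ[R] T) (s : T →ₗ[R] A) (κ : A →ₗ[R] T')
    {a : Module.End R A} {t : Module.End R T} {t' : Module.End R T'}
    (hι : a ∘ₗ ι = ι ∘ₗ t') (hπ : π ∘ₗ a = t ∘ₗ π) (hκι : κ ∘ₗ ι = LinearMap.id)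
    (hπs : π ∘ₗ s = LinearMap.id) (hsum : ι ∘ₗ κ + s ∘ₗ π = LinearMap.id) :
    LinearMap.trace R A a = LinearMap.trace R T' t' + LinearMap.trace R T t := by
  have h1 : a = (ι ∘ₗ t') ∘ₗ κ + (a ∘ₗ s) ∘ₗ π := by
    rw [← hι, LinearMap.comp_assoc, LinearMap.comp_assoc, ← LinearMap.comp_add, hsum,
      LinearMap.comp_id]
  rw [h1, map_add, LinearMap.trace_comp_comm', LinearMap.trace_comp_comm' π,
    ← LinearMap.comp_assoc, hκι, LinearMap.id_comp, ← LinearMap.comp_assoc, hπ,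
    LinearMap.comp_assoc, hπs, LinearMap.comp_id]

end RelativeSyzygy

/-! ### The modules `R[X] ⧸ (f)` -/

section CyclicModules

variable {R : Type*} [CommRing R]

theorem adjoinRoot_linearMap_ext {f : R[X]} {M : Type*} [AddCommGroup M] [Module R M]
    {φ ψ : AdjoinRoot f →ₗ[R] M} (h : ∀ n : ℕ, φ (AdjoinRoot.root f ^ n) = ψ (AdjoinRoot.root f ^ n)) :
    φ = ψ := by
  have : φ ∘ₗ (AdjoinRoot.mkₐ f).toLinearMap = ψ ∘ₗ (AdjoinRoot.mkₐ f).toLinearMap := by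
    refine Polynomial.lhom_ext' fun n => LinearMap.ext_ring ?_
    change φ (AdjoinRoot.mk f (monomial n 1)) = ψ (AdjoinRoot.mk f (monomial n 1))
    rw [← X_pow_eq_monomial, map_pow, AdjoinRoot.mk_X, h]
  refine LinearMap.ext fun v => ?_
  obtain ⟨P, rfl⟩ := AdjoinRoot.mk_surjective v
  exact LinearMap.congr_fun this P

theorem root_pow_eq_one {f : R[X]} {n : ℕ} (h : f ∣ X ^ n - 1) : AdjoinRoot.root f ^ n = 1 := by
  have := AdjoinRoot.mk_eq_zero.2 h
  simpa [sub_eq_zero] using this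

theorem dvd_of_root_pow_eq_one {f : R[X]} {n : ℕ} (h : AdjoinRoot.root f ^ n = 1) :
    f ∣ X ^ n - 1 := by
  rw [← AdjoinRoot.mk_eq_zero]
  simpa [sub_eq_zero] using h

/-- The class of `X` as a unit of `R[X] ⧸ (f)`, for a divisor `f` of `X ^ n - 1`. -/
noncomputable def rootUnit {f : R[X]} {n : ℕ} (hn : n ≠ 0) (h : f ∣ X ^ n - 1) : (AdjoinRoot f)ˣ :=
  Units.ofPowEqOne (AdjoinRoot.root f) n (root_pow_eq_one h) hn

/-- Conjugation by the class of `X` on the `R`-linear endomorphisms of `R[X] ⧸ (f)`. It is only used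
when this class is a unit. -/
noncomputable def conjRoot (f : R[X]) : Module.End R (Module.End R (AdjoinRoot f)) :=
  sandwich (LinearMap.mulLeft R (AdjoinRoot.root f))
    (LinearMap.mulLeft R (Ring.inverse (AdjoinRoot.root f)))

variable {G : Type*} [Group G] {g : G}

/-- The representation of a cyclic group with generator `g` on `R[X] ⧸ (f)` in which `g` acts as
multiplication by the class of `X`. -/
noncomputable def cyclicRep (hg : ∀ x, x ∈ Subgroup.zpowers g) (hg0 : orderOf g ≠ 0) {f : R[X]}
    (hf : f ∣ X ^ orderOf g - 1) : Representation R G (AdjoinRoot f) :=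
  ((Algebra.lmul R (AdjoinRoot f)).toMonoidHom.comp (Units.coeHom _)).comp
    (monoidHomOfForallMemZpowers hg (g' := rootUnit hg0 hf)
      (orderOf_dvd_of_pow_eq_one (Units.ext (by
        rw [Units.val_pow_eq_pow_val]; exact root_pow_eq_one hf))))

variable {hg : ∀ x, x ∈ Subgroup.zpowers g} {hg0 : orderOf g ≠ 0} {f : R[X]}
  {hf : f ∣ X ^ orderOf g - 1}

@[simp] theorem cyclicRep_gen (v : AdjoinRoot f) :
    cyclicRep hg hg0 hf g v = AdjoinRoot.root f * v := by
  simp only [cyclicRep, MonoidHom.comp_apply, monoidHomOfForallMemZpowers_apply_gen]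
  rfl

theorem cyclicRep_gen_pow (n : ℕ) (v : AdjoinRoot f) :
    cyclicRep hg hg0 hf (g ^ n) v = AdjoinRoot.root f ^ n * v := by
  induction n with
  | zero => simp
  | succ n ih => rw [pow_succ', map_mul, Module.End.mul_apply, ih, cyclicRep_gen, pow_succ', mul_assoc]

theorem cyclicRep_gen_inv (v : AdjoinRoot f) :
    cyclicRep hg hg0 hf g⁻¹ v = Ring.inverse (AdjoinRoot.root f) * v := by
  have hu : IsUnit (AdjoinRoot.root f) := (rootUnit hg0 hf).isUnit
  conv_rhs => rw [← Representation.self_inv_apply (cyclicRep hg hg0 hf) g v, cyclicRep_gen,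
    ← mul_assoc, Ring.inverse_mul_cancel _ hu, one_mul]

theorem linHom_cyclicRep :
    (cyclicRep hg hg0 hf).linHom (cyclicRep hg hg0 hf) g = conjRoot f := by
  ext h v
  simp [Representation.linHom_apply, conjRoot, cyclicRep_gen_inv]

theorem exists_pow_of_mem_zpowers (hg : ∀ x, x ∈ Subgroup.zpowers g) (hg0 : orderOf g ≠ 0) (x : G) :
    ∃ n : ℕ, g ^ n = x := by
  have := (orderOf_pos_iff.1 (Nat.pos_of_ne_zero hg0)).mem_powers_iff_mem_zpowers.2 (hg x)
  exact (Submonoid.mem_powers_iff _ _).1 this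

variable (R) in
/-- The split exact sequence `0 → R[X] ⧸ (F) → R[X] ⧸ (f * F) → R[X] ⧸ (f) → 0`. -/
theorem exists_adjoinRoot_exact {f F : R[X]} (hf : f.Monic) (hF : F.Monic) :
    ∃ (ι : AdjoinRoot F →ₗ[R] AdjoinRoot (f * F)) (π : AdjoinRoot (f * F) →ₗ[R] AdjoinRoot f)
      (s : AdjoinRoot f →ₗ[R] AdjoinRoot (f * F)) (κ : AdjoinRoot (f * F) →ₗ[R] AdjoinRoot F),
      (∀ v, ι (AdjoinRoot.root F * v) = AdjoinRoot.root (f * F) * ι v) ∧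
      (∀ v, π (AdjoinRoot.root (f * F) * v) = AdjoinRoot.root f * π v) ∧
      (∀ v, π (ι v) = 0) ∧ (∀ v, κ (ι v) = v) ∧ (∀ v, π (s v) = v) ∧
      (∀ v, ι (κ v) + s (π v) = v) ∧ π 1 = 1 := by
  let ι : AdjoinRoot F →ₗ[R] AdjoinRoot (f * F) :=
    (AdjoinRoot.mkₐ (f * F)).toLinearMap ∘ₗ LinearMap.mulLeft R f ∘ₗ AdjoinRoot.modByMonicHom hF
  have hι : ∀ P, ι (AdjoinRoot.mk F P) = AdjoinRoot.mk (f * F) (f * P) := by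
    intro P
    change AdjoinRoot.mk (f * F) (f * AdjoinRoot.modByMonicHom hF (AdjoinRoot.mk F P)) = _
    rw [AdjoinRoot.modByMonicHom_mk, AdjoinRoot.mk_eq_mk]
    refine ⟨-(P /ₘ F), ?_⟩
    have := modByMonic_add_div P F
    linear_combination f * this
  let πₐ : AdjoinRoot (f * F) →ₐ[R] AdjoinRoot f :=
    Ideal.Quotient.liftₐ _ (AdjoinRoot.mkₐ f) fun P hP =>
      AdjoinRoot.mk_eq_zero.2 ((dvd_mul_right f F).trans (Ideal.mem_span_singleton.1 hP))
  have hπ : ∀ P, πₐ (AdjoinRoot.mk (f * F) P) = AdjoinRoot.mk f P := fun P => rfl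
  let s : AdjoinRoot f →ₗ[R] AdjoinRoot (f * F) :=
    (AdjoinRoot.mkₐ (f * F)).toLinearMap ∘ₗ AdjoinRoot.modByMonicHom hf
  have hπs : ∀ v, πₐ (s v) = v := by
    intro v
    change πₐ (AdjoinRoot.mk (f * F) _) = v
    rw [hπ]
    exact AdjoinRoot.mk_leftInverse hf v
  have hιinj : Function.Injective ι := by
    rw [injective_iff_map_eq_zero]
    intro v hv
    obtain ⟨P, rfl⟩ := AdjoinRoot.mk_surjective v
    rw [hι, AdjoinRoot.mk_eq_zero] at hv
    obtain ⟨c, hc⟩ := hv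
    rw [AdjoinRoot.mk_eq_zero]
    exact ⟨c, hf.isRegular.left (by simpa [mul_assoc] using hc)⟩
  have hker : ∀ v, πₐ v = 0 → v ∈ LinearMap.range ι := by
    intro v hv
    obtain ⟨P, rfl⟩ := AdjoinRoot.mk_surjective v
    rw [hπ, AdjoinRoot.mk_eq_zero] at hv
    obtain ⟨c, rfl⟩ := hv
    exact ⟨AdjoinRoot.mk F c, hι c⟩
  let κ : AdjoinRoot (f * F) →ₗ[R] AdjoinRoot F :=
    (LinearEquiv.ofInjective ι hιinj).symm.toLinearMap ∘ₗ
      (LinearMap.id - s ∘ₗ πₐ.toLinearMap).codRestrict (LinearMap.range ι) fun v =>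
        hker _ (by simp [hπs])
  have hικ : ∀ v, ι (κ v) = v - s (πₐ v) := by
    intro v
    exact congrArg Subtype.val ((LinearEquiv.ofInjective ι hιinj).apply_symm_apply _)
  have hπι : ∀ v, πₐ (ι v) = 0 := by
    intro v
    obtain ⟨P, rfl⟩ := AdjoinRoot.mk_surjective v
    rw [hι, hπ, AdjoinRoot.mk_eq_zero]
    exact dvd_mul_right _ _
  refine ⟨ι, πₐ.toLinearMap, s, κ, ?_, ?_, hπι, ?_, hπs, fun v => by rw [hικ]; simp, map_one πₐ⟩
  · intro v
    obtain ⟨P, rfl⟩ := AdjoinRoot.mk_surjective v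
    rw [← AdjoinRoot.mk_X, ← map_mul, hι, hι, ← AdjoinRoot.mk_X, ← map_mul]
    congr 1; ring
  · intro v
    obtain ⟨P, rfl⟩ := AdjoinRoot.mk_surjective v
    simp only [AlgHom.toLinearMap_apply]
    rw [map_mul, ← AdjoinRoot.mk_X, hπ, AdjoinRoot.mk_X]
  · intro v
    apply hιinj
    rw [hικ, hπι, map_zero, sub_zero]

/-- The coefficient at `1` in the group algebra `R[X] ⧸ (X ^ n - 1)`. -/
theorem exists_coeff_one [Nontrivial R] {E : R[X]} {n : ℕ} (hn : n ≠ 0) (hE : E = X ^ n - 1) :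
    ∃ c : AdjoinRoot E →ₗ[R] R, ∀ t, c (AdjoinRoot.root E ^ t) = if n ∣ t then 1 else 0 := by
  have hEm : E.Monic := by
    rw [hE]; simpa using monic_X_pow_sub_C (1 : R) hn
  have hdeg : E.natDegree = n := by
    rw [hE]; simpa using natDegree_X_pow_sub_C (n := n) (r := (1 : R))
  have hroot : AdjoinRoot.root E ^ n = 1 := root_pow_eq_one hE.dvd
  refine ⟨Polynomial.lcoeff R 0 ∘ₗ AdjoinRoot.modByMonicHom hEm, fun t => ?_⟩
  have h1 : AdjoinRoot.root E ^ t = AdjoinRoot.mk E (X ^ (t % n)) := by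
    conv_lhs => rw [← Nat.mod_add_div t n, pow_add, pow_mul, hroot, one_pow, mul_one]
    simp
  rw [LinearMap.comp_apply, h1, AdjoinRoot.modByMonicHom_mk, (modByMonic_eq_self_iff hEm).2 (by
    rw [degree_X_pow, degree_eq_natDegree hEm.ne_zero, hdeg]
    exact_mod_cast Nat.mod_lt t (Nat.pos_of_ne_zero hn))]
  simp [coeff_X_pow, Nat.dvd_iff_mod_eq_zero, eq_comm]

theorem sum_coeff_one {G : Type*} [Group G] [Fintype G] {g : G}
    (hg : ∀ x, x ∈ Subgroup.zpowers g) (hg0 : orderOf g ≠ 0) {E : R[X]}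
    (hE : E = X ^ orderOf g - 1) {c : AdjoinRoot E →ₗ[R] R}
    (hc : ∀ t, c (AdjoinRoot.root E ^ t) = if orderOf g ∣ t then 1 else 0) (v : AdjoinRoot E) :
    ∑ x, c (cyclicRep hg hg0 hE.dvd x⁻¹ v) • cyclicRep hg hg0 hE.dvd x 1 = v := by
  classical
  let ρ := cyclicRep hg hg0 hE.dvd
  have hc' : ∀ x, c (ρ x 1) = if x = 1 then 1 else 0 := by
    intro x
    obtain ⟨n, rfl⟩ := exists_pow_of_mem_zpowers hg hg0 x
    simp only [ρ, cyclicRep_gen_pow, mul_one, hc, orderOf_dvd_iff_pow_eq_one]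
  have : (∑ x, (c ∘ₗ ρ x⁻¹).smulRight (ρ x 1)) = LinearMap.id := by
    refine adjoinRoot_linearMap_ext fun n => ?_
    have hn : AdjoinRoot.root E ^ n = ρ (g ^ n) 1 := by
      simp only [ρ, cyclicRep_gen_pow, mul_one]
    rw [hn, LinearMap.sum_apply, LinearMap.id_apply, Finset.sum_eq_single (g ^ n)]
    · have h1 : c 1 = 1 := by simpa using hc 0
      rw [LinearMap.smulRight_apply, LinearMap.comp_apply, ρ.inv_self_apply, h1, one_smul]
    · intro x _ hx
      have h1 : ρ x⁻¹ (ρ (g ^ n) 1) = ρ (x⁻¹ * g ^ n) 1 := by rw [map_mul, Module.End.mul_apply]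
      rw [LinearMap.smulRight_apply, LinearMap.comp_apply, h1, hc', if_neg, zero_smul]
      rw [inv_mul_eq_one]; exact hx
    · intro h; exact absurd (Finset.mem_univ _) h
  simpa using LinearMap.congr_fun this v

/-- The relative syzygy `R[X] ⧸ (F)` of `R[X] ⧸ (f)`, where `f * F = X ^ p ^ m - 1`, inherits from
it that the endomorphism module is a direct summand of a permutation module. -/
theorem IsPermSummand.conjRoot_cofactor [Nontrivial R] {p m : ℕ} (hp : p.Prime) {f F : R[X]}
    (hf : f.Monic) (hF : F.Monic) (hfF : f * F = X ^ p ^ m - 1)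
    (h : IsPermSummand p (conjRoot f)) : IsPermSummand p (conjRoot F) := by
  have : NeZero (p ^ m) := ⟨pow_ne_zero _ hp.ne_zero⟩
  let G := Multiplicative (ZMod (p ^ m))
  let g : G := Multiplicative.ofAdd 1
  have hcard : Fintype.card G = p ^ m := by
    rw [Fintype.card_multiplicative, ZMod.card]
  have hg : ∀ x, x ∈ Subgroup.zpowers g := by
    intro x
    refine ⟨(Multiplicative.toAdd x).cast, ?_⟩
    change Multiplicative.ofAdd (((Multiplicative.toAdd x).cast : ℤ) • (1 : ZMod (p ^ m))) = x
    simp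
  have hord : orderOf g = p ^ m := by
    rw [orderOf_eq_card_of_forall_mem_zpowers hg, Nat.card_eq_fintype_card, hcard]
  have hg0 : orderOf g ≠ 0 := by rw [hord]; exact pow_ne_zero _ hp.ne_zero
  have hE : f * F = X ^ orderOf g - 1 := by rw [hord, hfF]
  obtain ⟨c, hc⟩ := exists_coeff_one hg0 hE
  obtain ⟨ι, π, s, κ, hι, hπ, hπι, hκι, hπs, hsum, -⟩ := exists_adjoinRoot_exact R hf hF
  let ρA := cyclicRep hg hg0 hE.dvd
  let ρT := cyclicRep (f := f) hg hg0 (hE ▸ dvd_mul_right f F)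
  let ρT' := cyclicRep (f := F) hg hg0 (hE ▸ dvd_mul_left F f)
  have hι' : ∀ x v, ι (ρT' x v) = ρA x (ι v) := by
    intro x v
    obtain ⟨n, rfl⟩ := exists_pow_of_mem_zpowers hg hg0 x
    induction n with
    | zero => simp
    | succ n ih => rw [pow_succ', map_mul, map_mul, Module.End.mul_apply, Module.End.mul_apply, ← ih,
        cyclicRep_gen, cyclicRep_gen, hι]
  have hπ' : ∀ x v, π (ρA x v) = ρT x (π v) := by
    intro x v
    obtain ⟨n, rfl⟩ := exists_pow_of_mem_zpowers hg hg0 x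
    induction n with
    | zero => simp
    | succ n ih => rw [pow_succ', map_mul, map_mul, Module.End.mul_apply, Module.End.mul_apply, ← ih,
        cyclicRep_gen, cyclicRep_gen, hπ]
  have hθ := sum_coeff_one hg hg0 hE hc
  obtain ⟨i, r, hi, hr, hri⟩ := exists_end_summand (ρA := ρA) (ρT := ρT) (ρT' := ρT') ι π s κ
    (c.smulRight 1) hι' hπ' hπι hκι hπs hsum fun v => by simpa using hθ v
  have := hF.free_adjoinRoot
  have := hF.finite_adjoinRoot
  have h1 := isPermSummand_linHom_free (ρA := ρA) (ρT' := ρT') hcard c 1 hθ g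
  rw [← linHom_cyclicRep (hg := hg) (hg0 := hg0) (hf := hE ▸ dvd_mul_right f F)] at h
  rw [← linHom_cyclicRep (hg := hg) (hg0 := hg0) (hf := hE ▸ dvd_mul_left F f)]
  exact (h.prod h1).of_summand i r (hi g) (hr g) hri

theorem trace_root_pow_mul {f F : R[X]} (hf : f.Monic) (hF : F.Monic) (n : ℕ) :
    Algebra.trace R (AdjoinRoot (f * F)) (AdjoinRoot.root (f * F) ^ n) =
      Algebra.trace R (AdjoinRoot F) (AdjoinRoot.root F ^ n) +
        Algebra.trace R (AdjoinRoot f) (AdjoinRoot.root f ^ n) := by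
  obtain ⟨ι, π, s, κ, hι, hπ, hπι, hκι, hπs, hsum, -⟩ := exists_adjoinRoot_exact R hf hF
  have := hF.free_adjoinRoot
  have := hF.finite_adjoinRoot
  have := hf.free_adjoinRoot
  have := hf.finite_adjoinRoot
  have := (hf.mul hF).free_adjoinRoot
  have := (hf.mul hF).finite_adjoinRoot
  simp only [Algebra.trace_apply]
  refine trace_eq_add ι π s κ ?_ ?_ (LinearMap.ext hκι) (LinearMap.ext hπs) (LinearMap.ext hsum)
  · ext v
    simp only [LinearMap.comp_apply]
    change AdjoinRoot.root (f * F) ^ n * ι v = ι (AdjoinRoot.root F ^ n * v)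
    induction n with
    | zero => simp
    | succ n ih => rw [pow_succ', mul_assoc, ih, ← hι, pow_succ', mul_assoc]
  · ext v
    simp only [LinearMap.comp_apply]
    change π (AdjoinRoot.root (f * F) ^ n * v) = AdjoinRoot.root f ^ n * π v
    induction n with
    | zero => simp
    | succ n ih => rw [pow_succ', mul_assoc, hπ, ih, pow_succ', mul_assoc]

theorem trace_root_pow_X_pow_sub_one [Nontrivial R] {n : ℕ} (hn : n ≠ 0) (t : ℕ) :
    Algebra.trace R (AdjoinRoot (X ^ n - 1 : R[X])) (AdjoinRoot.root (X ^ n - 1 : R[X]) ^ t) =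
      if n ∣ t then (n : R) else 0 := by
  have hEm : (X ^ n - 1 : R[X]).Monic := by simpa using monic_X_pow_sub_C (1 : R) hn
  have hdeg : (X ^ n - 1 : R[X]).natDegree = n := by
    simpa using natDegree_X_pow_sub_C (n := n) (r := (1 : R))
  have hroot := root_pow_eq_one (dvd_refl (X ^ n - 1 : R[X]))
  obtain ⟨c, hc⟩ := exists_coeff_one (R := R) hn rfl
  have := hEm.free_adjoinRoot
  have := hEm.finite_adjoinRoot
  have hl : ∀ a b, Algebra.lmul R (AdjoinRoot (X ^ n - 1 : R[X])) a b = a * b := fun _ _ => rfl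
  have key : Algebra.lmul R (AdjoinRoot (X ^ n - 1 : R[X])) (AdjoinRoot.root (X ^ n - 1 : R[X]) ^ t) =
      ∑ j ∈ Finset.range n, (c ∘ₗ Algebra.lmul R (AdjoinRoot (X ^ n - 1 : R[X]))
        (AdjoinRoot.root _ ^ (n * j - j))).smulRight (AdjoinRoot.root _ ^ (t + j)) := by
    refine adjoinRoot_linearMap_ext fun i => ?_
    rw [LinearMap.sum_apply, Finset.sum_eq_single (i % n)]
    · rw [LinearMap.smulRight_apply, LinearMap.comp_apply]
      rw [hl, hl]
      rw [← pow_add, ← pow_add, hc, if_pos, one_smul]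
      · conv_lhs => rw [← Nat.mod_add_div i n, ← add_assoc, pow_add _ _ (n * (i / n)), pow_mul, hroot,
          one_pow, mul_one]
      · have h1 : n * (i % n) - i % n + i = n * (i % n) + n * (i / n) := by
          have := Nat.mod_add_div i n
          have : i % n ≤ n * (i % n) := Nat.le_mul_of_pos_left _ (Nat.pos_of_ne_zero hn)
          omega
        rw [h1]
        exact dvd_add (dvd_mul_right _ _) (dvd_mul_right _ _)
    · intro j hj hji
      rw [LinearMap.smulRight_apply, LinearMap.comp_apply]
      rw [hl]
      rw [← pow_add, hc, if_neg, zero_smul]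
      intro hdvd
      apply hji
      have h2 : j ≤ n * j := Nat.le_mul_of_pos_left _ (Nat.pos_of_ne_zero hn)
      have h3 : n ∣ (n * j - j + i) + j ↔ n ∣ i + n * j := by
        rw [show (n * j - j + i) + j = i + n * j by omega]
      have h4 : i ≡ j [MOD n] := by
        have h5 : (n * j - j + i) + j ≡ 0 + j [MOD n] :=
          Nat.ModEq.add_right j ((Nat.modEq_zero_iff_dvd).2 hdvd)
        rw [show (n * j - j + i) + j = i + n * j by omega, zero_add] at h5
        exact (Nat.ModEq.symm (by simp [Nat.ModEq])).trans h5
      have := h4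
      rw [Nat.ModEq, Nat.mod_eq_of_lt (Finset.mem_range.1 hj)] at this
      exact this.symm
    · intro h; exact absurd (Finset.mem_range.2 (Nat.mod_lt _ (Nat.pos_of_ne_zero hn))) h
  rw [Algebra.trace_apply, key, map_sum]
  have hterm : ∀ j ∈ Finset.range n, LinearMap.trace R _ ((c ∘ₗ Algebra.lmul R
      (AdjoinRoot (X ^ n - 1 : R[X])) (AdjoinRoot.root _ ^ (n * j - j))).smulRight
        (AdjoinRoot.root _ ^ (t + j))) = if n ∣ t then 1 else 0 := by
    intro j _
    rw [LinearMap.trace_smulRight, LinearMap.comp_apply]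
    rw [hl]
    have h2 : j ≤ n * j := Nat.le_mul_of_pos_left _ (Nat.pos_of_ne_zero hn)
    rw [← pow_add, hc, show n * j - j + (t + j) = t + n * j by omega]
    simp only [Nat.dvd_add_left (dvd_mul_right n j)]
  rw [Finset.sum_congr rfl hterm]
  simp

end CyclicModules

/-! ### Jordan blocks with a permutation module of endomorphisms -/

section JordanBlocks

variable {k : Type*} [Field k]

/-- The nilpotent element `X - 1` of `k[X] ⧸ ((X - 1) ^ n)`. -/
noncomputable def nilp (k : Type*) [Field k] (n : ℕ) : AdjoinRoot ((X - 1 : k[X]) ^ n) :=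
  AdjoinRoot.root _ - 1

theorem monic_X_sub_one_pow (k : Type*) [CommRing k] (n : ℕ) : ((X - 1 : k[X]) ^ n).Monic := by
  simpa using (monic_X_sub_C (1 : k)).pow n

theorem natDegree_X_sub_one_pow (k : Type*) [CommRing k] [Nontrivial k] (n : ℕ) :
    ((X - 1 : k[X]) ^ n).natDegree = n := by
  have := (monic_X_sub_C (1 : k)).natDegree_pow n
  rwa [natDegree_X_sub_C, mul_one, map_one] at this

theorem nilp_pow (n m : ℕ) : nilp k n ^ m = AdjoinRoot.mk _ ((X - 1) ^ m) := by
  simp [nilp]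

theorem nilp_pow_eq_zero {n m : ℕ} (h : n ≤ m) : nilp k n ^ m = 0 := by
  rw [nilp_pow, AdjoinRoot.mk_eq_zero]
  exact pow_dvd_pow _ h

theorem le_of_nilp_pow_dvd {n m d : ℕ} (hd : d < n) (h : nilp k n ^ m ∣ nilp k n ^ d) : m ≤ d := by
  by_contra hlt
  have hX1 : Prime (X - 1 : k[X]) := by simpa using prime_X_sub_C (1 : k)
  have h1 : nilp k n ^ (m + (n - 1 - d)) ∣ nilp k n ^ (d + (n - 1 - d)) := by
    rw [pow_add, pow_add]; exact mul_dvd_mul_right h _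
  rw [nilp_pow_eq_zero (by omega), zero_dvd_iff, nilp_pow, AdjoinRoot.mk_eq_zero,
    pow_dvd_pow_iff hX1.ne_zero hX1.not_isUnit] at h1
  omega

/-- The powers of `nilp k n` below the `n`-th are a basis of `k[X] ⧸ ((X - 1) ^ n)`: linear maps can
be prescribed on them. -/
theorem exists_linearMap_nilp {n : ℕ} {M : Type*} [AddCommGroup M] [Module k M] (φ : ℕ → M)
    (hφ : ∀ m, n ≤ m → φ m = 0) :
    ∃ L : AdjoinRoot ((X - 1 : k[X]) ^ n) →ₗ[k] M, ∀ m, L (nilp k n ^ m) = φ m := by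
  let Φ : k[X] →ₗ[k] M := (Polynomial.basisMonomials k).constr k φ ∘ₗ taylor 1
  have hΦ : ∀ m, Φ ((X - 1) ^ m) = φ m := by
    intro m
    have : taylor 1 ((X - 1 : k[X]) ^ m) = monomial m 1 := by
      rw [taylor_pow, map_sub, taylor_X, taylor_one, ← X_pow_eq_monomial]; simp
    simp only [Φ, LinearMap.comp_apply]
    rw [this]
    have h := (Polynomial.basisMonomials k).constr_basis k φ m
    rwa [coe_basisMonomials] at h
  have hzero : ∀ P, Φ ((X - 1) ^ n * P) = 0 := by
    intro P
    have h2 : ∀ P, taylor 1 ((X - 1 : k[X]) ^ n * P) = X ^ n * taylor 1 P := by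
      intro P
      rw [taylor_mul, taylor_pow, map_sub, taylor_X, taylor_one]; simp
    simp only [Φ, LinearMap.comp_apply, h2]
    generalize taylor 1 P = S
    induction S using Polynomial.induction_on' with
    | add a b ha hb => rw [mul_add, map_add, ha, hb, add_zero]
    | monomial m c =>
      rw [X_pow_mul_monomial, ← mul_one c, ← smul_eq_mul, ← smul_monomial, map_smul]
      have h := (Polynomial.basisMonomials k).constr_basis k φ (m + n)
      rw [coe_basisMonomials] at h
      rw [h, hφ _ (by omega), smul_zero]
  refine ⟨Φ ∘ₗ AdjoinRoot.modByMonicHom (monic_X_sub_one_pow k n), fun m => ?_⟩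
  rw [nilp_pow, LinearMap.comp_apply, AdjoinRoot.modByMonicHom_mk, ← hΦ]
  have := modByMonic_add_div ((X - 1 : k[X]) ^ m) ((X - 1) ^ n)
  conv_rhs => rw [← this, map_add, hzero, add_zero]

theorem linearMap_ext_nilp {n : ℕ} {M : Type*} [AddCommGroup M] [Module k M]
    {φ ψ : AdjoinRoot ((X - 1 : k[X]) ^ n) →ₗ[k] M} (h : ∀ m, φ (nilp k n ^ m) = ψ (nilp k n ^ m)) :
    φ = ψ := by
  refine adjoinRoot_linearMap_ext fun m => ?_
  have : AdjoinRoot.root ((X - 1 : k[X]) ^ n) ^ m =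
      ∑ i ∈ Finset.range (m + 1), (m.choose i : k) • nilp k n ^ i := by
    rw [show AdjoinRoot.root ((X - 1 : k[X]) ^ n) = nilp k n + 1 by simp [nilp], add_pow]
    refine Finset.sum_congr rfl fun i _ => ?_
    rw [one_pow, mul_one, mul_comm, Algebra.smul_def, map_natCast]
  rw [this, map_sum, map_sum]
  exact Finset.sum_congr rfl fun i _ => by rw [map_smul, map_smul, h]

theorem isUnit_root_X_sub_one_pow (n : ℕ) : IsUnit (AdjoinRoot.root ((X - 1 : k[X]) ^ n)) := by
  have : IsNilpotent (nilp k n) := ⟨n, nilp_pow_eq_zero le_rfl⟩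
  have h := this.isUnit_add_one
  rwa [nilp, sub_add_cancel] at h

/-- If the endomorphism module of a Jordan block of size `n` is a direct summand of a permutation
module, then `n ≤ p ^ j` or `n ≥ (p - 1) * p ^ j`. Restrict to the subgroup of index `p ^ j`, whose
generator acts by `1 + Y` with `Y = (X - 1) ^ p ^ j` and Jordan blocks of sizes `B + 1` and `B`. The
map from a long block to a short one that matches generators (the map `Y` on one block, if all are
long) commutes with `Y` and is a commutator with `Y`, hence would have to be a norm
`∑ t < p, (1 + Y) ^ t w (1 + Y) ^ (-t)`; but norms map every vector into the image of
`Y ^ (p - 1 - B)`. -/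
theorem le_or_le_of_isPermSummand_conjRoot {p : ℕ} [Fact p.Prime] [CharP k p] {n j : ℕ}
    (h : IsPermSummand p (conjRoot ((X - 1 : k[X]) ^ n))) :
    n ≤ p ^ j ∨ (p - 1) * p ^ j ≤ n := by
  classical
  have hp : p.Prime := Fact.out
  by_contra! hcon
  obtain ⟨hQn, hn2⟩ := hcon
  set Q := p ^ j with hQ
  have hQpos : 0 < Q := pow_pos hp.pos j
  obtain ⟨B, d, hd0, hdQ, hnB⟩ : ∃ B d, 0 < d ∧ d ≤ Q ∧ n = B * Q + d := by
    refine ⟨(n - 1) / Q, (n - 1) % Q + 1, Nat.succ_pos _, Nat.mod_lt _ hQpos, ?_⟩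
    have := Nat.div_add_mod' (n - 1) Q
    omega
  have hB : 0 < B := by
    rcases Nat.eq_zero_or_pos B with rfl | hB
    · omega
    · exact hB
  have hBQ : Q ≤ B * Q := Nat.le_mul_of_pos_left _ hB
  have hdn : d < n := by omega
  have hBp : B < p - 1 := by
    by_contra hlt
    have := Nat.mul_le_mul_right Q (not_lt.1 hlt)
    omega
  let ν := nilp k n
  let x := AdjoinRoot.root ((X - 1 : k[X]) ^ n)
  let z := Ring.inverse x
  have hxz : x * z = 1 := Ring.mul_inverse_cancel _ (isUnit_root_X_sub_one_pow n)
  have hxzQ : x ^ Q * z ^ Q = 1 := by rw [← mul_pow, hxz, one_pow]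
  have hxQ : x ^ Q = 1 + ν ^ Q := by
    have : CharP (AdjoinRoot ((X - 1 : k[X]) ^ n)) p := by
      have : Nontrivial (AdjoinRoot ((X - 1 : k[X]) ^ n)) := ⟨ν ^ d, 0, by
        intro h0
        have := le_of_nilp_pow_dvd (m := n) hdn (by
          change _ ∣ ν ^ d
          rw [h0]; exact dvd_zero _)
        omega⟩
      exact charP_of_injective_algebraMap (algebraMap k _).injective p
    change _ = 1 + (x - 1) ^ p ^ j
    rw [sub_pow_char_pow, one_pow, hQ]; ring
  have hconj : ∀ (t : ℕ) (w : Module.End k (AdjoinRoot ((X - 1 : k[X]) ^ n))) v,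
      (conjRoot ((X - 1 : k[X]) ^ n) ^ t) w v = x ^ t * w (z ^ t * v) := by
    intro t w
    induction t with
    | zero => intro v; simp
    | succ t ih =>
      intro v
      rw [pow_succ', Module.End.mul_apply]
      change x * (conjRoot ((X - 1 : k[X]) ^ n) ^ t) w (z * v) = _
      rw [ih]; ring_nf
  -- `f` is the `Y`-linear map that sends the generator `1` of a block of size `B + 1` to `ν ^ d`,
  -- which is annihilated by `Y ^ B`, and kills the other blocks `k[Y] ν ^ i`, `0 < i < Q`
  obtain ⟨f, hf⟩ := exists_linearMap_nilp (k := k) (n := n) (M := AdjoinRoot ((X - 1 : k[X]) ^ n))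
    (fun m => if Q ∣ m then ν ^ (m + d) else 0)
    (fun m hm => by
      split_ifs
      · exact nilp_pow_eq_zero (by omega)
      · rfl)
  -- `η` sends `Y ^ s` to `- s Y ^ (s - 1) f 1`, so that `f = Y η - η Y`
  obtain ⟨η, hη⟩ := exists_linearMap_nilp (k := k) (n := n) (M := AdjoinRoot ((X - 1 : k[X]) ^ n))
    (fun m => if Q ∣ m then -((m / Q : ℕ) : k) • ν ^ (m + d - Q) else 0)
    (fun m hm => by
      split_ifs with hQm
      · obtain ⟨s, rfl⟩ := hQm
        have hBs : B < s := by
          by_contra hlt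
          have := Nat.mul_le_mul_left Q (not_lt.1 hlt)
          rw [Nat.mul_comm Q B] at this
          omega
        have : Q * (B + 1) ≤ Q * s := Nat.mul_le_mul_left Q hBs
        rw [mul_add, mul_one, mul_comm Q B] at this
        rw [show ν ^ (Q * s + d - Q) = 0 from
          nilp_pow_eq_zero (by omega), smul_zero]
      · rfl)
  have hQdvd : ∀ m, Q ∣ Q + m ↔ Q ∣ m := fun m => (Nat.dvd_add_right (dvd_refl Q))
  have hfY : ∀ v, f (ν ^ Q * v) = ν ^ Q * f v := by
    intro v
    have : f ∘ₗ LinearMap.mulLeft k (ν ^ Q) = LinearMap.mulLeft k (ν ^ Q) ∘ₗ f := by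
      refine linearMap_ext_nilp fun m => ?_
      simp only [LinearMap.comp_apply, LinearMap.mulLeft_apply]
      change f (ν ^ Q * ν ^ m) = ν ^ Q * _
      rw [← pow_add, hf, hf]
      simp only [hQdvd]
      split_ifs
      · rw [← pow_add, add_assoc]
      · rw [mul_zero]
    exact LinearMap.congr_fun this v
  have hcomm : ∀ v, f v = ν ^ Q * η v - η (ν ^ Q * v) := by
    intro v
    have : f = LinearMap.mulLeft k (ν ^ Q) ∘ₗ η - η ∘ₗ LinearMap.mulLeft k (ν ^ Q) := by
      refine linearMap_ext_nilp fun m => ?_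
      simp only [LinearMap.sub_apply, LinearMap.comp_apply, LinearMap.mulLeft_apply]
      change _ = ν ^ Q * _ - η (ν ^ Q * ν ^ m)
      rw [← pow_add, hf, hη, hη]
      simp only [hQdvd]
      split_ifs with hQm
      · obtain ⟨s, rfl⟩ := hQm
        have e1 : Q * s / Q = s := Nat.mul_div_cancel_left s hQpos
        have e2 : (Q + Q * s) / Q = s + 1 := by
          rw [Nat.add_div_left _ hQpos, e1]
        have e3 : Q + Q * s + d - Q = Q * s + d := by omega
        rw [e1, e2, e3]
        have e4 : ν ^ Q * (-(s : k) • ν ^ (Q * s + d - Q)) = -(s : k) • ν ^ (Q * s + d) := by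
          rcases Nat.eq_zero_or_pos s with rfl | hs
          · simp
          · have : Q ≤ Q * s := Nat.le_mul_of_pos_right _ hs
            rw [mul_smul_comm, ← pow_add, show Q + (Q * s + d - Q) = Q * s + d by omega]
        rw [e4, ← sub_smul]
        simp
      · simp
    exact LinearMap.congr_fun this v
  obtain ⟨w, hw⟩ := (h.pow Q).exists_norm hp 0 (v := f) (w := η ∘ₗ LinearMap.mulLeft k (x ^ Q))
    (by
      refine LinearMap.ext fun v => ?_
      rw [hconj]
      have : v = x ^ Q * (z ^ Q * v) := by rw [← mul_assoc, hxzQ, one_mul]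
      conv_rhs => rw [this]
      generalize z ^ Q * v = y
      rw [hxQ, add_mul, add_mul, map_add, one_mul, one_mul, hfY])
    (by
      refine LinearMap.ext fun v => ?_
      rw [pow_zero, pow_one, LinearMap.sub_apply, hconj]
      simp only [LinearMap.comp_apply, LinearMap.mulLeft_apply]
      rw [← mul_assoc, hxzQ, one_mul, hcomm, hxQ, add_mul, add_mul, map_add, one_mul, one_mul]
      ring)
  -- commutation with `1 + Y` raises the `Y`-adic degree of an endomorphism by one
  let c := conjRoot ((X - 1 : k[X]) ^ n) ^ Q
  have hdeg : ∀ m, ∀ i y, ν ^ (i * Q) ∣ y → ν ^ ((m + i - B) * Q) ∣ ((c - 1) ^ m) w y := by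
    intro m
    induction m with
    | zero =>
      intro i y hy
      rw [zero_add, pow_zero, Module.End.one_apply]
      rcases Nat.lt_or_ge B i with hi | hi
      · have : y = 0 := by
          rw [← zero_dvd_iff]
          convert hy using 1
          refine (nilp_pow_eq_zero ?_).symm
          have := Nat.mul_le_mul_right Q hi
          rw [Nat.succ_mul] at this
          omega
        rw [this, map_zero]; exact dvd_zero _
      · rw [Nat.sub_eq_zero_of_le hi, zero_mul, pow_zero]; exact one_dvd _
    | succ m ih =>
      intro i y hy
      rw [pow_succ', Module.End.mul_apply]
      generalize ((c - 1) ^ m) w = T at ih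
      rw [LinearMap.sub_apply, LinearMap.sub_apply, hconj, Module.End.one_apply]
      have hz : ν ^ (i * Q) ∣ z ^ Q * y := hy.mul_left _
      have hy' : y = x ^ Q * (z ^ Q * y) := by rw [← mul_assoc, hxzQ, one_mul]
      nth_rw 2 [hy']
      generalize z ^ Q * y = y' at hz
      rw [hxQ, add_mul, add_mul, one_mul, one_mul, map_add, add_sub_add_left_eq_sub]
      refine dvd_sub ?_ ?_
      · have h1 := mul_dvd_mul_left (ν ^ Q) (ih i y' hz)
        rw [← pow_add] at h1
        refine (pow_dvd_pow _ ?_).trans h1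
        calc (m + 1 + i - B) * Q ≤ (m + i - B + 1) * Q := Nat.mul_le_mul_right _ (by omega)
          _ = Q + (m + i - B) * Q := by ring
      · have h1 := ih (i + 1) (ν ^ Q * y') (by
          rw [add_mul, one_mul, add_comm, pow_add]; exact mul_dvd_mul_left _ hz)
        rwa [show m + 1 + i - B = m + (i + 1) - B by omega]
  have hnorm : ∑ t ∈ Finset.range (p ^ (0 + 1)), (c ^ t) w = ((c - 1) ^ (p - 1)) w := by
    have h1 : aeval c (∑ t ∈ Finset.range (p ^ 1), (X : k[X]) ^ t) = (c - 1) ^ (p - 1) := by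
      rw [geom_sum_eq_sub_one_pow p]; simp
    rw [zero_add, ← h1, map_sum, LinearMap.sum_apply]
    simp
  have hfin := hdeg (p - 1) 0 1 (by simp)
  rw [← hnorm, ← hw,
    show (1 : AdjoinRoot ((X - 1 : k[X]) ^ n)) = nilp k n ^ 0 from (pow_zero _).symm, hf, if_pos (dvd_zero Q),
    zero_add] at hfin
  have hle := le_of_nilp_pow_dvd hdn hfin
  -- so `(p - 1 - B) * Q ≤ d ≤ Q`
  have h1 : (p - 1 + 0 - B) * Q = (p - 1) * Q - B * Q := by
    rw [add_zero, Nat.sub_mul]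
  rw [h1] at hle
  omega

end JordanBlocks

/-! ### Base change and determinants of the modules `R[X] ⧸ (f)` -/

section AdjoinRootBaseChange

variable {R : Type*} [CommRing R] (S : Type*) [CommRing S] [Algebra R S] (f : R[X])

/-- The canonical map `R[X] ⧸ (f) → S[X] ⧸ (f)`. -/
noncomputable def adjoinRootMap : AdjoinRoot f →ₐ[R] AdjoinRoot (f.map (algebraMap R S)) :=
  { AdjoinRoot.map (algebraMap R S) f (f.map (algebraMap R S)) dvd_rfl with
    commutes' := fun r => by
      rw [IsScalarTower.algebraMap_apply R S (AdjoinRoot (f.map (algebraMap R S)))]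
      exact AdjoinRoot.map_of _ _ _ _ r }

@[simp] theorem adjoinRootMap_root :
    adjoinRootMap S f (AdjoinRoot.root f) = AdjoinRoot.root (f.map (algebraMap R S)) :=
  AdjoinRoot.map_root _ _ _ dvd_rfl

theorem adjoinRootMap_isBaseChange : IsBaseChange S (adjoinRootMap S f).toLinearMap := by
  let φ : S ⊗[R] AdjoinRoot f →ₐ[S] AdjoinRoot (f.map (algebraMap R S)) :=
    Algebra.TensorProduct.lift (Algebra.ofId S _) (adjoinRootMap S f) fun _ _ => Commute.all _ _
  let ψ : AdjoinRoot (f.map (algebraMap R S)) →ₐ[S] S ⊗[R] AdjoinRoot f :=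
    AdjoinRoot.liftAlgHom _ (Algebra.ofId S _) (1 ⊗ₜ AdjoinRoot.root f) (by
      have h := aeval_algHom_apply (Algebra.TensorProduct.includeRight (R := R) (A := S))
        (AdjoinRoot.root f) f
      rw [AdjoinRoot.aeval_eq, AdjoinRoot.mk_self, map_zero] at h
      rw [eval₂_map]
      exact h)
  have h1 : φ.comp ψ = AlgHom.id S _ := by
    refine AdjoinRoot.algHom_ext ?_
    simp [φ, ψ]
  have h2 : ψ.comp φ = AlgHom.id S _ := by
    refine Algebra.TensorProduct.ext (by ext) ?_
    refine AdjoinRoot.algHom_ext ?_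
    simp [φ, ψ]
  refine IsBaseChange.of_equiv (AlgEquiv.ofAlgHom φ ψ h1 h2).toLinearEquiv fun x => ?_
  simp [φ]

variable {f}

theorem conjRoot_endHom (hf : f.Monic) (hu : IsUnit (AdjoinRoot.root f))
    (h : Module.End R (AdjoinRoot f)) :
    (adjoinRootMap_isBaseChange S f).endHom (conjRoot f h) =
      conjRoot (f.map (algebraMap R S)) ((adjoinRootMap_isBaseChange S f).endHom h) := by
  have := hf.free_adjoinRoot
  have := hf.finite_adjoinRoot
  refine (adjoinRootMap_isBaseChange S f).algHom_ext _ _ fun v => ?_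
  rw [IsBaseChange.endHom_comp_apply]
  have hz : adjoinRootMap S f (Ring.inverse (AdjoinRoot.root f)) =
      Ring.inverse (AdjoinRoot.root (f.map (algebraMap R S))) := by
    have h1 := congrArg (adjoinRootMap S f) (Ring.mul_inverse_cancel _ hu)
    rw [map_mul, map_one, adjoinRootMap_root] at h1
    have hu' : IsUnit (AdjoinRoot.root (f.map (algebraMap R S))) := .of_mul_eq_one _ h1
    exact hu'.mul_left_cancel (by rw [h1, Ring.mul_inverse_cancel _ hu'])
  simp only [conjRoot, sandwich_apply, LinearMap.mulLeft_apply, AlgHom.toLinearMap_apply]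
  rw [map_mul, adjoinRootMap_root, ← hz, ← map_mul]
  congr 1
  exact ((adjoinRootMap_isBaseChange S f).endHom_comp_apply h _).symm

theorem IsPermSummand.conjRoot_map {p : ℕ} (hf : f.Monic) (hu : IsUnit (AdjoinRoot.root f))
    (h : IsPermSummand p (conjRoot f)) : IsPermSummand p (conjRoot (f.map (algebraMap R S))) := by
  have := hf.free_adjoinRoot
  have := hf.finite_adjoinRoot
  exact h.of_isBaseChange (adjoinRootMap_isBaseChange S f).end (conjRoot_endHom S hf hu)

end AdjoinRootBaseChange

section Charpoly

variable {R : Type*} [CommRing R]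

theorem charpoly_lmul_root [Nontrivial R] {f : R[X]} (hf : f.Monic) [Module.Free R (AdjoinRoot f)]
    [Module.Finite R (AdjoinRoot f)] :
    (Algebra.lmul R (AdjoinRoot f) (AdjoinRoot.root f)).charpoly = f := by
  refine (Polynomial.eq_of_monic_of_dvd_of_natDegree_le hf (LinearMap.charpoly_monic _) ?_ ?_)
  · rw [← AdjoinRoot.mk_eq_zero, ← AdjoinRoot.aeval_eq]
    exact Algebra.aeval_self_charpoly_lmul _
  · rw [LinearMap.charpoly_natDegree, (AdjoinRoot.powerBasis' hf).finrank,
      AdjoinRoot.powerBasis'_dim]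

theorem finrank_adjoinRoot [Nontrivial R] {f : R[X]} (hf : f.Monic) :
    Module.finrank R (AdjoinRoot f) = f.natDegree := by
  rw [(AdjoinRoot.powerBasis' hf).finrank, AdjoinRoot.powerBasis'_dim]

theorem norm_root [Nontrivial R] {f : R[X]} (hf : f.Monic) :
    Algebra.norm R (AdjoinRoot.root f) = (-1) ^ f.natDegree * f.coeff 0 := by
  have := hf.free_adjoinRoot
  have := hf.finite_adjoinRoot
  rw [Algebra.norm_apply, LinearMap.det_eq_sign_charpoly_coeff, charpoly_lmul_root hf,
    finrank_adjoinRoot hf]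

theorem exists_coeff_one_of_monic [Nontrivial R] {f : R[X]} (hf : f.Monic) (hd : f.natDegree ≠ 0) :
    ∃ c : AdjoinRoot f →ₗ[R] R, c 1 = 1 := by
  refine ⟨Polynomial.lcoeff R 0 ∘ₗ AdjoinRoot.modByMonicHom hf, ?_⟩
  rw [LinearMap.comp_apply, ← map_one (AdjoinRoot.mk f), AdjoinRoot.modByMonicHom_mk,
    (modByMonic_eq_self_iff hf).2]
  · simp
  · rw [degree_one, degree_eq_natDegree hf.ne_zero]
    exact_mod_cast Nat.pos_of_ne_zero hd

theorem eq_X_sub_one_pow_of_dvd {k : Type*} [Field k] {p : ℕ} [Fact p.Prime] [CharP k p] {l : ℕ}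
    {f : k[X]} (hf : f.Monic) (h : f ∣ X ^ p ^ l - 1) : f = (X - 1) ^ f.natDegree := by
  have hX1 : Prime (X - 1 : k[X]) := by simpa using prime_X_sub_C (1 : k)
  rw [show (X ^ p ^ l - 1 : k[X]) = (X - 1) ^ p ^ l by rw [sub_pow_char_pow, one_pow]] at h
  obtain ⟨n, -, hn⟩ := (dvd_prime_pow hX1 _).1 h
  have := eq_of_monic_of_associated hf (monic_X_sub_one_pow k n) hn
  rw [this, natDegree_X_sub_one_pow]

/-- An `OD`-lattice `O[X] ⧸ (f)` of rank `n ≤ p ^ l` prime to `p`, of determinant one and with a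
permutation module of endomorphisms, is inflated from the quotient of order `p ^ l`: the
kernel acts trivially on the reduction of the endomorphism module, hence on the permuted basis,
so it acts by scalars, and these are trivial by comparing determinants. -/
theorem dvd_X_pow_sub_one_of_natDegree_le {O : Type u} [CommRing O] [IsLocalRing O] {p : ℕ}
    [Fact p.Prime] [CharP (IsLocalRing.ResidueField O) p] {l : ℕ} {f : O[X]} (hf : f.Monic)
    (hdvd : f ∣ X ^ p ^ (l + 1) - 1) (hn : f.natDegree ≤ p ^ l) (hpn : ¬ p ∣ f.natDegree)
    (hdet : (-1) ^ f.natDegree * f.coeff 0 = 1) (h : IsPermSummand p (conjRoot f)) :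
    f ∣ X ^ p ^ l - 1 := by
  have hp : p.Prime := Fact.out
  have := hf.free_adjoinRoot
  have := hf.finite_adjoinRoot
  have hn0 : f.natDegree ≠ 0 := fun h0 => hpn (h0 ▸ dvd_zero p)
  let x := AdjoinRoot.root f
  have hu : IsUnit x := (rootUnit (pow_ne_zero (l + 1) hp.ne_zero) hdvd).isUnit
  let z := Ring.inverse x
  have hxz : x * z = 1 := Ring.mul_inverse_cancel _ hu
  have hxzQ : z ^ p ^ l * x ^ p ^ l = 1 := by rw [← mul_pow, mul_comm, hxz, one_pow]
  have hconj : ∀ (R : Type u) [CommRing R] (f : R[X]) (t : ℕ) (w : Module.End R (AdjoinRoot f)) v,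
      (conjRoot f ^ t) w v =
        AdjoinRoot.root f ^ t * w (Ring.inverse (AdjoinRoot.root f) ^ t * v) := by
    intro R _ f t w
    induction t with
    | zero => intro v; simp
    | succ t ih =>
      intro v
      rw [pow_succ', Module.End.mul_apply]
      change AdjoinRoot.root f * (conjRoot f ^ t) w (Ring.inverse (AdjoinRoot.root f) * v) = _
      rw [ih]; ring_nf
  let κ := IsLocalRing.ResidueField O
  let f' := f.map (algebraMap O κ)
  have hf' : f' = (X - 1) ^ f.natDegree := by
    have h1 : f' ∣ X ^ p ^ (l + 1) - 1 := by
      have := Polynomial.map_dvd (algebraMap O κ) hdvd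
      simpa using this
    have h2 := eq_X_sub_one_pow_of_dvd (hf.map _) h1
    rwa [hf.natDegree_map] at h2
  have hroot' : AdjoinRoot.root f' ^ p ^ l = 1 := by
    refine root_pow_eq_one ?_
    rw [hf', show (X ^ p ^ l - 1 : κ[X]) = (X - 1) ^ p ^ l by rw [sub_pow_char_pow, one_pow]]
    exact pow_dvd_pow _ hn
  have hinv' : Ring.inverse (AdjoinRoot.root f') ^ p ^ l = 1 := by
    rw [Ring.inverse_pow, hroot', Ring.inverse_one]
  have hbc := (adjoinRootMap_isBaseChange κ f).end
  have hendpow : ∀ t h, (adjoinRootMap_isBaseChange κ f).endHom ((conjRoot f ^ t) h) =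
      (conjRoot f' ^ t) ((adjoinRootMap_isBaseChange κ f).endHom h) := by
    intro t
    induction t with
    | zero => intro h; rfl
    | succ t ih =>
      intro h
      rw [pow_succ', Module.End.mul_apply, conjRoot_endHom κ hf hu, ih, pow_succ',
        Module.End.mul_apply]
  have htriv : conjRoot f ^ p ^ l = 1 := by
    obtain ⟨ι, _, b, hb⟩ := h.isPermEnd
    choose τ hτ using hb
    have hbpow : ∀ t i, (conjRoot f ^ t) (b i) = b (τ^[t] i) := by
      intro t
      induction t with
      | zero => intro i; rfl
      | succ t ih =>
        intro i
        rw [pow_succ', Module.End.mul_apply, ih, hτ, Function.iterate_succ_apply']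
    refine b.ext fun i => ?_
    have h1 : (conjRoot f' ^ p ^ l) ((adjoinRootMap_isBaseChange κ f).endHom (b i)) =
        (adjoinRootMap_isBaseChange κ f).endHom (b i) := by
      refine LinearMap.ext fun v => ?_
      rw [hconj, hroot', hinv', one_mul, one_mul]
    rw [← hendpow, hbpow, ← hbc.basis_apply, ← hbc.basis_apply] at h1
    rw [hbpow, (hbc.basis b).injective h1]; rfl
  obtain ⟨c, hc⟩ := exists_coeff_one_of_monic hf hn0
  have hscal : x ^ p ^ l = algebraMap O _ (c (x ^ p ^ l)) := by
    have h1 := LinearMap.congr_fun (LinearMap.congr_fun htriv (c.smulRight 1)) (x ^ p ^ l)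
    rw [hconj] at h1
    change x ^ p ^ l * c (z ^ p ^ l * x ^ p ^ l) • 1 = c (x ^ p ^ l) • 1 at h1
    rw [hxzQ, hc, one_smul, mul_one] at h1
    rwa [Algebra.algebraMap_eq_smul_one]
  set a := c (x ^ p ^ l) with ha
  have ha1 : a ^ p = 1 := by
    have h1 : x ^ p ^ (l + 1) = 1 := root_pow_eq_one hdvd
    rw [pow_succ, pow_mul, hscal, ← map_pow] at h1
    have h2 := congrArg c h1
    rwa [Algebra.algebraMap_eq_smul_one, map_smul, hc, smul_eq_mul, mul_one] at h2
  have ha2 : a ^ f.natDegree = 1 := by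
    have h1 : Algebra.norm O (x ^ p ^ l) = 1 := by
      rw [map_pow, norm_root hf, hdet, one_pow]
    rwa [hscal, Algebra.norm_algebraMap_of_basis (AdjoinRoot.powerBasis' hf).basis,
      Fintype.card_fin, AdjoinRoot.powerBasis'_dim] at h1
  have ha3 : a = 1 := by
    have hcop : Nat.gcd p f.natDegree = 1 := (hp.coprime_iff_not_dvd).2 hpn
    have h1 := pow_gcd_eq_one.2 ⟨ha1, ha2⟩
    rwa [hcop, pow_one] at h1
  exact dvd_of_root_pow_eq_one (by rw [show AdjoinRoot.root f = x from rfl, hscal, ha3, map_one])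

end Charpoly

/-! ### The standard polynomials -/

section StandardPolynomials

/-- The monic polynomials `f` such that `ℤ[X] ⧸ (f)` is the standard lattice obtained from the
trivial one by taking, for `m = 1, 2, …`, the syzygy relative to the subgroup of index `p ^ m`
whenever the bit `β (m - 1)` is set. Such a syzygy replaces `f` by `(X ^ p ^ m - 1) / f`. -/
noncomputable def stdPoly (p : ℕ) (β : ℕ → Fin 2) : ℕ → ℤ[X]
  | 0 => X - 1
  | m + 1 => if β m = 1 then (X ^ p ^ (m + 1) - 1) /ₘ stdPoly p β m else stdPoly p β m

variable {p : ℕ} (β : ℕ → Fin 2)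

theorem monic_X_pow_p_sub_one {R : Type*} [CommRing R] (hp : p.Prime) (m : ℕ) :
    (X ^ p ^ m - 1 : R[X]).Monic := by
  simpa using monic_X_pow_sub_C (1 : R) (pow_ne_zero m hp.ne_zero)

theorem natDegree_X_pow_p_sub_one (R : Type*) [CommRing R] [Nontrivial R] (m : ℕ) :
    (X ^ p ^ m - 1 : R[X]).natDegree = p ^ m := by
  simpa using natDegree_X_pow_sub_C (n := p ^ m) (r := (1 : R))

theorem X_pow_p_sub_one_dvd {R : Type*} [CommRing R] {m n : ℕ} (h : m ≤ n) :
    (X ^ p ^ m - 1 : R[X]) ∣ X ^ p ^ n - 1 := by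
  obtain ⟨c, hc⟩ := pow_dvd_pow p h
  rw [hc, pow_mul]
  simpa using sub_dvd_pow_sub_pow (X ^ p ^ m : R[X]) 1 c

theorem stdPoly_spec (hp : p.Prime) (m : ℕ) :
    (stdPoly p β m).Monic ∧ stdPoly p β m ∣ X ^ p ^ m - 1 := by
  induction m with
  | zero =>
    refine ⟨?_, by simp [stdPoly]⟩
    change (X - 1 : ℤ[X]).Monic
    simpa using monic_X_sub_C (1 : ℤ)
  | succ m ih =>
    have hdvd := ih.2.trans (X_pow_p_sub_one_dvd (Nat.le_succ m))
    rw [stdPoly]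
    split_ifs
    · obtain ⟨c, hc⟩ := hdvd
      rw [hc, mul_divByMonic_cancel_left _ ih.1]
      refine ⟨?_, Dvd.intro_left _ rfl⟩
      exact ih.1.of_mul_monic_left (hc ▸ monic_X_pow_p_sub_one hp _)
    · exact ⟨ih.1, hdvd⟩

theorem monic_stdPoly (hp : p.Prime) (m : ℕ) : (stdPoly p β m).Monic := (stdPoly_spec β hp m).1

variable {β}

theorem natDegree_stdPoly_zero : (stdPoly p β 0).natDegree = 1 := by
  change (X - 1 : ℤ[X]).natDegree = 1
  simpa using natDegree_X_sub_C (1 : ℤ)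

theorem stdPoly_succ_of_eq_zero {m : ℕ} (h : β m = 0) : stdPoly p β (m + 1) = stdPoly p β m := by
  rw [stdPoly, h, if_neg (by decide)]

theorem stdPoly_mul_succ (hp : p.Prime) {m : ℕ} (h : β m = 1) :
    stdPoly p β m * stdPoly p β (m + 1) = X ^ p ^ (m + 1) - 1 := by
  obtain ⟨c, hc⟩ := (stdPoly_spec β hp m).2.trans (X_pow_p_sub_one_dvd (Nat.le_succ m))
  rw [stdPoly, if_pos h, hc, mul_divByMonic_cancel_left _ (monic_stdPoly β hp m)]

theorem stdPoly_congr {β' : ℕ → Fin 2} {m : ℕ} (h : ∀ i < m, β i = β' i) :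
    stdPoly p β m = stdPoly p β' m := by
  induction m with
  | zero => rfl
  | succ m ih =>
    rw [stdPoly, stdPoly, ih fun i hi => h i (by omega), h m (by omega)]

theorem natDegree_stdPoly_le (hp : p.Prime) (m : ℕ) : (stdPoly p β m).natDegree ≤ p ^ m := by
  have := natDegree_le_of_dvd (stdPoly_spec β hp m).2 (monic_X_pow_p_sub_one hp m).ne_zero
  rwa [natDegree_X_pow_p_sub_one] at this

theorem natDegree_stdPoly_succ (hp : p.Prime) {m : ℕ} (h : β m = 1) :
    (stdPoly p β m).natDegree + (stdPoly p β (m + 1)).natDegree = p ^ (m + 1) := by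
  rw [← (monic_stdPoly β hp m).natDegree_mul (monic_stdPoly β hp (m + 1)), stdPoly_mul_succ hp h,
    natDegree_X_pow_p_sub_one]

theorem not_dvd_natDegree_stdPoly (hp : p.Prime) (m : ℕ) : ¬ p ∣ (stdPoly p β m).natDegree := by
  induction m with
  | zero =>
    rw [natDegree_stdPoly_zero]
    exact fun h => hp.one_lt.ne' (Nat.dvd_one.1 h)
  | succ m ih =>
    rcases (show β m = 0 ∨ β m = 1 by omega) with h | h
    · rwa [stdPoly_succ_of_eq_zero h]
    · intro hd
      have h1 := natDegree_stdPoly_succ hp h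
      exact ih ((Nat.dvd_add_left hd).1 (h1 ▸ dvd_pow_self p (Nat.succ_ne_zero m)))

theorem natDegree_stdPoly_pos (hp : p.Prime) (m : ℕ) : 0 < (stdPoly p β m).natDegree :=
  Nat.pos_of_ne_zero fun h => not_dvd_natDegree_stdPoly hp m (h ▸ dvd_zero p)

theorem natDegree_stdPoly_injective (hp : p.Prime) (hp2 : p ≠ 2) {β' : ℕ → Fin 2} {m : ℕ}
    (h : (stdPoly p β m).natDegree = (stdPoly p β' m).natDegree) : ∀ i < m, β i = β' i := by
  -- the two values of the top bit give degrees `≤ p ^ m` and `≥ (p - 1) * p ^ m`, respectively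
  have hdis : ∀ {m : ℕ} {β β' : ℕ → Fin 2}, β m = 0 → β' m = 1 →
      (stdPoly p β (m + 1)).natDegree < (stdPoly p β' (m + 1)).natDegree := by
    intro m β β' h0 h1
    have e1 := natDegree_stdPoly_succ hp h1
    have e2 := natDegree_stdPoly_le (β := β') hp m
    have e3 := natDegree_stdPoly_le (β := β) hp m
    have h3 : 3 ≤ p := by have := hp.two_le; omega
    have e4 : 3 * p ^ m ≤ p ^ (m + 1) := by rw [pow_succ']; exact Nat.mul_le_mul_right _ h3
    have e5 : 0 < p ^ m := pow_pos hp.pos m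
    rw [stdPoly_succ_of_eq_zero h0]
    omega
  induction m with
  | zero => intro i hi; omega
  | succ m ih =>
    have htop : β m = β' m := by
      rcases (show β m = 0 ∨ β m = 1 by omega) with h0 | h0 <;>
      rcases (show β' m = 0 ∨ β' m = 1 by omega) with h1 | h1
      · rw [h0, h1]
      · exact absurd h (hdis h0 h1).ne
      · exact absurd h (hdis h1 h0).ne'
      · rw [h0, h1]
    have hm : (stdPoly p β m).natDegree = (stdPoly p β' m).natDegree := by
      rcases (show β m = 0 ∨ β m = 1 by omega) with h0 | h0
      · rwa [stdPoly_succ_of_eq_zero h0, stdPoly_succ_of_eq_zero (htop ▸ h0)] at h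
      · have e1 := natDegree_stdPoly_succ hp h0
        have e2 := natDegree_stdPoly_succ (β := β') hp (htop ▸ h0)
        omega
    intro i hi
    rcases Nat.lt_succ_iff_lt_or_eq.1 hi with hi | rfl
    · exact ih hm i hi
    · exact htop

variable (R : Type*) [CommRing R] (β)

/-- The polynomial `stdPoly p β m` with coefficients in `R`. -/
noncomputable def stdPolyIn (p : ℕ) (m : ℕ) : R[X] := (stdPoly p β m).map (Int.castRingHom R)

theorem monic_stdPolyIn (hp : p.Prime) (m : ℕ) : (stdPolyIn β R p m).Monic :=
  (monic_stdPoly β hp m).map _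

theorem natDegree_stdPolyIn [Nontrivial R] (hp : p.Prime) (m : ℕ) :
    (stdPolyIn β R p m).natDegree = (stdPoly p β m).natDegree :=
  (monic_stdPoly β hp m).natDegree_map _

theorem stdPolyIn_dvd (hp : p.Prime) (m : ℕ) : stdPolyIn β R p m ∣ X ^ p ^ m - 1 := by
  have := Polynomial.map_dvd (Int.castRingHom R) (stdPoly_spec β hp m).2
  rw [stdPolyIn]
  simpa using this

theorem stdPolyIn_map (S : Type*) [CommRing S] [Algebra R S] (m : ℕ) :
    (stdPolyIn β R p m).map (algebraMap R S) = stdPolyIn β S p m := by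
  rw [stdPolyIn, stdPolyIn, Polynomial.map_map]
  congr 1
  exact Subsingleton.elim _ _

theorem stdPolyIn_zero : stdPolyIn β R p 0 = X - 1 := by simp [stdPolyIn, stdPoly]

variable {β}

theorem stdPolyIn_succ_of_eq_zero {m : ℕ} (h : β m = 0) :
    stdPolyIn β R p (m + 1) = stdPolyIn β R p m := by
  rw [stdPolyIn, stdPoly_succ_of_eq_zero h]; rfl

theorem stdPolyIn_mul_succ (hp : p.Prime) {m : ℕ} (h : β m = 1) :
    stdPolyIn β R p m * stdPolyIn β R p (m + 1) = X ^ p ^ (m + 1) - 1 := by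
  rw [stdPolyIn, stdPolyIn, ← Polynomial.map_mul, stdPoly_mul_succ hp h]; simp

theorem det_cofactor {R : Type*} [CommRing R] [Nontrivial R] (hp : p.Prime) (hp2 : p ≠ 2) {m : ℕ}
    {f F : R[X]} (hf : f.Monic) (hF : F.Monic) (h : f * F = X ^ p ^ m - 1)
    (hdet : (-1) ^ f.natDegree * f.coeff 0 = 1) : (-1) ^ F.natDegree * F.coeff 0 = 1 := by
  have h0 : f.coeff 0 * F.coeff 0 = -1 := by
    rw [← mul_coeff_zero, h]
    simp [(pow_ne_zero m hp.ne_zero).symm]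
  have hd : f.natDegree + F.natDegree = p ^ m := by
    rw [← hf.natDegree_mul hF, h, natDegree_X_pow_p_sub_one]
  have hodd : (-1 : R) ^ (f.natDegree + F.natDegree) = -1 := by
    rw [hd]; exact ((hp.odd_of_ne_two hp2).pow).neg_one_pow
  calc (-1) ^ F.natDegree * F.coeff 0
      = ((-1) ^ f.natDegree * f.coeff 0) * ((-1) ^ F.natDegree * F.coeff 0) := by rw [hdet, one_mul]
    _ = (-1) ^ (f.natDegree + F.natDegree) * (f.coeff 0 * F.coeff 0) := by rw [pow_add]; ring
    _ = 1 := by rw [hodd, h0]; ring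

theorem det_stdPolyIn [Nontrivial R] (hp : p.Prime) (hp2 : p ≠ 2) (m : ℕ) :
    (-1) ^ (stdPolyIn β R p m).natDegree * (stdPolyIn β R p m).coeff 0 = 1 := by
  induction m with
  | zero =>
    have := natDegree_X_sub_one_pow R 1
    rw [pow_one] at this
    rw [stdPolyIn_zero, this]
    simp
  | succ m ih =>
    rcases (show β m = 0 ∨ β m = 1 by omega) with h | h
    · rwa [stdPolyIn_succ_of_eq_zero R h]
    · exact det_cofactor hp hp2 (monic_stdPolyIn β R hp m) (monic_stdPolyIn β R hp (m + 1))
        (stdPolyIn_mul_succ R hp h) ih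

/-- The standard lattices are endo-permutation. -/
theorem isPermSummand_conjRoot_stdPolyIn [Nontrivial R] (hp : p.Prime) (m : ℕ) :
    IsPermSummand p (conjRoot (stdPolyIn β R p m)) := by
  induction m with
  | zero =>
    -- conjugation on the endomorphisms of a module of rank one is trivial
    rw [stdPolyIn_zero]
    have hroot : AdjoinRoot.root (X - 1 : R[X]) = 1 := by
      have := root_pow_eq_one (f := (X - 1 : R[X])) (n := 1) (by rw [pow_one])
      rwa [pow_one] at this
    have h1 : conjRoot (X - 1 : R[X]) = 1 := by
      refine LinearMap.ext fun h => LinearMap.ext fun v => ?_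
      simp [conjRoot, hroot]
    have hm : (X - 1 : R[X]).Monic := by simpa using monic_X_sub_C (1 : R)
    have := hm.free_adjoinRoot
    have := hm.finite_adjoinRoot
    refine IsPermEnd.isPermSummand (N := 0) hp.pos ⟨Fin _, inferInstance,
      Module.finBasis R (Module.End R (AdjoinRoot (X - 1 : R[X]))), fun i => ⟨i, by rw [h1]; rfl⟩⟩ ?_
    rw [h1, one_pow]
  | succ m ih =>
    rcases (show β m = 0 ∨ β m = 1 by omega) with h | h
    · rwa [stdPolyIn_succ_of_eq_zero R h]
    · exact ih.conjRoot_cofactor hp (monic_stdPolyIn β R hp m) (monic_stdPolyIn β R hp (m + 1))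
        (stdPolyIn_mul_succ R hp h)

end StandardPolynomials

section Classification

variable {p : ℕ} [Fact p.Prime]

/-- Dade's classification over a field: the size, if prime to `p`, of a Jordan block whose
endomorphism module is a permutation module is the degree of a standard polynomial. -/
theorem exists_natDegree_stdPoly_eq {k : Type*} [Field k] [CharP k p] (l : ℕ) :
    ∀ n ≤ p ^ l, ¬ p ∣ n → IsPermSummand p (conjRoot ((X - 1 : k[X]) ^ n)) →
      ∃ β : ℕ → Fin 2, (stdPoly p β l).natDegree = n := by
  have hp : p.Prime := Fact.out
  induction l with
  | zero =>
    intro n hn hpn _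
    refine ⟨0, ?_⟩
    rw [natDegree_stdPoly_zero]
    have : n ≠ 0 := fun h => hpn (h ▸ dvd_zero p)
    rw [pow_zero] at hn
    omega
  | succ l ih =>
    intro n hn hpn h
    rcases le_or_le_of_isPermSummand_conjRoot (j := l) h with hle | hle
    · obtain ⟨β, hβ⟩ := ih n hle hpn h
      refine ⟨Function.update β l 0, ?_⟩
      rw [stdPoly_succ_of_eq_zero (Function.update_self _ _ _), ← hβ]
      exact congrArg _ (stdPoly_congr fun i hi => Function.update_of_ne hi.ne _ _)
    · have hmul : (X - 1 : k[X]) ^ n * (X - 1) ^ (p ^ (l + 1) - n) = X ^ p ^ (l + 1) - 1 := by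
        rw [← pow_add, Nat.add_sub_cancel' hn, sub_pow_char_pow, one_pow]
      have hle' : p ^ (l + 1) - n ≤ p ^ l := by
        have : (p - 1) * p ^ l + p ^ l = p ^ (l + 1) := by
          rw [← Nat.succ_mul, Nat.succ_eq_add_one, Nat.sub_add_cancel hp.pos, pow_succ']
        omega
      have hpn' : ¬ p ∣ p ^ (l + 1) - n := by
        intro hd
        have := (Nat.dvd_sub_iff_right hn (dvd_pow_self p (Nat.succ_ne_zero l))).1 hd
        exact hpn this
      obtain ⟨β, hβ⟩ := ih _ hle' hpn' (h.conjRoot_cofactor hp (monic_X_sub_one_pow k n)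
        (monic_X_sub_one_pow k _) hmul)
      refine ⟨Function.update β l 1, ?_⟩
      have h1 := natDegree_stdPoly_succ (β := Function.update β l 1) hp (Function.update_self _ _ _)
      rw [stdPoly_congr (β' := β) fun i hi => Function.update_of_ne hi.ne _ _, hβ] at h1
      omega

/-- The lattice form of the classification: an endo-permutation lattice `O[X] ⧸ (f)` of determinant
one and rank prime to `p` is standard. -/
theorem exists_stdPolyIn_eq {O : Type u} [CommRing O] [IsLocalRing O]
    [CharP (IsLocalRing.ResidueField O) p] (hp2 : p ≠ 2) (l : ℕ) :
    ∀ f : O[X], f.Monic → f ∣ X ^ p ^ l - 1 → ¬ p ∣ f.natDegree →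
      (-1) ^ f.natDegree * f.coeff 0 = 1 → IsPermSummand p (conjRoot f) →
      ∃ β : ℕ → Fin 2, f = stdPolyIn β O p l := by
  have hp : p.Prime := Fact.out
  induction l with
  | zero =>
    intro f hf hdvd hpn _ _
    refine ⟨0, ?_⟩
    rw [pow_zero, pow_one] at hdvd
    rw [stdPolyIn_zero]
    refine (Polynomial.eq_of_monic_of_dvd_of_natDegree_le hf
      (by simpa using monic_X_sub_C (1 : O)) hdvd ?_).symm
    have := natDegree_X_sub_one_pow O 1
    rw [pow_one] at this
    rw [this]
    exact Nat.pos_of_ne_zero fun h => hpn (h ▸ dvd_zero p)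
  | succ l ih =>
    intro f hf hdvd hpn hdet h
    have hu : IsUnit (AdjoinRoot.root f) :=
      (rootUnit (pow_ne_zero (l + 1) hp.ne_zero) hdvd).isUnit
    have hred := h.conjRoot_map (IsLocalRing.ResidueField O) hf hu
    have hdvd' : f.map (algebraMap O (IsLocalRing.ResidueField O)) ∣ X ^ p ^ (l + 1) - 1 := by
      have := Polynomial.map_dvd (algebraMap O (IsLocalRing.ResidueField O)) hdvd
      simpa using this
    rw [eq_X_sub_one_pow_of_dvd (hf.map _) hdvd', hf.natDegree_map] at hred
    rcases le_or_le_of_isPermSummand_conjRoot (j := l) hred with hle | hle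
    · obtain ⟨β, hβ⟩ := ih f hf (dvd_X_pow_sub_one_of_natDegree_le hf hdvd hle hpn hdet h) hpn hdet h
      refine ⟨Function.update β l 0, ?_⟩
      rw [stdPolyIn_succ_of_eq_zero O (Function.update_self _ _ _), hβ, stdPolyIn, stdPolyIn]
      exact congrArg _ (stdPoly_congr fun i hi => (Function.update_of_ne hi.ne _ _).symm)
    · obtain ⟨F, hF⟩ := hdvd
      have hFm : F.Monic := hf.of_mul_monic_left (hF ▸ monic_X_pow_p_sub_one hp _)
      have hFp := h.conjRoot_cofactor hp hf hFm hF.symm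
      have hFdet := det_cofactor hp hp2 hf hFm hF.symm hdet
      have hdeg : f.natDegree + F.natDegree = p ^ (l + 1) := by
        rw [← hf.natDegree_mul hFm, ← hF, natDegree_X_pow_p_sub_one]
      have hFle : F.natDegree ≤ p ^ l := by
        have : (p - 1) * p ^ l + p ^ l = p ^ (l + 1) := by
          rw [← Nat.succ_mul, Nat.succ_eq_add_one, Nat.sub_add_cancel hp.pos, pow_succ']
        omega
      have hpF : ¬ p ∣ F.natDegree := fun hd =>
        hpn ((Nat.dvd_add_left hd).1 (hdeg ▸ dvd_pow_self p (Nat.succ_ne_zero l)))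
      obtain ⟨β, hβ⟩ := ih F hFm (dvd_X_pow_sub_one_of_natDegree_le hFm
        (hF ▸ dvd_mul_left F f) hFle hpF hFdet hFp) hpF hFdet hFp
      refine ⟨Function.update β l 1, ?_⟩
      have h1 := stdPolyIn_mul_succ (β := Function.update β l 1) O hp (Function.update_self _ _ _)
      rw [stdPolyIn, stdPoly_congr (β' := β) fun i hi => Function.update_of_ne hi.ne _ _,
        ← stdPolyIn, ← hβ, hF, mul_comm] at h1
      exact (hFm.isRegular.right h1).symm

end Classification

section Traces

variable {p : ℕ} {β : ℕ → Fin 2}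

/-- The integer `ρ(g ^ s)` for the standard lattice with bits `β 0, …, β (m - 1)`. -/
def stdTrace (p : ℕ) (β : ℕ → Fin 2) (s : ℕ) : ℕ → ℤ
  | 0 => 1
  | m + 1 => if β m = 1 then (if p ^ (m + 1) ∣ s then (p : ℤ) ^ (m + 1) else 0) - stdTrace p β s m
    else stdTrace p β s m

theorem trace_root_stdPolyIn (R : Type*) [CommRing R] [Nontrivial R] (hp : p.Prime) (s m : ℕ) :
    Algebra.trace R (AdjoinRoot (stdPolyIn β R p m)) (AdjoinRoot.root (stdPolyIn β R p m) ^ s) =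
      stdTrace p β s m := by
  induction m with
  | zero =>
    rw [stdPolyIn_zero, stdTrace, ← pow_one (X : R[X]),
      trace_root_pow_X_pow_sub_one one_ne_zero]
    simp
  | succ m ih =>
    rcases (show β m = 0 ∨ β m = 1 by omega) with h | h
    · rw [stdTrace, if_neg (by rw [h]; decide), stdPolyIn_succ_of_eq_zero R h, ih]
    · have h1 := trace_root_pow_mul (monic_stdPolyIn β R hp m) (monic_stdPolyIn β R hp (m + 1)) s
      rw [stdPolyIn_mul_succ R hp h, trace_root_pow_X_pow_sub_one (pow_ne_zero _ hp.ne_zero), ih]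
        at h1
      rw [stdTrace, if_pos h]
      push_cast
      rw [eq_sub_iff_add_eq, ← h1]
      push_cast
      rfl

theorem stdTrace_eq_natDegree (hp : p.Prime) {s m : ℕ} (h : p ^ m ∣ s) :
    stdTrace p β s m = (stdPoly p β m).natDegree := by
  induction m with
  | zero =>
    rw [natDegree_stdPoly_zero]; rfl
  | succ m ih =>
    have ih := ih ((pow_dvd_pow p (Nat.le_succ m)).trans h)
    rcases (show β m = 0 ∨ β m = 1 by omega) with h0 | h0
    · rw [stdTrace, if_neg (by rw [h0]; decide), stdPoly_succ_of_eq_zero h0, ih]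
    · rw [stdTrace, if_pos h0, if_pos h, ih]
      have := natDegree_stdPoly_succ hp h0
      have h1 : ((p ^ (m + 1) : ℕ) : ℤ) = (p : ℤ) ^ (m + 1) := by push_cast; rfl
      rw [← h1, ← this]; push_cast; ring

/-- Translations relative to subgroups not containing `g ^ s` only change the sign of the character
at `g ^ s`, since the induced module has trace zero there. -/
theorem stdTrace_add {s c : ℕ} (h : ¬ p ^ (c + 1) ∣ s) (m : ℕ) :
    stdTrace p β s (c + m) =
      (-1) ^ (∑ i ∈ Finset.range m, (β (c + i) : ℕ)) * stdTrace p β s c := by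
  induction m with
  | zero => simp
  | succ m ih =>
    have hnd : ¬ p ^ (c + m + 1) ∣ s := fun hd => h ((pow_dvd_pow p (by omega)).trans hd)
    rw [← add_assoc, stdTrace, Finset.sum_range_succ]
    rcases (show β (c + m) = 0 ∨ β (c + m) = 1 by omega) with h0 | h0
    · rw [if_neg (by rw [h0]; decide), ih, h0]; simp
    · rw [if_pos h0, if_neg hnd, ih, h0]; simp [pow_succ]

theorem stdTrace_ne_zero (hp : p.Prime) (s m : ℕ) : stdTrace p β s m ≠ 0 := by
  induction m with
  | zero => simp [stdTrace]
  | succ m ih =>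
    by_cases hd : p ^ (m + 1) ∣ s
    · rw [stdTrace_eq_natDegree hp hd]
      exact_mod_cast (natDegree_stdPoly_pos hp _).ne'
    · rw [stdTrace, if_neg hd]
      split_ifs
      · simpa using ih
      · exact ih

end Traces

/-! ### Relative projectivity and relative projective covers -/

section RelativeTrace

variable {R : Type*} [CommRing R] {G : Type*} [Group G] (Q : Subgroup G)
  {V W X : Type*} [AddCommGroup V] [Module R V] [AddCommGroup W] [Module R W]
  [AddCommGroup X] [Module R X]
  (ρ : Representation R G V) (τ : Representation R G W) (ξ : Representation R G X)

/-- `f` commutes with the action of `Q`. -/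
def IsLinearOver (f : V →ₗ[R] W) : Prop := ∀ q ∈ Q, ∀ v, f (ρ q v) = τ q (f v)

variable {Q ρ τ ξ}

theorem IsLinearOver.conj_eq {f : V →ₗ[R] W} (hf : IsLinearOver Q ρ τ f) {g h : G}
    (e : (g : G ⧸ Q) = h) (v : V) : τ g (f (ρ g⁻¹ v)) = τ h (f (ρ h⁻¹ v)) := by
  have hq : g⁻¹ * h ∈ Q := QuotientGroup.eq.1 e
  have h1 : ρ g⁻¹ v = ρ (g⁻¹ * h) (ρ h⁻¹ v) := by
    rw [← Module.End.mul_apply, ← map_mul]; simp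
  rw [h1, hf _ hq, ← Module.End.mul_apply, ← map_mul]
  simp

theorem IsLinearOver.comp {φ : W →ₗ[R] X} {f : V →ₗ[R] W} (hφ : IsLinearOver Q τ ξ φ)
    (hf : IsLinearOver Q ρ τ f) : IsLinearOver Q ρ ξ (φ ∘ₗ f) := fun q hq v => by
  rw [LinearMap.comp_apply, hf q hq, hφ q hq]; rfl

variable (Q) [Fintype (G ⧸ Q)]

/-- The relative trace `∑ x ∈ G ⧸ Q, x f x⁻¹` of a linear map `f`, formed with the representatives
`Quotient.out`; the choice is irrelevant if `f` is `Q`-linear. -/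
noncomputable def relTrace (ρ : Representation R G V) (τ : Representation R G W) (f : V →ₗ[R] W) :
    V →ₗ[R] W :=
  ∑ x : G ⧸ Q, τ x.out ∘ₗ f ∘ₗ ρ x.out⁻¹

variable {Q}

theorem relTrace_apply (f : V →ₗ[R] W) (v : V) :
    relTrace Q ρ τ f v = ∑ x : G ⧸ Q, τ x.out (f (ρ x.out⁻¹ v)) := by
  simp [relTrace]

/-- The relative trace of a `Q`-linear map can be computed with any set of representatives. -/
theorem IsLinearOver.relTrace_apply_eq_sum {f : V →ₗ[R] W} (hf : IsLinearOver Q ρ τ f)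
    {ι : Type*} [Fintype ι] (c : ι → G) (hc : Function.Bijective fun i => (c i : G ⧸ Q)) (v : V) :
    relTrace Q ρ τ f v = ∑ i, τ (c i) (f (ρ (c i)⁻¹ v)) := by
  rw [relTrace_apply, ← Equiv.sum_comp (Equiv.ofBijective _ hc)]
  exact Finset.sum_congr rfl fun i _ => hf.conj_eq (by simp) v

theorem IsLinearOver.relTrace_equivariant {f : V →ₗ[R] W} (hf : IsLinearOver Q ρ τ f) (g : G)
    (v : V) : relTrace Q ρ τ f (ρ g v) = τ g (relTrace Q ρ τ f v) := by
  have hc : Function.Bijective fun x : G ⧸ Q => ((g * x.out : G) : G ⧸ Q) := by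
    convert MulAction.bijective (α := G) (β := G ⧸ Q) g using 2 with x
    rw [← smul_eq_mul, ← MulAction.Quotient.smul_coe]
    simp
  rw [hf.relTrace_apply_eq_sum _ hc, relTrace_apply, map_sum]
  refine Finset.sum_congr rfl fun x _ => ?_
  rw [map_mul, Module.End.mul_apply, mul_inv_rev, map_mul, Module.End.mul_apply,
    Representation.inv_self_apply]

theorem relTrace_comp_left {f : V →ₗ[R] W} {φ : W →ₗ[R] X} (hφ : ∀ g w, φ (τ g w) = ξ g (φ w)) :
    relTrace Q ρ ξ (φ ∘ₗ f) = φ ∘ₗ relTrace Q ρ τ f := by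
  refine LinearMap.ext fun v => ?_
  simp only [relTrace_apply, LinearMap.comp_apply, map_sum, hφ]

theorem relTrace_comp_right {f : W →ₗ[R] X} {φ : V →ₗ[R] W} (hφ : ∀ g w, φ (ρ g w) = τ g (φ w)) :
    relTrace Q ρ ξ (f ∘ₗ φ) = relTrace Q τ ξ f ∘ₗ φ := by
  refine LinearMap.ext fun v => ?_
  simp only [relTrace_apply, LinearMap.comp_apply, hφ]

end RelativeTrace

section Higman

variable {R : Type u} [CommRing R] {G : Type v} [Group G] {Q : Subgroup G} [Fintype (G ⧸ Q)]

open Classical in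
/-- The identity of an induced module is the relative trace of the projection onto its component
`1 ⊗ N`. -/
theorem exists_relTrace_ind_eq_id {N : Type*} [AddCommGroup N] [Module R N]
    (σ : Representation R Q N) :
    ∃ E, IsLinearOver Q (Representation.ind Q.subtype σ) (Representation.ind Q.subtype σ) E ∧
      relTrace Q (Representation.ind Q.subtype σ) (Representation.ind Q.subtype σ) E =
        LinearMap.id := by
  let E : Representation.IndV Q.subtype σ →ₗ[R] Representation.IndV Q.subtype σ :=
    Representation.Coinvariants.lift _ (TensorProduct.lift <| (Finsupp.lift _ _ _ fun h : G =>
      if h ∈ Q then Representation.IndV.mk Q.subtype σ h else 0) ∘ₗ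
      (MonoidAlgebra.coeffLinearEquiv R).toLinearMap) (by
        intro g
        ext h x
        by_cases hh : h ∈ Q
        · have : (g : G) * h ∈ Q := Q.mul_mem g.2 hh
          have h2 := Representation.Coinvariants.mk_self_apply
            (ρ := Representation.tprod ((Representation.leftRegular R G).comp Q.subtype) σ) g
            (MonoidAlgebra.single h (1 : R) ⊗ₜ[R] x)
          simpa [hh, this] using h2
        · have : (g : G) * h ∉ Q := fun hg => hh ((Q.mul_mem_cancel_left g.2).1 hg)
          simp [hh, this])
  have hE : ∀ h x, E (Representation.IndV.mk Q.subtype σ h x) =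
      if h ∈ Q then Representation.IndV.mk Q.subtype σ h x else 0 := by
    intro h x
    by_cases hh : h ∈ Q <;> simp [E, hh]
  have hlin : IsLinearOver Q (Representation.ind Q.subtype σ) (Representation.ind Q.subtype σ) E := by
    intro q hq v
    have : E ∘ₗ Representation.ind Q.subtype σ q = Representation.ind Q.subtype σ q ∘ₗ E := by
      refine Representation.IndV.hom_ext _ _ fun h => LinearMap.ext fun x => ?_
      change E (Representation.ind Q.subtype σ q (Representation.IndV.mk Q.subtype σ h x)) =
        Representation.ind Q.subtype σ q (E (Representation.IndV.mk Q.subtype σ h x))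
      rw [Representation.ind_mk, hE, hE]
      simp only [Q.mul_mem_cancel_right (Q.inv_mem hq)]
      split_ifs
      · rw [Representation.ind_mk]
      · rw [map_zero]
    exact LinearMap.congr_fun this v
  refine ⟨E, hlin, ?_⟩
  refine Representation.IndV.hom_ext _ _ fun h => LinearMap.ext fun x => ?_
  rw [LinearMap.comp_apply, relTrace_apply]
  simp only [Representation.ind_mk, hE, inv_inv]
  rw [Finset.sum_eq_single ((h⁻¹ : G) : G ⧸ Q)]
  · have : h * (((h⁻¹ : G) : G ⧸ Q)).out ∈ Q := by
      have := QuotientGroup.eq.1 (Quotient.out_eq' ((h⁻¹ : G) : G ⧸ Q)).symm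
      simpa using this
    rw [if_pos this, Representation.ind_mk]
    simp
  · intro y _ hy
    rw [if_neg, map_zero]
    intro hmem
    refine hy ?_
    rw [← Quotient.out_eq' y]
    exact (QuotientGroup.eq.2 (by simpa using hmem)).symm
  · simp

/-- Higman's criterion for relative projectivity. -/
theorem isRelProjective_iff {V : Type u} [AddCommGroup V] [Module R V] [Module.Finite R V]
    {ρ : Representation R G V} :
    IsRelProjective Q ρ ↔
      ∃ θ, IsLinearOver Q ρ ρ θ ∧ relTrace Q ρ ρ θ = LinearMap.id := by
  constructor
  · rintro ⟨N, -, i, r, hri⟩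
    obtain ⟨E, hE, hE1⟩ := exists_relTrace_ind_eq_id N.ρ
    refine ⟨r.toLinearMap ∘ₗ E ∘ₗ i.toLinearMap, ?_, ?_⟩
    · exact IsLinearOver.comp (fun q _ => (r.isIntertwining _ _) q)
        (hE.comp fun q _ => (i.isIntertwining _ _) q)
    · rw [relTrace_comp_left (r.isIntertwining _ _), relTrace_comp_right (i.isIntertwining _ _), hE1]
      exact LinearMap.ext hri
  · rintro ⟨θ, hθ, hθ1⟩
    let σ : Representation R Q V := ρ.comp Q.subtype
    have hr : ∀ g : Q, (TensorProduct.lift <| (Finsupp.lift _ _ _ fun h : G => ρ h⁻¹) ∘ₗ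
        (MonoidAlgebra.coeffLinearEquiv R).toLinearMap) ∘ₗ
          Representation.tprod ((Representation.leftRegular R G).comp Q.subtype) σ g =
        (TensorProduct.lift <| (Finsupp.lift _ _ _ fun h : G => ρ h⁻¹) ∘ₗ
        (MonoidAlgebra.coeffLinearEquiv R).toLinearMap) := by
      intro g
      ext h x
      simp [σ]
    let r : Representation.IndV Q.subtype σ →ₗ[R] V := Representation.Coinvariants.lift _ _ hr
    have hr1 : ∀ h x, r (Representation.IndV.mk Q.subtype σ h x) = ρ h⁻¹ x := by
      intro h x
      simp [r]
    have hrG : ∀ g w, r (Representation.ind Q.subtype σ g w) = ρ g (r w) := by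
      intro g w
      have : r ∘ₗ Representation.ind Q.subtype σ g = ρ g ∘ₗ r := by
        refine Representation.IndV.hom_ext _ _ fun h => LinearMap.ext fun x => ?_
        change r (Representation.ind Q.subtype σ g (Representation.IndV.mk Q.subtype σ h x)) =
          ρ g (r (Representation.IndV.mk Q.subtype σ h x))
        rw [Representation.ind_mk, hr1, hr1, mul_inv_rev, inv_inv, map_mul, Module.End.mul_apply]
      exact LinearMap.congr_fun this w
    have hmk : IsLinearOver Q ρ (Representation.ind Q.subtype σ)
        (Representation.IndV.mk Q.subtype σ 1) := by
      intro q hq x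
      rw [Representation.ind_mk, one_mul]
      have h2 := Representation.Coinvariants.mk_self_apply
        (ρ := Representation.tprod ((Representation.leftRegular R G).comp Q.subtype) σ) ⟨q, hq⟩
        (MonoidAlgebra.single q⁻¹ (1 : R) ⊗ₜ[R] x)
      simpa [σ] using h2
    have hi := hmk.comp hθ
    refine ⟨Rep.of σ, inferInstanceAs (Module.Finite R V),
      ⟨relTrace Q ρ (Representation.ind Q.subtype σ) _,
        fun g => LinearMap.ext fun v => hi.relTrace_equivariant g v⟩,
      ⟨r, fun g => LinearMap.ext fun v => hrG g v⟩, fun v => ?_⟩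
    have h1 := relTrace_comp_left (Q := Q) (ρ := ρ)
      (f := Representation.IndV.mk Q.subtype σ 1 ∘ₗ θ) (φ := r) hrG
    have h2 : r ∘ₗ Representation.IndV.mk Q.subtype σ 1 ∘ₗ θ = θ := by
      refine LinearMap.ext fun x => ?_
      rw [LinearMap.comp_apply, LinearMap.comp_apply, hr1, inv_one, map_one]; rfl
    rw [h2, hθ1] at h1
    exact (LinearMap.congr_fun h1 v).symm

end Higman

section Covers

variable {R : Type u} [CommRing R] {G : Type v} [Group G] {Q : Subgroup G}
  {X X' V V' L L' : Type u} [AddCommGroup X] [Module R X] [AddCommGroup X'] [Module R X']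
  [AddCommGroup V] [Module R V] [AddCommGroup V'] [Module R V']
  [AddCommGroup L] [Module R L] [AddCommGroup L'] [Module R L']
  {τ : Representation R G X} {τ' : Representation R G X'} {ρ : Representation R G V}
  {ρ' : Representation R G V'} {lam : Representation R G L} {lam' : Representation R G L'}

variable [Fintype (G ⧸ Q)]

theorem IsRelProjectiveCover.exists_lift {π : τ.IntertwiningMap ρ} {π' : τ'.IntertwiningMap ρ'}
    (h : IsRelProjectiveCover Q π) (h' : IsRelProjectiveCover Q π') (e : ρ.IntertwiningMap ρ') :
    ∃ φ : τ.IntertwiningMap τ', ∀ x, π' (φ x) = e (π x) := by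
  have := h.finite
  obtain ⟨θ, hθ, hθ1⟩ := isRelProjective_iff.1 h.relProjective
  obtain ⟨s, hs, hs1⟩ := h'.split
  have hlin : IsLinearOver Q τ τ' (s ∘ₗ (e.toLinearMap ∘ₗ π.toLinearMap) ∘ₗ θ) :=
    IsLinearOver.comp hs (IsLinearOver.comp (IsLinearOver.comp (fun q _ => (e.isIntertwining _ _) q)
      fun q _ => (π.isIntertwining _ _) q) hθ)
  refine ⟨⟨relTrace Q τ τ' _, fun g => LinearMap.ext fun v => hlin.relTrace_equivariant g v⟩,
    fun x => ?_⟩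
  have h1 := relTrace_comp_left (Q := Q) (ρ := τ)
    (f := s ∘ₗ (e.toLinearMap ∘ₗ π.toLinearMap) ∘ₗ θ) (φ := π'.toLinearMap) (π'.isIntertwining _ _)
  have h2 : π'.toLinearMap ∘ₗ s ∘ₗ (e.toLinearMap ∘ₗ π.toLinearMap) ∘ₗ θ =
      (e.toLinearMap ∘ₗ π.toLinearMap) ∘ₗ θ := LinearMap.ext fun x => hs1 _
  rw [h2, relTrace_comp_left (τ := τ) (fun g w => (by
    rw [LinearMap.comp_apply, Representation.IntertwiningMap.toLinearMap_apply,
      Representation.IntertwiningMap.toLinearMap_apply, (π.isIntertwining _ _), (e.isIntertwining _ _)]; rfl)),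
    hθ1] at h1
  exact (LinearMap.congr_fun h1 x).symm

/-- Relative projective covers, and with them relative Heller translates, are unique up to
isomorphism. -/
theorem IsRelHeller.equiv (h : IsRelHeller Q lam ρ) (h' : IsRelHeller Q lam' ρ')
    (e : ρ.Equiv ρ') : Nonempty (lam.Equiv lam') := by
  obtain ⟨X, π, i, hπ, hi, hiπ⟩ := h
  obtain ⟨X', π', i', hπ', hi', hiπ'⟩ := h'
  obtain ⟨φ, hφ⟩ := hπ.exists_lift hπ' e.toIntertwiningMap
  obtain ⟨ψ, hψ⟩ := hπ'.exists_lift hπ e.symm.toIntertwiningMap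
  have h1 : Function.Bijective (ψ.comp φ) := hπ.minimal _ <| by
    refine Representation.IntertwiningMap.ext (LinearMap.ext fun x => ?_)
    change π (ψ (φ x)) = π x
    rw [hψ, hφ]; exact e.symm_apply_apply _
  have h2 : Function.Bijective (φ.comp ψ) := hπ'.minimal _ <| by
    refine Representation.IntertwiningMap.ext (LinearMap.ext fun x => ?_)
    change π' (φ (ψ x)) = π' x
    rw [hφ, hψ]; exact e.apply_symm_apply _
  have hinj : Function.Injective φ := Function.Injective.of_comp (f := ψ) h1.1
  have hsurj : Function.Surjective φ := Function.Surjective.of_comp (g := ψ) h2.2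
  have hmem : ∀ x, (∃ a, i a = x) ↔ π x = 0 := fun x =>
    SetLike.ext_iff.1 hiπ x
  have hmem' : ∀ x, (∃ a, i' a = x) ↔ π' x = 0 := fun x =>
    SetLike.ext_iff.1 hiπ' x
  have hex : ∀ a, ∃ b, i' b = φ (i a) := fun a =>
    (hmem' _).2 (by rw [hφ, (hmem _).1 ⟨a, rfl⟩, map_zero])
  choose c hc using hex
  refine ⟨Representation.Equiv.mk (LinearEquiv.ofBijective
    { toFun := c
      map_add' := fun a b => hi' (by rw [map_add i', hc, hc, hc, map_add i, map_add φ])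
      map_smul' := fun r a => hi' (by
        rw [RingHom.id_apply, map_smul i', hc, hc, map_smul i, map_smul φ]) } ⟨?_, ?_⟩) ?_⟩
  · intro a b hab
    have : i' (c a) = i' (c b) := congrArg i' hab
    rw [hc, hc] at this
    exact hi (hinj this)
  · intro b
    obtain ⟨x, hx⟩ := hsurj (i' b)
    have : π x = 0 := by
      have h3 := hφ x
      rw [hx, (hmem' _).1 ⟨b, rfl⟩] at h3
      have h4 : e (π x) = e 0 := by rw [map_zero]; exact h3.symm
      exact e.toLinearEquiv.injective h4
    obtain ⟨a, ha⟩ := (hmem x).2 this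
    exact ⟨a, hi' (by change i' (c a) = _; rw [hc, ha, hx])⟩
  · refine fun g => LinearMap.ext fun a => hi' ?_
    change i' (c (lam g a)) = i' (lam' g (c a))
    rw [hc, (i.isIntertwining _ _), (φ.isIntertwining _ _), (i'.isIntertwining _ _), hc]

end Covers

/-! ### Modules of cyclic groups -/

section Generator

variable {R : Type*} [CommRing R] {G : Type*} [Group G] {g : G}

theorem equivariant_of_gen (hg : ∀ x, x ∈ Subgroup.zpowers g) (hg0 : orderOf g ≠ 0)
    {V W : Type*} [AddCommGroup V] [Module R V] [AddCommGroup W] [Module R W]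
    {ρ : Representation R G V} {τ : Representation R G W} {φ : V →ₗ[R] W}
    (h : ∀ v, φ (ρ g v) = τ g (φ v)) (x : G) (v : V) : φ (ρ x v) = τ x (φ v) := by
  obtain ⟨n, rfl⟩ := exists_pow_of_mem_zpowers hg hg0 x
  induction n generalizing v with
  | zero => simp
  | succ n ih => rw [pow_succ, map_mul, map_mul, Module.End.mul_apply, Module.End.mul_apply, ih, h]

theorem nonempty_equiv_of_gen (hg : ∀ x, x ∈ Subgroup.zpowers g) (hg0 : orderOf g ≠ 0)
    {V W : Type*} [AddCommGroup V] [Module R V] [AddCommGroup W] [Module R W]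
    {ρ : Representation R G V} {τ : Representation R G W} (e : V ≃ₗ[R] W)
    (h : ∀ v, e (ρ g v) = τ g (e v)) : Nonempty (ρ.Equiv τ) :=
  ⟨Representation.Equiv.mk e fun x => LinearMap.ext fun v =>
    equivariant_of_gen hg hg0 (φ := e.toLinearMap) h x v⟩

end Generator

section CyclicVector

variable {R : Type u} [CommRing R] {G : Type v} [Group G] {g : G}

theorem isPermutation_iff (hg : ∀ x, x ∈ Subgroup.zpowers g) (hg0 : orderOf g ≠ 0)
    {V : Type u} [AddCommGroup V] [Module R V] {ρ : Representation R G V} :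
    IsPermutation ρ ↔ IsPermEnd (ρ g) := by
  constructor
  · rintro ⟨ι, _, b, h⟩
    exact ⟨ι, inferInstance, b, h g⟩
  · rintro ⟨ι, _, b, h⟩
    refine ⟨ι, inferInstance, b, fun x i => ?_⟩
    obtain ⟨n, rfl⟩ := exists_pow_of_mem_zpowers hg hg0 x
    induction n with
    | zero => exact ⟨i, by simp⟩
    | succ n ih =>
      obtain ⟨j, hj⟩ := ih
      obtain ⟨m, hm⟩ := h j
      exact ⟨m, by rw [pow_succ', map_mul, Module.End.mul_apply, hj, hm]⟩

/-- A module for a cyclic group that is free of finite rank and generated by a single vector `v₀` is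
`R[X] ⧸ (f)`, where `f` is the characteristic polynomial of the generator. -/
theorem exists_equiv_cyclicRep [Nontrivial R] (hg : ∀ x, x ∈ Subgroup.zpowers g)
    (hg0 : orderOf g ≠ 0) {V : Type*} [AddCommGroup V] [Module R V] [Module.Free R V]
    [Module.Finite R V] {ρ : Representation R G V} (v₀ : V)
    (hv₀ : ∀ v, ∃ P : R[X], aeval (ρ g) P v₀ = v) :
    ∃ hf : (ρ g).charpoly ∣ X ^ orderOf g - 1, Nonempty ((cyclicRep hg hg0 hf).Equiv ρ) := by
  have hm := LinearMap.charpoly_monic (ρ g)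
  have := hm.free_adjoinRoot
  have := hm.finite_adjoinRoot
  let φ₀ : AdjoinRoot (ρ g).charpoly →ₐ[R] Module.End R V :=
    Ideal.Quotient.liftₐ _ (aeval (ρ g)) fun P hP => by
      obtain ⟨c, rfl⟩ := Ideal.mem_span_singleton.1 hP
      rw [map_mul, LinearMap.aeval_self_charpoly, zero_mul]
  have hmk : ∀ P, φ₀ (AdjoinRoot.mk _ P) = aeval (ρ g) P := fun P => rfl
  have hφ₀ : φ₀ (AdjoinRoot.root _) = ρ g := by rw [← AdjoinRoot.mk_X, hmk, aeval_X]
  let φ : AdjoinRoot (ρ g).charpoly →ₗ[R] V := LinearMap.applyₗ v₀ ∘ₗ φ₀.toLinearMap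
  have hφ : ∀ v, φ v = φ₀ v v₀ := fun v => rfl
  have hsurj : Function.Surjective φ := by
    intro v
    obtain ⟨P, rfl⟩ := hv₀ v
    refine ⟨AdjoinRoot.mk _ P, ?_⟩
    rw [hφ, hmk]
  have hbij : Function.Bijective φ :=
    OrzechProperty.bijective_of_surjective_of_finrank_le _ hsurj (by
      rw [finrank_adjoinRoot hm, LinearMap.charpoly_natDegree])
  have hroot : ∀ v, φ (AdjoinRoot.root _ * v) = ρ g (φ v) := by
    intro v
    rw [hφ, map_mul, hφ₀]; rfl
  have hpow : ∀ n : ℕ, φ (AdjoinRoot.root _ ^ n) = ρ (g ^ n) v₀ := by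
    intro n
    rw [hφ, map_pow, hφ₀, map_pow]
  have hf : (ρ g).charpoly ∣ X ^ orderOf g - 1 := by
    refine dvd_of_root_pow_eq_one (hbij.1 ?_)
    rw [hpow, pow_orderOf_eq_one, map_one, hφ, map_one]
  refine ⟨hf, nonempty_equiv_of_gen hg hg0 (LinearEquiv.ofBijective φ hbij) fun v => ?_⟩
  rw [cyclicRep_gen]
  exact hroot v

theorem cyclicRep_equiv_of_eq {hg : ∀ x, x ∈ Subgroup.zpowers g} {hg0 : orderOf g ≠ 0}
    {f f' : R[X]} {hf : f ∣ X ^ orderOf g - 1} {hf' : f' ∣ X ^ orderOf g - 1} (h : f = f') :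
    Nonempty ((cyclicRep hg hg0 hf).Equiv (cyclicRep hg hg0 hf')) := by
  subst h
  exact ⟨Representation.Equiv.refl _⟩

end CyclicVector

section JordanBlocks

variable {k : Type u} [Field k] {G : Type v} [Group G] {g : G}
  {hg : ∀ x, x ∈ Subgroup.zpowers g} {hg0 : orderOf g ≠ 0}

/-- The augmentation of the local ring `k[X] ⧸ (f)`, where `f` is a nontrivial power of `X - 1`. -/
theorem exists_augmentation {f : k[X]} {m : ℕ} (hf1 : X - 1 ∣ f) (hfm : f ∣ (X - 1) ^ m) :
    ∃ ε : AdjoinRoot f →ₐ[k] k, ε (AdjoinRoot.root f) = 1 ∧ ∀ v, ε v ≠ 0 → IsUnit v := by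
  have hev : ∀ P : k[X], AdjoinRoot.mk f P - algebraMap k _ (P.eval 1) =
      AdjoinRoot.mk f (P - C (P.eval 1)) := by
    intro P; simp
  let ε : AdjoinRoot f →ₐ[k] k := AdjoinRoot.liftAlgHom f (Algebra.ofId k k) 1 (by
    obtain ⟨c, rfl⟩ := hf1
    simp)
  have hε : ∀ P, ε (AdjoinRoot.mk f P) = P.eval 1 := by
    intro P
    rw [← AdjoinRoot.aeval_eq, ← aeval_algHom_apply, AdjoinRoot.liftAlgHom_root, coe_aeval_eq_eval]
  refine ⟨ε, AdjoinRoot.liftAlgHom_root .., fun v hv => ?_⟩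
  obtain ⟨P, rfl⟩ := AdjoinRoot.mk_surjective v
  rw [hε] at hv
  have hdvd : (X - 1 : k[X]) ∣ P - C (P.eval 1) := by
    have := X_sub_C_dvd_sub_C_eval (a := (1 : k)) (p := P)
    simpa using this
  have hnil : IsNilpotent (AdjoinRoot.mk f (P - C (P.eval 1))) := by
    refine ⟨m, ?_⟩
    rw [← map_pow, AdjoinRoot.mk_eq_zero]
    exact hfm.trans (pow_dvd_pow_of_dvd hdvd m)
  have hu : IsUnit (algebraMap k (AdjoinRoot f) (P.eval 1)) := (IsUnit.mk0 _ hv).map _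
  have := hnil.isUnit_add_left_of_commute hu (Commute.all _ _)
  rwa [← hev, add_sub_cancel] at this

theorem cyclicRep_isIndecomposable {f : k[X]} {m : ℕ} {hf : f ∣ X ^ orderOf g - 1}
    (hf1 : X - 1 ∣ f) (hfm : f ∣ (X - 1) ^ m) : IsIndecomposable (cyclicRep hg hg0 hf) := by
  obtain ⟨ε, hε, hεu⟩ := exists_augmentation hf1 hfm
  refine ⟨ε.toRingHom.domain_nontrivial, fun U X hUX => ?_⟩
  have hmul : ∀ (U : Subrepresentation (cyclicRep hg hg0 hf)) (u : AdjoinRoot f),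
      u ∈ U.toSubmodule → IsUnit u → U.toSubmodule = ⊤ := by
    intro U u hu hunit
    have h1 : ∀ P : k[X], AdjoinRoot.mk f P * u ∈ U.toSubmodule := by
      intro P
      induction P using Polynomial.induction_on' with
      | add P Q hP hQ => rw [map_add, add_mul]; exact U.toSubmodule.add_mem hP hQ
      | monomial n a =>
        have h2 : cyclicRep hg hg0 hf (g ^ n) u ∈ U.toSubmodule := U.apply_mem_toSubmodule _ hu
        rw [cyclicRep_gen_pow] at h2
        have h3 := U.toSubmodule.smul_mem a h2
        rwa [← smul_mul_assoc, ← AdjoinRoot.mk_X, ← map_pow, AdjoinRoot.smul_mk,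
          smul_eq_C_mul, C_mul_X_pow_eq_monomial] at h3
    rw [Submodule.eq_top_iff']
    intro v
    obtain ⟨w, hw⟩ := hunit.exists_left_inv
    obtain ⟨P, hP⟩ := AdjoinRoot.mk_surjective (v * w)
    have := h1 P
    rwa [hP, mul_assoc, hw, mul_one] at this
  have h1 : (1 : AdjoinRoot f) ∈ U.toSubmodule ⊔ X.toSubmodule := by
    rw [hUX.sup_eq_top]; trivial
  obtain ⟨u, hu, x, hx, hux⟩ := Submodule.mem_sup.1 h1
  by_cases hεu0 : ε u = 0
  · left
    have hx1 : ε x ≠ 0 := by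
      have := congrArg ε hux
      rw [map_add, hεu0, zero_add, map_one] at this
      rw [this]; exact one_ne_zero
    have := hmul X x hx (hεu x hx1)
    have h2 := hUX.inf_eq_bot
    rwa [this, inf_top_eq] at h2
  · right
    have := hmul U u hu (hεu u hεu0)
    have h2 := hUX.inf_eq_bot
    rwa [this, top_inf_eq] at h2

/-- The indecomposable modules of a cyclic `p`-group in characteristic `p` are the Jordan blocks. -/
theorem IsIndecomposable.exists_equiv_cyclicRep {p l : ℕ} [Fact p.Prime] [CharP k p]
    (hg : ∀ x, x ∈ Subgroup.zpowers g) (hg0 : orderOf g ≠ 0) (hord : orderOf g = p ^ l)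
    {V : Type u} [AddCommGroup V] [Module k V] [Module.Finite k V]
    {ρ : Representation k G V} (h : IsIndecomposable ρ) :
    ∃ (n : ℕ) (hf : (X - 1 : k[X]) ^ n ∣ X ^ orderOf g - 1), 0 < n ∧
      Nonempty ((cyclicRep hg hg0 hf).Equiv ρ) := by
  classical
  obtain ⟨hV, hdec⟩ := h
  have ha : (ρ g - 1) ^ p ^ l = 0 := unipotent_of_pow_eq_one (N := l) (by
    rw [← map_pow, ← hord, pow_orderOf_eq_one, map_one])
  obtain ⟨ι, _, e, n, hn, hgen, hrel⟩ := exists_jordan_decomposition ha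
  have hne : Nonempty ι := by
    by_contra hempty
    rw [not_nonempty_iff] at hempty
    obtain ⟨v, hv⟩ := exists_ne (0 : V)
    obtain ⟨P, hP⟩ := hgen v
    exact hv (by rw [hP]; simp)
  obtain ⟨i₀⟩ := hne
  -- the blocks indexed by a set `S` span a submodule
  let L : (ι → k[X]) →ₗ[k] V := ∑ i, LinearMap.applyₗ (e i) ∘ₗ
    (aeval (ρ g) : k[X] →ₐ[k] Module.End k V).toLinearMap ∘ₗ LinearMap.proj i
  have hL : ∀ P, L P = ∑ i, aeval (ρ g) (P i) (e i) := by intro P; simp [L]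
  let T : (S : Set ι) → Submodule k (ι → k[X]) := fun S =>
    { carrier := {P | ∀ i ∉ S, P i = 0}
      add_mem' := fun {P Q} hP hQ i hi => by rw [Pi.add_apply, hP i hi, hQ i hi, add_zero]
      zero_mem' := fun i _ => rfl
      smul_mem' := fun c P hP i hi => by rw [Pi.smul_apply, hP i hi, smul_zero] }
  let U : Set ι → Subrepresentation ρ := fun S =>
    { toSubmodule := (T S).map L
      apply_mem_toSubmodule := by
        intro x v hv
        obtain ⟨t, rfl⟩ := exists_pow_of_mem_zpowers hg hg0 x
        obtain ⟨P, hP, rfl⟩ := hv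
        refine ⟨fun i => X ^ t * P i, fun i hi => ?_, ?_⟩
        · change X ^ t * P i = 0
          rw [hP i hi, mul_zero]
        · rw [hL, hL, map_sum]
          refine Finset.sum_congr rfl fun i _ => ?_
          rw [map_mul, Module.End.mul_apply, map_pow, aeval_X, map_pow] }
  have hcompl : IsCompl (U {i₀}).toSubmodule (U {i₀}ᶜ).toSubmodule := by
    rw [isCompl_iff, disjoint_iff, codisjoint_iff]
    constructor
    · rw [Submodule.eq_bot_iff]
      rintro v ⟨⟨P, hP, rfl⟩, ⟨Q, hQ, hPQ⟩⟩
      have h0 : L (P - Q) = 0 := by rw [map_sub, hPQ, sub_self]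
      rw [hL, hrel] at h0
      rw [hL]
      refine (hrel P).2 fun i => ?_
      by_cases hi : i = i₀
      · subst hi
        have h1 := h0 i
        rwa [Pi.sub_apply, hQ i (by simp), sub_zero] at h1
      · rw [hP i hi]; exact dvd_zero _
    · rw [Submodule.eq_top_iff']
      intro v
      obtain ⟨P, hP⟩ := hgen v
      rw [← hL] at hP
      rw [hP]
      have hsplit : P = Pi.single i₀ (P i₀) + (P - Pi.single i₀ (P i₀)) := by abel
      rw [hsplit, map_add]
      refine Submodule.add_mem_sup ⟨_, fun i hi => ?_, rfl⟩ ⟨_, fun i hi => ?_, rfl⟩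
      · exact Pi.single_eq_of_ne hi _
      · have : i = i₀ := by simpa using hi
        subst this
        simp
  have hsing : ∀ Q : k[X], L (Pi.single i₀ Q) = aeval (ρ g) Q (e i₀) := by
    intro Q
    rw [hL, Finset.sum_eq_single i₀]
    · simp
    · intro i _ hi; simp [hi]
    · intro h; exact absurd (Finset.mem_univ _) h
  have hUne : (U {i₀}).toSubmodule ≠ ⊥ := by
    intro hbot
    have hmem : e i₀ ∈ (U {i₀}).toSubmodule :=
      ⟨Pi.single i₀ 1, fun i hi => Pi.single_eq_of_ne hi _, by rw [hsing]; simp⟩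
    rw [hbot, Submodule.mem_bot] at hmem
    have h1 := (hrel (Pi.single i₀ 1)).1 (by rw [← hL, hsing, hmem, map_zero]) i₀
    rw [Pi.single_eq_same] at h1
    have h2 := natDegree_eq_zero_of_isUnit (isUnit_of_dvd_one h1)
    rw [natDegree_X_sub_one_pow] at h2
    exact (hn i₀).ne' h2
  have hXbot := (hdec _ _ hcompl).resolve_left hUne
  have htop : (U {i₀}).toSubmodule = ⊤ := by
    have := hcompl.sup_eq_top
    rwa [hXbot, sup_bot_eq] at this
  obtain ⟨hf, hequiv⟩ := CyclicDade.exists_equiv_cyclicRep hg hg0 (ρ := ρ) (e i₀) fun v => by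
    have hv : v ∈ (U {i₀}).toSubmodule := by rw [htop]; trivial
    obtain ⟨P, hP, rfl⟩ := hv
    refine ⟨P i₀, ?_⟩
    rw [← hsing]
    congr 1
    funext i
    by_cases hi : i = i₀
    · subst hi; simp
    · rw [Pi.single_eq_of_ne hi, hP i hi]
  have hpow : (ρ g).charpoly = (X - 1) ^ (ρ g).charpoly.natDegree :=
    eq_X_sub_one_pow_of_dvd (LinearMap.charpoly_monic _) (hord ▸ hf)
  refine ⟨_, hpow ▸ hf, ?_, ?_⟩
  · rw [LinearMap.charpoly_natDegree]
    exact Module.finrank_pos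
  · obtain ⟨E⟩ := hequiv
    obtain ⟨E'⟩ := cyclicRep_equiv_of_eq (hg := hg) (hg0 := hg0) (hf := hpow ▸ hf) (hf' := hf)
      hpow.symm
    exact ⟨E'.trans E⟩

end JordanBlocks

section RelativeTraceCyclic

variable {R : Type u} [CommRing R] {G : Type v} [Group G] {g : G}
  {hg : ∀ x, x ∈ Subgroup.zpowers g} {hg0 : orderOf g ≠ 0} {Q : Subgroup G} {M : ℕ}

theorem dvd_mul_pred_add_iff {M N : ℕ} (h : M ∣ N) (hN : N ≠ 0) (i t : ℕ) :
    M ∣ i * (N - 1) + t ↔ i ≡ t [MOD M] := by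
  obtain ⟨N, rfl⟩ := Nat.exists_eq_succ_of_ne_zero hN
  have h1 : i * N + t + i = i * (N + 1) + t := by ring
  rw [Nat.succ_sub_one, ← Nat.modEq_zero_iff_dvd]
  have h2 : i * (N + 1) + t ≡ t [MOD M] := by
    have : i * (N + 1) ≡ 0 [MOD M] := Nat.modEq_zero_iff_dvd.2 (h.mul_left i)
    simpa using this.add_right t
  constructor
  · intro h0
    have := h0.add_right i
    rw [h1, zero_add] at this
    exact this.symm.trans h2
  · intro h0
    refine Nat.ModEq.add_right_cancel' i ?_
    rw [h1, zero_add]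
    exact h2.trans h0.symm

theorem inv_pow_eq_pow {g : G} (hg0 : orderOf g ≠ 0) (i : ℕ) :
    (g ^ i)⁻¹ = g ^ (i * (orderOf g - 1)) := by
  rw [inv_eq_iff_mul_eq_one, ← pow_add]
  obtain ⟨N, hN⟩ := Nat.exists_eq_succ_of_ne_zero hg0
  rw [hN, Nat.succ_sub_one, show i + i * N = (N + 1) * i by ring, pow_mul, ← Nat.succ_eq_add_one,
    ← hN, pow_orderOf_eq_one, one_pow]

theorem bijective_pow_quotient (hg : ∀ x, x ∈ Subgroup.zpowers g) (hg0 : orderOf g ≠ 0)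
    (hQ : ∀ t : ℕ, g ^ t ∈ Q ↔ M ∣ t) :
    Function.Bijective fun i : Fin M => ((g ^ (i : ℕ) : G) : G ⧸ Q) := by
  have hMN : M ∣ orderOf g := (hQ _).1 (by rw [pow_orderOf_eq_one]; exact Q.one_mem)
  have hM : 0 < M := Nat.pos_of_ne_zero fun h => hg0 (by rw [h] at hMN; exact zero_dvd_iff.1 hMN)
  have key : ∀ i j : ℕ, ((g ^ i : G) : G ⧸ Q) = (g ^ j : G) ↔ i ≡ j [MOD M] := by
    intro i j
    rw [QuotientGroup.eq, inv_pow_eq_pow hg0, ← pow_add, hQ, dvd_mul_pred_add_iff hMN hg0]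
  refine ⟨fun i j hij => Fin.ext ?_, fun x => ?_⟩
  · exact ((key i j).1 hij).eq_of_lt_of_lt i.2 j.2
  · obtain ⟨x, rfl⟩ := QuotientGroup.mk_surjective x
    obtain ⟨n, rfl⟩ := exists_pow_of_mem_zpowers hg hg0 x
    exact ⟨⟨n % M, Nat.mod_lt _ hM⟩, (key _ _).2 (Nat.mod_modEq n M)⟩

/-- Relative projectivity of `R[X] ⧸ (f)` with respect to the subgroup of index `M`, if there is a
projection killing the powers of `X` with exponent prime to `M ℤ`. -/
theorem isRelProjective_cyclicRep [Finite G] (hQ : ∀ t : ℕ, g ^ t ∈ Q ↔ M ∣ t) {f : R[X]}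
    (hfm : f.Monic) {hf : f ∣ X ^ orderOf g - 1} (θ : Module.End R (AdjoinRoot f))
    (hθ : ∀ t, θ (AdjoinRoot.root f ^ t) = if M ∣ t then AdjoinRoot.root f ^ t else 0) :
    IsRelProjective Q (cyclicRep hg hg0 hf) := by
  have := Fintype.ofFinite (G ⧸ Q)
  have := hfm.finite_adjoinRoot
  have hMN : M ∣ orderOf g := (hQ _).1 (by rw [pow_orderOf_eq_one]; exact Q.one_mem)
  have hM : 0 < M := Nat.pos_of_ne_zero fun h => hg0 (by rw [h] at hMN; exact zero_dvd_iff.1 hMN)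
  have hlin : IsLinearOver Q (cyclicRep hg hg0 hf) (cyclicRep hg hg0 hf) θ := by
    intro q hq v
    obtain ⟨s, rfl⟩ := exists_pow_of_mem_zpowers hg hg0 q
    rw [hQ] at hq
    have : θ ∘ₗ cyclicRep hg hg0 hf (g ^ s) = cyclicRep hg hg0 hf (g ^ s) ∘ₗ θ := by
      refine adjoinRoot_linearMap_ext fun t => ?_
      rw [LinearMap.comp_apply, LinearMap.comp_apply, cyclicRep_gen_pow, cyclicRep_gen_pow,
        ← pow_add, hθ, hθ]
      simp only [Nat.dvd_add_right hq]
      split_ifs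
      · rw [pow_add]
      · rw [mul_zero]
    exact LinearMap.congr_fun this v
  refine isRelProjective_iff.2 ⟨θ, hlin, adjoinRoot_linearMap_ext fun t => ?_⟩
  rw [hlin.relTrace_apply_eq_sum _ (bijective_pow_quotient hg hg0 hQ)]
  have hterm : ∀ i : Fin M, cyclicRep hg hg0 hf (g ^ (i : ℕ))
      (θ (cyclicRep hg hg0 hf (g ^ (i : ℕ))⁻¹ (AdjoinRoot.root f ^ t))) =
      if (i : ℕ) ≡ t [MOD M] then AdjoinRoot.root f ^ t else 0 := by
    intro i
    have h1 : (AdjoinRoot.root f) ^ (i : ℕ) * AdjoinRoot.root f ^ ((i : ℕ) * (orderOf g - 1)) = 1 := by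
      rw [← cyclicRep_gen_pow (hg := hg) (hg0 := hg0) (hf := hf), ← mul_one (AdjoinRoot.root f ^ _),
        ← cyclicRep_gen_pow (hg := hg) (hg0 := hg0) (hf := hf), ← inv_pow_eq_pow hg0,
        Representation.self_inv_apply]
    rw [inv_pow_eq_pow hg0, cyclicRep_gen_pow, cyclicRep_gen_pow, ← pow_add, hθ]
    simp only [dvd_mul_pred_add_iff hMN hg0]
    split_ifs
    · rw [pow_add, ← mul_assoc, h1, one_mul]
    · rw [mul_zero]
  rw [Finset.sum_congr rfl fun i _ => hterm i,
    Finset.sum_eq_single (⟨t % M, Nat.mod_lt _ hM⟩ : Fin M)]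
  · rw [if_pos (Nat.mod_modEq t M)]; rfl
  · intro i _ hi
    rw [if_neg]
    intro h
    exact hi (Fin.ext (h.trans (Nat.mod_modEq t M).symm |>.eq_of_lt_of_lt i.2 (Nat.mod_lt _ hM)))
  · intro h; exact absurd (Finset.mem_univ _) h

end RelativeTraceCyclic

/-! ### Relative projectivity of Jordan blocks -/

section Transport

variable {R : Type u} [CommRing R] {G : Type v} [Group G] {V W : Type u} [AddCommGroup V]
  [Module R V] [AddCommGroup W] [Module R W] {ρ : Representation R G V} {τ : Representation R G W}

theorem IsRelProjective.of_isSummand {Q : Subgroup G} (h : IsRelProjective Q ρ)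
    (hs : IsSummand τ ρ) : IsRelProjective Q τ := by
  obtain ⟨N, hN, i, r, hri⟩ := h
  obtain ⟨i', r', hri'⟩ := hs
  exact ⟨N, hN, i.comp i', r'.comp r, fun w => by
    change r' (r (i (i' w))) = w
    rw [hri, hri']⟩

theorem isSummand_of_equiv (e : ρ.Equiv τ) : IsSummand τ ρ :=
  ⟨e.symm.toIntertwiningMap, e.toIntertwiningMap, e.apply_symm_apply⟩

theorem IsSummand.trans {X : Type u} [AddCommGroup X] [Module R X] {ξ : Representation R G X}
    (h : IsSummand ρ τ) (h' : IsSummand τ ξ) : IsSummand ρ ξ := by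
  obtain ⟨i, r, hri⟩ := h
  obtain ⟨i', r', hri'⟩ := h'
  exact ⟨i'.comp i, r.comp r', fun w => by
    change r (r' (i' (i w))) = w
    rw [hri', hri]⟩

theorem IsCapped.congr (h : IsCapped ρ) (e : ρ.Equiv τ) : IsCapped τ := by
  obtain ⟨A, hA, hv, hs⟩ := h
  exact ⟨A, hA, hv, hs.trans (isSummand_of_equiv e.symm)⟩

theorem IsIndecomposable.congr (h : IsIndecomposable ρ) (e : ρ.Equiv τ) : IsIndecomposable τ := by
  obtain ⟨hV, h⟩ := h
  refine ⟨e.symm.toLinearEquiv.toEquiv.nontrivial, fun U X hUX => ?_⟩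
  have hcomap : ∀ U : Subrepresentation τ, ∃ U' : Subrepresentation ρ,
      U'.toSubmodule = Submodule.orderIsoMapComap e.symm.toLinearEquiv U.toSubmodule := by
    intro U
    refine ⟨⟨U.toSubmodule.map e.symm.toLinearMap, ?_⟩, rfl⟩
    rintro g _ ⟨u, hu, rfl⟩
    exact ⟨τ g u, U.apply_mem_toSubmodule g hu, e.symm.toIntertwiningMap.isIntertwining _ _ g u⟩
  obtain ⟨U', hU'⟩ := hcomap U
  obtain ⟨X', hX'⟩ := hcomap X
  have := h U' X' (by rw [hU', hX']; exact OrderIso.isCompl _ hUX)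
  rwa [hU', hX', map_eq_bot_iff, map_eq_bot_iff] at this

theorem IsEndoPermutation.congr (h : IsEndoPermutation ρ) (e : ρ.Equiv τ) :
    IsEndoPermutation τ := by
  obtain ⟨ι, _, b, hb⟩ := h
  refine ⟨ι, inferInstance, b.map e.toLinearEquiv.conj, fun g i => ?_⟩
  obtain ⟨j, hj⟩ := hb g i
  refine ⟨j, ?_⟩
  rw [Module.Basis.map_apply, Module.Basis.map_apply, ← hj]
  refine LinearMap.ext fun w => ?_
  have h1 := e.toIntertwiningMap.isIntertwining _ _ g (b i (e.symm (τ g⁻¹ w)))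
  have h2 := e.symm.toIntertwiningMap.isIntertwining _ _ g⁻¹ w
  change e.symm (τ g⁻¹ w) = ρ g⁻¹ (e.symm w) at h2
  change τ g (e (b i (e.symm (τ g⁻¹ w)))) = e (ρ g (b i (ρ g⁻¹ (e.symm w))))
  rw [← h2]
  exact h1.symm

theorem IsDadeModule.congr (h : IsDadeModule ρ) (e : ρ.Equiv τ) : IsDadeModule τ where
  finite := have := h.finite; Module.Finite.equiv e.toLinearEquiv
  indecomposable := h.indecomposable.congr e
  endoPermutation := h.endoPermutation.congr e
  capped := h.capped.congr e

/-- The vertex of an indecomposable capped module is the whole group, since the capping summand is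
the module itself. -/
theorem IsIndecomposable.isVertex_top (h : IsIndecomposable ρ) (hc : IsCapped ρ) :
    IsVertex ⊤ ρ := by
  obtain ⟨A, hA, hv, i, r, hri⟩ := hc
  have hcompl : IsCompl i.range.toSubmodule r.ker.toSubmodule := by
    rw [isCompl_iff, disjoint_iff, codisjoint_iff]
    constructor
    · rw [Submodule.eq_bot_iff]
      rintro v ⟨⟨a, rfl⟩, ha⟩
      have ha' : r (i a) = 0 := ha
      rw [hri] at ha'
      change i a = 0
      rw [ha', map_zero]
    · rw [Submodule.eq_top_iff']
      intro v
      rw [← add_sub_cancel (i (r v)) v]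
      refine Submodule.add_mem_sup ⟨r v, rfl⟩ ?_
      change r (v - i (r v)) = 0
      rw [map_sub, hri, sub_self]
  have hker : r.ker.toSubmodule = ⊥ := by
    refine (h.2 _ _ hcompl).resolve_left fun hbot => ?_
    have := hA.1
    obtain ⟨a, ha⟩ := exists_ne (0 : A)
    have h1 : i a ∈ i.range.toSubmodule := ⟨a, rfl⟩
    rw [hbot, Submodule.mem_bot] at h1
    exact ha (by rw [← hri a, h1, map_zero])
  have hir : ∀ v, i (r v) = v := by
    intro v
    have h1 : i (r v) - v ∈ r.ker.toSubmodule := by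
      change r (i (r v) - v) = 0
      rw [map_sub, hri, sub_self]
    rw [hker, Submodule.mem_bot, sub_eq_zero] at h1
    exact h1
  exact ⟨hv.1.of_isSummand ⟨r, i, hir⟩, fun Q' hQ' hproj =>
    hv.2 Q' hQ' (hproj.of_isSummand ⟨i, r, hri⟩)⟩

theorem isRelProjective_top [Module.Finite R V] : IsRelProjective (⊤ : Subgroup G) ρ := by
  have := Fintype.ofFinite (G ⧸ (⊤ : Subgroup G))
  have hid : IsLinearOver ⊤ ρ ρ LinearMap.id := fun _ _ _ => rfl
  refine isRelProjective_iff.2 ⟨LinearMap.id, hid, LinearMap.ext fun v => ?_⟩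
  rw [hid.relTrace_apply_eq_sum (fun _ : Unit => (1 : G)) ⟨fun _ _ _ => rfl, fun x =>
    ⟨(), QuotientGroup.subsingleton_quotient_top.elim _ _⟩⟩]
  simp

/-- The index of `Q` divides the rank of a relatively `Q`-projective module in `R`: take traces in
Higman's criterion. -/
theorem IsRelProjective.index_dvd_finrank [Finite G] {Q : Subgroup G}
    [Module.Free R V] [Module.Finite R V] (h : IsRelProjective Q ρ) :
    (Q.index : R) ∣ (Module.finrank R V : R) := by
  have := Fintype.ofFinite (G ⧸ Q)
  obtain ⟨θ, -, hθ⟩ := isRelProjective_iff.1 h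
  refine ⟨LinearMap.trace R V θ, ?_⟩
  rw [← LinearMap.trace_id R V, ← hθ, relTrace, map_sum]
  have : ∀ x : G ⧸ Q, LinearMap.trace R V (ρ x.out ∘ₗ θ ∘ₗ ρ x.out⁻¹) = LinearMap.trace R V θ := by
    intro x
    rw [LinearMap.trace_comp_comm', LinearMap.comp_assoc]
    congr 1
    exact LinearMap.ext fun v => by simp
  rw [Finset.sum_congr rfl fun x _ => this x, Finset.sum_const, Finset.card_univ, nsmul_eq_mul,
    Subgroup.index, Nat.card_eq_fintype_card]

end Transport

section Blocks

variable {k : Type u} [Field k] {p l : ℕ} [Fact p.Prime] [CharP k p] {G : Type v} [Group G] {g : G}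
  {hg : ∀ x, x ∈ Subgroup.zpowers g} {hg0 : orderOf g ≠ 0}

theorem X_pow_p_sub_one_eq (m : ℕ) : (X ^ p ^ m - 1 : k[X]) = (X - 1) ^ p ^ m := by
  rw [sub_pow_char_pow, one_pow]

variable [Finite G]

/-- A Jordan block of size divisible by `p` is induced from the subgroup of index `p`. -/
theorem isRelProjective_of_dvd_natDegree {Q : Subgroup G} (hQ : ∀ t : ℕ, g ^ t ∈ Q ↔ p ∣ t) {n : ℕ}
    (hpn : p ∣ n) {hf : (X - 1 : k[X]) ^ n ∣ X ^ orderOf g - 1} :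
    IsRelProjective Q (cyclicRep hg hg0 hf) := by
  let Θ : k[X] →ₗ[k] k[X] := (Polynomial.basisMonomials k).constr k fun m =>
    if p ∣ m then X ^ m else 0
  have hΘ : ∀ m, Θ (X ^ m) = if p ∣ m then X ^ m else 0 := by
    intro m
    have := (Polynomial.basisMonomials k).constr_basis k (fun m => if p ∣ m then (X ^ m : k[X]) else 0) m
    rw [coe_basisMonomials] at this
    exact (congrArg Θ (X_pow_eq_monomial m)).trans this
  -- `Θ` is linear over `k[X ^ p]`, and `f` lies in this subring
  have hXp : ∀ P, Θ ((X ^ p - 1) * P) = (X ^ p - 1) * Θ P := by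
    intro P
    have : Θ ∘ₗ LinearMap.mulLeft k (X ^ p - 1) = LinearMap.mulLeft k (X ^ p - 1) ∘ₗ Θ := by
      refine Polynomial.lhom_ext' fun m => LinearMap.ext_ring ?_
      simp only [LinearMap.comp_apply, LinearMap.mulLeft_apply, ← X_pow_eq_monomial, sub_mul, one_mul,
        ← pow_add, map_sub, hΘ, Nat.dvd_add_right (dvd_refl p)]
      split_ifs
      · rw [pow_add]
      · simp
    exact LinearMap.congr_fun this P
  obtain ⟨c, rfl⟩ := hpn
  have hfp : ((X - 1 : k[X]) ^ (p * c)) = (X ^ p - 1) ^ c := by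
    have := X_pow_p_sub_one_eq (k := k) (p := p) 1
    rw [pow_one] at this
    rw [this, pow_mul]
  have hΘf : ∀ P, Θ ((X - 1) ^ (p * c) * P) = (X - 1) ^ (p * c) * Θ P := by
    intro P
    rw [hfp]
    generalize c = c
    induction c generalizing P with
    | zero => simp
    | succ c ih => rw [pow_succ, mul_assoc, ih, hXp, mul_assoc]
  have hfm := monic_X_sub_one_pow k (p * c)
  refine isRelProjective_cyclicRep hQ hfm
    ((AdjoinRoot.mkₐ ((X - 1 : k[X]) ^ (p * c))).toLinearMap ∘ₗ Θ ∘ₗ AdjoinRoot.modByMonicHom hfm)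
    fun t => ?_
  have h1 : AdjoinRoot.root ((X - 1 : k[X]) ^ (p * c)) ^ t = AdjoinRoot.mk _ (X ^ t) := by simp
  change AdjoinRoot.mk _ (Θ (AdjoinRoot.modByMonicHom hfm _)) = _
  rw [h1, AdjoinRoot.modByMonicHom_mk]
  have h2 := congrArg Θ (modByMonic_add_div (X ^ t) ((X - 1 : k[X]) ^ (p * c)))
  rw [map_add, hΘf, hΘ] at h2
  have h3 := congrArg (AdjoinRoot.mk ((X - 1 : k[X]) ^ (p * c))) h2
  rw [map_add, map_mul, AdjoinRoot.mk_self, zero_mul, add_zero] at h3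
  rw [h3]
  split_ifs
  · rfl
  · rw [map_zero]

theorem isVertex_top_of_not_dvd_natDegree (hord : orderOf g = p ^ l) {f : k[X]} (hfm : f.Monic)
    (hpn : ¬ p ∣ f.natDegree) {hf : f ∣ X ^ orderOf g - 1} :
    IsVertex ⊤ (cyclicRep hg hg0 hf) := by
  have := hfm.finite_adjoinRoot
  refine ⟨isRelProjective_top, fun Q hQ hproj => ?_⟩
  have hcard : Nat.card G = p ^ l := by rw [← hord, orderOf_eq_card_of_forall_mem_zpowers hg]
  obtain ⟨j, -, hj⟩ := (Nat.dvd_prime_pow Fact.out).1 (hcard ▸ Q.index_dvd_card)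
  have hpj : p ∣ Q.index := by
    cases j with
    | zero => exact absurd (Subgroup.index_eq_one.1 (by rw [hj, pow_zero])) hQ.ne
    | succ j => rw [hj]; exact dvd_pow_self p (Nat.succ_ne_zero j)
  have h1 := hproj.index_dvd_finrank
  rw [(CharP.cast_eq_zero_iff k p _).2 hpj, zero_dvd_iff, finrank_adjoinRoot hfm,
    CharP.cast_eq_zero_iff k p] at h1
  exact hpn h1

/-- If `f * F = X ^ M - 1`, then `k[X] ⧸ (F)` is the Heller translate of `k[X] ⧸ (f)` relative to
the subgroup `Q` of index `M`, the relative projective cover being `k[X] ⧸ (X ^ M - 1)`. -/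
theorem isRelHeller_cyclicRep {Q : Subgroup G} {m : ℕ} (hQ : ∀ t : ℕ, g ^ t ∈ Q ↔ p ^ m ∣ t)
    {f F : k[X]} (hfm : f.Monic) (hFm : F.Monic) (hfF : f * F = X ^ p ^ m - 1) (hf1 : X - 1 ∣ f)
    {hf : f ∣ X ^ orderOf g - 1} {hF : F ∣ X ^ orderOf g - 1} :
    IsRelHeller Q (cyclicRep hg hg0 hF) (cyclicRep hg hg0 hf) := by
  have hp : p.Prime := Fact.out
  have hMN : p ^ m ∣ orderOf g := (hQ _).1 (by rw [pow_orderOf_eq_one]; exact Q.one_mem)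
  have hE : f * F ∣ X ^ orderOf g - 1 := by
    obtain ⟨c, hc⟩ := hMN
    rw [hfF, hc, pow_mul]
    simpa using sub_dvd_pow_sub_pow (X ^ p ^ m : k[X]) 1 c
  have hEm : (f * F).Monic := hfm.mul hFm
  obtain ⟨ι, π, s, κ, hι, hπ, hπι, hκι, hπs, hsum, hπ1⟩ := exists_adjoinRoot_exact k hfm hFm
  obtain ⟨c, hc⟩ := exists_coeff_one (pow_ne_zero m hp.ne_zero) hfF
  let ρE := cyclicRep hg hg0 hE
  have hfE : f ∣ (X - 1) ^ p ^ m := by rw [← X_pow_p_sub_one_eq, ← hfF]; exact dvd_mul_right _ _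
  have hEE : f * F ∣ (X - 1) ^ p ^ m := by rw [← X_pow_p_sub_one_eq, ← hfF]
  have hEone : ∀ t, p ^ m ∣ t → AdjoinRoot.root (f * F) ^ t = 1 := by
    rintro _ ⟨t, rfl⟩
    rw [pow_mul, root_pow_eq_one hfF.dvd, one_pow]
  have hfone : ∀ t, p ^ m ∣ t → AdjoinRoot.root f ^ t = 1 := by
    rintro _ ⟨t, rfl⟩
    rw [pow_mul, root_pow_eq_one ((dvd_mul_right f F).trans hfF.dvd), one_pow]
  have hιG : ∀ x v, ι (cyclicRep hg hg0 hF x v) = ρE x (ι v) :=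
    equivariant_of_gen hg hg0 fun v => by rw [cyclicRep_gen, hι, cyclicRep_gen]
  have hπG : ∀ x v, π (ρE x v) = cyclicRep hg hg0 hf x (π v) :=
    equivariant_of_gen hg hg0 fun v => by rw [cyclicRep_gen, hπ, cyclicRep_gen]
  refine ⟨Rep.of ρE, ⟨π, fun x => LinearMap.ext fun v => hπG x v⟩,
    ⟨ι, fun x => LinearMap.ext fun v => hιG x v⟩, ⟨hEm.finite_adjoinRoot, ?_, ?_, ?_, ?_⟩, ?_, ?_⟩
  · refine isRelProjective_cyclicRep hQ hEm (c.smulRight 1) fun t => ?_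
    rw [LinearMap.smulRight_apply, hc]
    split_ifs with h
    · rw [one_smul, hEone t h]
    · rw [zero_smul]
  · exact fun v => ⟨s v, hπs v⟩
  · -- `Q` acts trivially on all the modules involved
    refine ⟨s, fun q hq v => ?_, hπs⟩
    obtain ⟨t, rfl⟩ := exists_pow_of_mem_zpowers hg hg0 q
    rw [hQ] at hq
    change s (cyclicRep hg hg0 hf (g ^ t) v) = ρE (g ^ t) (s v)
    rw [cyclicRep_gen_pow, cyclicRep_gen_pow, hfone t hq, hEone t hq, one_mul, one_mul]
  · -- an endomorphism is multiplication by its value at `1`, which has augmentation one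
    intro φ hφ
    obtain ⟨ε, hε, -⟩ := exists_augmentation hf1 hfE
    obtain ⟨ε', hε', hunit⟩ := exists_augmentation (hf1.trans (dvd_mul_right f F)) hEE
    have hpow : ∀ t : ℕ, ρE (g ^ t) 1 = AdjoinRoot.root (f * F) ^ t := fun t => by
      rw [cyclicRep_gen_pow, mul_one]
    have hεπ : ε.toLinearMap ∘ₗ π = ε'.toLinearMap := by
      refine adjoinRoot_linearMap_ext fun t => ?_
      have h1 : π (AdjoinRoot.root (f * F) ^ t) = AdjoinRoot.root f ^ t := by
        rw [← hpow, hπG, cyclicRep_gen_pow, hπ1, mul_one]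
      change ε (π _) = ε' _
      rw [h1, map_pow, map_pow, hε, hε']
    have hφ1 : φ.toLinearMap = LinearMap.mulRight k (φ.toLinearMap 1) := by
      refine adjoinRoot_linearMap_ext fun t => ?_
      rw [LinearMap.mulRight_apply, ← hpow]
      have h1 := φ.isIntertwining _ _ (g ^ t) 1
      refine h1.trans ?_
      change ρE (g ^ t) (φ 1) = _
      rw [cyclicRep_gen_pow, hpow]; rfl
    have hπφ : π (φ.toLinearMap 1) = 1 := by
      rw [← hπ1]
      exact congrArg (fun r => r (1 : AdjoinRoot (f * F))) hφ
    have hu : IsUnit (φ.toLinearMap 1) := by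
      apply hunit
      have := LinearMap.congr_fun hεπ (φ.toLinearMap 1)
      change ε (π _) = ε' _ at this
      rw [hπφ, map_one] at this
      rw [← this]; exact one_ne_zero
    have hcoe : ⇑φ = fun v => v * φ.toLinearMap 1 := by
      funext v
      exact LinearMap.congr_fun hφ1 v
    rw [hcoe]
    obtain ⟨w, hw⟩ := hu.exists_right_inv
    refine ⟨hu.isRegular.right, fun v => ⟨v * w, ?_⟩⟩
    change v * w * _ = v
    rw [mul_assoc, mul_comm w, hw, mul_one]
  · exact Function.LeftInverse.injective hκι
  · ext v
    refine ⟨?_, fun hv => ⟨κ v, ?_⟩⟩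
    · rintro ⟨w, rfl⟩
      exact hπι w
    · have hv' : π v = 0 := hv
      have := hsum v
      rwa [hv', map_zero, add_zero] at this

end Blocks

/-! ### The standard modules and lattices -/

section StandardModules

variable {p l : ℕ} [Fact p.Prime] {G : Type v} [Group G] {g : G}

theorem stdPolyIn_dvd_X_pow_orderOf (hord : orderOf g = p ^ l) (β : ℕ → Fin 2) (R : Type*)
    [CommRing R] {m : ℕ} (hm : m ≤ l) : stdPolyIn β R p m ∣ X ^ orderOf g - 1 := by
  rw [hord]
  exact (stdPolyIn_dvd β R Fact.out m).trans (X_pow_p_sub_one_dvd hm)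

theorem orderOf_ne_zero_of_eq_pow (hord : orderOf g = p ^ l) : orderOf g ≠ 0 :=
  hord ▸ pow_ne_zero l (Fact.out : p.Prime).ne_zero

/-- The module `R[X] ⧸ (stdPoly p β m)` for the cyclic group generated by `g`; over a field these
are the modules obtained from the trivial one by iterated relative Heller translations, and over
`O` their lifts. -/
noncomputable def stdRep (R : Type*) [CommRing R] (hg : ∀ x, x ∈ Subgroup.zpowers g)
    (hord : orderOf g = p ^ l) (β : ℕ → Fin 2) {m : ℕ} (hm : m ≤ l) :
    Representation R G (AdjoinRoot (stdPolyIn β R p m)) :=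
  cyclicRep hg (orderOf_ne_zero_of_eq_pow hord) (stdPolyIn_dvd_X_pow_orderOf hord β R hm)

variable (hg : ∀ x, x ∈ Subgroup.zpowers g) (hord : orderOf g = p ^ l) {β : ℕ → Fin 2}

theorem stdRep_equiv_of_eq {R : Type u} [CommRing R] {β β' : ℕ → Fin 2} {m m' : ℕ} (hm : m ≤ l)
    (hm' : m' ≤ l) (h : stdPolyIn β R p m = stdPolyIn β' R p m') :
    Nonempty ((stdRep R hg hord β hm).Equiv (stdRep R hg hord β' hm')) :=
  cyclicRep_equiv_of_eq h

theorem stdRep_pow (R : Type u) [CommRing R] {m : ℕ} (hm : m ≤ l) (n : ℕ) :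
    stdRep R hg hord β hm (g ^ n) =
      Algebra.lmul R _ (AdjoinRoot.root (stdPolyIn β R p m) ^ n) :=
  LinearMap.ext fun v => cyclicRep_gen_pow n v

theorem nonempty_baseChange_stdRep_equiv (R : Type u) [CommRing R] (S : Type u) [CommRing S]
    [Algebra R S] {m : ℕ} (hm : m ≤ l) :
    Nonempty ((baseChange S (stdRep R hg hord β hm)).Equiv (stdRep S hg hord β hm)) := by
  have hmap := stdPolyIn_map (p := p) β R S m
  have hf : (stdPolyIn β R p m).map (algebraMap R S) ∣ X ^ orderOf g - 1 := by
    rw [hmap]; exact stdPolyIn_dvd_X_pow_orderOf hord β S hm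
  have hg0 := orderOf_ne_zero_of_eq_pow hord
  obtain ⟨e⟩ := cyclicRep_equiv_of_eq (hg := hg) (hg0 := hg0) (hf := hf)
    (hf' := stdPolyIn_dvd_X_pow_orderOf hord β S hm) hmap
  have hb := adjoinRootMap_isBaseChange S (stdPolyIn β R p m)
  obtain ⟨e'⟩ := nonempty_equiv_of_gen (ρ := baseChange S (stdRep R hg hord β hm))
    (τ := cyclicRep hg hg0 hf) hg hg0 hb.equiv fun v => by
      induction v using TensorProduct.induction_on with
      | zero => simp
      | add v w hv hw => rw [map_add, map_add, hv, hw, map_add, map_add]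
      | tmul s v =>
        have h1 : baseChange S (stdRep R hg hord β hm) g (s ⊗ₜ v) =
            s ⊗ₜ (AdjoinRoot.root _ * v) := by
          change s ⊗ₜ[R] (stdRep R hg hord β hm g v) = _
          rw [stdRep, cyclicRep_gen]
        rw [h1, hb.equiv_tmul, hb.equiv_tmul, map_smul, cyclicRep_gen, AlgHom.toLinearMap_apply,
          map_mul, adjoinRootMap_root]
        rfl
  exact ⟨e'.trans e⟩

section Local

variable {O : Type u} [CommRing O] [IsLocalRing O] [CharP (IsLocalRing.ResidueField O) p]

variable (O) in
theorem isPermEnd_conjRoot_stdPolyIn (m : ℕ) : IsPermEnd (conjRoot (stdPolyIn β O p m)) := by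
  have hm := monic_stdPolyIn β O (Fact.out : p.Prime) m
  have := hm.free_adjoinRoot
  have := hm.finite_adjoinRoot
  exact (isPermSummand_conjRoot_stdPolyIn O Fact.out m).isPermEnd

theorem stdRep_isEndoPermutation {m : ℕ} (hm : m ≤ l) :
    IsEndoPermutation (stdRep O hg hord β hm) := by
  rw [IsEndoPermutation, isPermutation_iff hg (orderOf_ne_zero_of_eq_pow hord), stdRep,
    linHom_cyclicRep]
  exact isPermEnd_conjRoot_stdPolyIn O m

theorem stdRep_residueField_isEndoPermutation {m : ℕ} (hm : m ≤ l) :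
    IsEndoPermutation (stdRep (IsLocalRing.ResidueField O) hg hord β hm) := by
  have hp : p.Prime := Fact.out
  have hmon := monic_stdPolyIn β O hp m
  have := hmon.free_adjoinRoot
  have := hmon.finite_adjoinRoot
  have hu : IsUnit (AdjoinRoot.root (stdPolyIn β O p m)) :=
    (rootUnit (pow_ne_zero m hp.ne_zero) (stdPolyIn_dvd β O hp m)).isUnit
  rw [IsEndoPermutation, isPermutation_iff hg (orderOf_ne_zero_of_eq_pow hord), stdRep,
    linHom_cyclicRep, ← stdPolyIn_map β O]
  exact (isPermEnd_conjRoot_stdPolyIn O m).of_isBaseChange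
    (adjoinRootMap_isBaseChange (IsLocalRing.ResidueField O) (stdPolyIn β O p m)).end
    (conjRoot_endHom _ hmon hu)

theorem isDetOneLift_stdRep (hp2 : p ≠ 2) {m : ℕ} (hm : m ≤ l) {V : Type u} [AddCommGroup V]
    [Module (IsLocalRing.ResidueField O) V] {ρ : Representation (IsLocalRing.ResidueField O) G V}
    (e : (stdRep (IsLocalRing.ResidueField O) hg hord β hm).Equiv ρ) :
    IsDetOneLift (stdRep O hg hord β hm) ρ := by
  have hp : p.Prime := Fact.out
  have hmon := monic_stdPolyIn β O hp m
  refine ⟨hmon.finite_adjoinRoot, hmon.free_adjoinRoot, stdRep_isEndoPermutation hg hord hm,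
    (nonempty_baseChange_stdRep_equiv hg hord O _ hm).map fun e' => e'.trans e, fun x => ?_⟩
  obtain ⟨n, rfl⟩ := exists_pow_of_mem_zpowers hg (orderOf_ne_zero_of_eq_pow hord) x
  have h1 : LinearMap.det (Algebra.lmul O _ (AdjoinRoot.root (stdPolyIn β O p m))) = 1 := by
    rw [← det_stdPolyIn (β := β) O hp hp2 m, ← norm_root hmon]; rfl
  rw [stdRep_pow, map_pow, map_pow, h1, one_pow]

theorem isDadeModule_stdRep :
    IsDadeModule (stdRep (IsLocalRing.ResidueField O) hg hord β le_rfl) := by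
  have hp : p.Prime := Fact.out
  have hg0 := orderOf_ne_zero_of_eq_pow hord
  have : Finite G := by
    have := orderOf_pos_iff.1 (Nat.pos_of_ne_zero hg0)
    exact Nat.finite_of_card_ne_zero (by rwa [← orderOf_eq_card_of_forall_mem_zpowers hg])
  have hmon := monic_stdPolyIn β (IsLocalRing.ResidueField O) hp l
  have hdvd := stdPolyIn_dvd β (IsLocalRing.ResidueField O) hp l
  have hdeg := natDegree_stdPolyIn β (IsLocalRing.ResidueField O) hp l
  have hind : IsIndecomposable (stdRep (IsLocalRing.ResidueField O) hg hord β le_rfl) := by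
    refine cyclicRep_isIndecomposable (m := p ^ l) ?_ ?_
    · rw [eq_X_sub_one_pow_of_dvd hmon hdvd, hdeg]
      exact dvd_pow_self _ (natDegree_stdPoly_pos hp l).ne'
    · rwa [← X_pow_p_sub_one_eq]
  have hvert : IsVertex ⊤ (stdRep (IsLocalRing.ResidueField O) hg hord β le_rfl) :=
    isVertex_top_of_not_dvd_natDegree hord hmon (by
      rw [hdeg]; exact not_dvd_natDegree_stdPoly hp l)
  exact ⟨hmon.finite_adjoinRoot, hind, stdRep_residueField_isEndoPermutation hg hord le_rfl,
    ⟨Rep.of (stdRep (IsLocalRing.ResidueField O) hg hord β le_rfl), hind, hvert,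
      isSummand_of_equiv (Representation.Equiv.refl _)⟩⟩

/-- The indecomposable capped endo-permutation modules are the standard ones. -/
theorem IsDadeModule.exists_equiv_stdRep {k : Type u} [Field k] [CharP k p] (hl : 1 ≤ l)
    {V : Type u} [AddCommGroup V] [Module k V] {ρ : Representation k G V} (h : IsDadeModule ρ) :
    ∃ β : ℕ → Fin 2, Nonempty ((stdRep k hg hord β le_rfl).Equiv ρ) := by
  have hp : p.Prime := Fact.out
  have hg0 := orderOf_ne_zero_of_eq_pow hord
  have := h.finite
  have : Finite G := by
    have := orderOf_pos_iff.1 (Nat.pos_of_ne_zero hg0)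
    exact Nat.finite_of_card_ne_zero (by rwa [← orderOf_eq_card_of_forall_mem_zpowers hg])
  obtain ⟨n, hf, hn0, ⟨e⟩⟩ := h.indecomposable.exists_equiv_cyclicRep hg hg0 hord
  have hnl : n ≤ p ^ l := by
    rw [hord] at hf
    have := natDegree_le_of_dvd hf (monic_X_pow_p_sub_one hp l).ne_zero
    rwa [natDegree_X_sub_one_pow, natDegree_X_pow_p_sub_one] at this
  -- a block of size divisible by `p` is projective relative to the subgroup generated by `g ^ p`
  have hpn : ¬ p ∣ n := by
    intro hpn
    have hQ : ∀ t : ℕ, g ^ t ∈ Subgroup.zpowers (g ^ p) ↔ p ∣ t := by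
      intro t
      constructor
      · rintro ⟨z, hz⟩
        have hz' : g ^ ((p : ℤ) * z) = g ^ (t : ℤ) := by
          rw [zpow_mul, zpow_natCast, zpow_natCast]; exact hz
        have h1 := (zpow_eq_zpow_iff_modEq.1 hz').dvd
        have h2 : (p : ℤ) ∣ t - p * z :=
          (Int.natCast_dvd_natCast.2 (hord ▸ dvd_pow_self p (by omega))).trans h1
        exact Int.natCast_dvd_natCast.1 ((dvd_sub_left (dvd_mul_right _ _)).1 h2)
      · rintro ⟨c, rfl⟩
        rw [pow_mul]
        exact Subgroup.npow_mem_zpowers _ _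
    refine (h.indecomposable.isVertex_top h.capped).2 (Subgroup.zpowers (g ^ p)) ?_ ?_
    · refine lt_top_iff_ne_top.2 fun htop => hp.one_lt.ne' (Nat.dvd_one.1 ((hQ 1).1 ?_))
      rw [htop]; trivial
    · exact (isRelProjective_of_dvd_natDegree hQ hpn (hg0 := hg0) (hf := hf)).of_isSummand
        (isSummand_of_equiv e)
  have hendo := h.endoPermutation.congr e.symm
  rw [IsEndoPermutation, isPermutation_iff hg hg0] at hendo
  have hSP := hendo.isPermSummand (N := l) hp.pos (by
    rw [← map_pow, ← hord, pow_orderOf_eq_one, map_one])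
  rw [linHom_cyclicRep] at hSP
  obtain ⟨β, hβ⟩ := exists_natDegree_stdPoly_eq l n hnl hpn hSP
  have hpoly : stdPolyIn β k p l = (X - 1) ^ n := by
    rw [eq_X_sub_one_pow_of_dvd (monic_stdPolyIn β k hp l) (stdPolyIn_dvd β k hp l),
      natDegree_stdPolyIn β k hp l, hβ]
  obtain ⟨e'⟩ := cyclicRep_equiv_of_eq (hg := hg) (hg0 := hg0)
    (hf := stdPolyIn_dvd_X_pow_orderOf hord β k le_rfl) (hf' := hf) hpoly
  exact ⟨β, ⟨e'.trans e⟩⟩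

/-- A lattice lifting a module generated by one vector is generated by one vector. -/
theorem exists_cyclic_vector_of_lift {M : Type u} [AddCommGroup M] [Module O M] [Module.Finite O M]
    {σ : Representation O G M} {f : (IsLocalRing.ResidueField O)[X]} {hg0 : orderOf g ≠ 0}
    {hf : f ∣ X ^ orderOf g - 1}
    (e : (baseChange (IsLocalRing.ResidueField O) σ).Equiv (cyclicRep hg hg0 hf)) :
    ∃ v₀ : M, ∀ v, ∃ P : O[X], aeval (σ g) P v₀ = v := by
  have hmk : Function.Surjective (TensorProduct.mk O (IsLocalRing.ResidueField O) M 1) :=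
    TensorProduct.mk_surjective O M _ IsLocalRing.residue_surjective
  obtain ⟨v₀, hv₀⟩ := hmk (e.symm 1)
  have he1 : e (1 ⊗ₜ v₀) = 1 := by
    change e (TensorProduct.mk O (IsLocalRing.ResidueField O) M 1 v₀) = 1
    rw [hv₀, e.apply_symm_apply]
  have hpow : ∀ n : ℕ, e (1 ⊗ₜ (σ g ^ n) v₀) = AdjoinRoot.root f ^ n := by
    intro n
    have h1 := e.toIntertwiningMap.isIntertwining _ _ (g ^ n) (1 ⊗ₜ v₀)
    rw [← map_pow]
    refine h1.trans ?_
    change cyclicRep hg hg0 hf (g ^ n) (e (1 ⊗ₜ v₀)) = _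
    rw [he1, cyclicRep_gen_pow, mul_one]
  have heP : ∀ P : O[X], e (1 ⊗ₜ aeval (σ g) P v₀) =
      AdjoinRoot.mk f (P.map (algebraMap O (IsLocalRing.ResidueField O))) := by
    intro P
    induction P using Polynomial.induction_on' with
    | add P Q hP hQ =>
      rw [map_add, LinearMap.add_apply, TensorProduct.tmul_add, map_add, hP, hQ,
        Polynomial.map_add, map_add]
    | monomial n a =>
      rw [aeval_monomial, ← Algebra.smul_def, LinearMap.smul_apply, TensorProduct.tmul_smul,
        ← algebraMap_smul (IsLocalRing.ResidueField O) a, map_smul, hpow, map_monomial,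
        ← C_mul_X_pow_eq_monomial, ← smul_eq_C_mul, ← AdjoinRoot.smul_mk, map_pow, AdjoinRoot.mk_X]
  let N : Submodule O M := LinearMap.range
    (LinearMap.applyₗ v₀ ∘ₗ (aeval (σ g) : O[X] →ₐ[O] Module.End O M).toLinearMap)
  have hN : N = ⊤ := by
    rw [← IsLocalRing.map_tensorProduct_mk_eq_top, Submodule.eq_top_iff']
    intro w
    obtain ⟨P', hP'⟩ := AdjoinRoot.mk_surjective (e w)
    obtain ⟨P, rfl⟩ := Polynomial.map_surjective (algebraMap O (IsLocalRing.ResidueField O))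
      IsLocalRing.residue_surjective P'
    refine ⟨aeval (σ g) P v₀, ⟨P, rfl⟩, e.toLinearEquiv.injective ?_⟩
    exact (heP P).trans hP'
  refine ⟨v₀, fun v => ?_⟩
  have hv : v ∈ N := by rw [hN]; trivial
  exact hv

/-- Uniqueness of the determinant-one lift: it is the standard lattice. -/
theorem IsDetOneLift.nonempty_equiv_stdRep (hp2 : p ≠ 2) {V M : Type u} [AddCommGroup V]
    [Module (IsLocalRing.ResidueField O) V] [AddCommGroup M] [Module O M]
    {ρ : Representation (IsLocalRing.ResidueField O) G V} {σ : Representation O G M}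
    (h : IsDetOneLift σ ρ) (e : (stdRep (IsLocalRing.ResidueField O) hg hord β le_rfl).Equiv ρ) :
    Nonempty ((stdRep O hg hord β le_rfl).Equiv σ) := by
  have hp : p.Prime := Fact.out
  have hg0 := orderOf_ne_zero_of_eq_pow hord
  have := h.finite
  have := h.free
  obtain ⟨e₀⟩ := h.lifts
  have e₁ := e₀.trans e.symm
  obtain ⟨v₀, hv₀⟩ := exists_cyclic_vector_of_lift hg e₁
  obtain ⟨hf, ⟨e₂⟩⟩ := exists_equiv_cyclicRep hg hg0 (ρ := σ) v₀ hv₀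
  have hmon := LinearMap.charpoly_monic (σ g)
  have hdeg : (σ g).charpoly.natDegree = (stdPoly p β l).natDegree := by
    have h1 := e₁.toLinearEquiv.finrank_eq
    rw [finrank_adjoinRoot (monic_stdPolyIn β _ hp l), natDegree_stdPolyIn β _ hp l,
      Module.finrank_baseChange] at h1
    rw [LinearMap.charpoly_natDegree, h1]
  have hendo := h.endoPermutation.congr e₂.symm
  rw [IsEndoPermutation, isPermutation_iff hg hg0] at hendo
  have hSP := hendo.isPermSummand (N := l) hp.pos (by
    rw [← map_pow, ← hord, pow_orderOf_eq_one, map_one])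
  rw [linHom_cyclicRep] at hSP
  have hdet := h.det_eq_one g
  rw [LinearMap.det_eq_sign_charpoly_coeff, ← LinearMap.charpoly_natDegree] at hdet
  obtain ⟨β', hβ'⟩ := exists_stdPolyIn_eq hp2 l _ hmon (hord ▸ hf)
    (by rw [hdeg]; exact not_dvd_natDegree_stdPoly hp l) hdet hSP
  have hββ' : stdPolyIn β O p l = (σ g).charpoly := by
    rw [hβ', natDegree_stdPolyIn β' O hp l] at hdeg
    rw [hβ', stdPolyIn, stdPolyIn,
      stdPoly_congr (natDegree_stdPoly_injective hp hp2 hdeg.symm)]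
  obtain ⟨e₃⟩ := cyclicRep_equiv_of_eq (hg := hg) (hg0 := hg0)
    (hf := stdPolyIn_dvd_X_pow_orderOf hord β O le_rfl) (hf' := hf) hββ'
  exact ⟨e₃.trans e₂⟩

end Local

theorem character_baseChange {O : Type u} [CommRing O] {M N : Type u} [AddCommGroup M] [Module O M]
    [AddCommGroup N] [Module O N] [Module.Free O M] [Module.Finite O M] (K : Type u) [Field K]
    [Algebra O K] {σ : Representation O G M} {τ : Representation O G N} (e : σ.Equiv τ) (x : G) :
    (baseChange K τ).character x = algebraMap O K (LinearMap.trace O M (σ x)) := by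
  have := Module.Free.of_equiv e.toLinearEquiv
  have := Module.Finite.equiv e.toLinearEquiv
  change LinearMap.trace K (K ⊗[O] N) ((τ x).baseChange K) = _
  rw [LinearMap.trace_baseChange, ← LinearMap.trace_conj' (σ x) e.toLinearEquiv]
  congr 2
  refine LinearMap.ext fun w => ?_
  have h1 := e.toIntertwiningMap.isIntertwining _ _ x (e.symm w)
  change e (σ x (e.symm w)) = τ x (e (e.symm w)) at h1
  rw [e.apply_symm_apply] at h1
  exact h1.symm

theorem character_baseChange_stdRep {O : Type u} [CommRing O] [Nontrivial O] (K : Type u) [Field K]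
    [Algebra O K] {N : Type u} [AddCommGroup N] [Module O N] {τ : Representation O G N}
    (e : (stdRep O hg hord β le_rfl).Equiv τ) (s : ℕ) :
    (baseChange K τ).character (g ^ s) = (stdTrace p β s l : K) := by
  have hp : p.Prime := Fact.out
  have hmon := monic_stdPolyIn β O hp l
  have := hmon.free_adjoinRoot
  have := hmon.finite_adjoinRoot
  rw [character_baseChange K e, stdRep_pow]
  have := trace_root_stdPolyIn (β := β) O hp s l
  rw [Algebra.trace_apply] at this
  rw [this, map_intCast]

end StandardModules

/-! ### Signs -/

section Signs

variable {p l : ℕ} [Fact p.Prime] {G : Type v} [Group G] {g : G}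
  (hg : ∀ x, x ∈ Subgroup.zpowers g) (hord : orderOf g = p ^ l) {β : ℕ → Fin 2}
  {O : Type u} [CommRing O] [IsLocalRing O] [CharP (IsLocalRing.ResidueField O) p]
  (K : Type u) [Field K] [Algebra O K] {V : Type u} [AddCommGroup V]
  [Module (IsLocalRing.ResidueField O) V] {ρ : Representation (IsLocalRing.ResidueField O) G V}

theorem IsDetOneLift.character_eq (hp2 : p ≠ 2) {M : Type u} [AddCommGroup M] [Module O M]
    {σ : Representation O G M} (h : IsDetOneLift σ ρ)
    (e : (stdRep (IsLocalRing.ResidueField O) hg hord β le_rfl).Equiv ρ) (s : ℕ) :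
    (baseChange K σ).character (g ^ s) = (stdTrace p β s l : K) := by
  obtain ⟨e'⟩ := h.nonempty_equiv_stdRep hg hord hp2 e
  exact character_baseChange_stdRep hg hord K e' s

theorem omega_stdRep [CharZero K] (hp2 : p ≠ 2)
    (e : (stdRep (IsLocalRing.ResidueField O) hg hord β le_rfl).Equiv ρ) (s : ℕ) :
    omega O K ρ (g ^ s) = if 0 < stdTrace p β s l then 1 else -1 := by
  classical
  unfold omega
  refine if_congr ⟨?_, fun h => ?_⟩ rfl rfl
  · rintro ⟨M, hM, n, hn, hchar⟩
    rw [hM.character_eq hg hord K hp2 e s, Int.cast_inj] at hchar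
    rwa [hchar]
  · have hlift := isDetOneLift_stdRep hg hord hp2 le_rfl e
    exact ⟨Rep.of (stdRep O hg hord β le_rfl), hlift, _, h,
      hlift.character_eq hg hord K hp2 e s⟩

end Signs

section Bits

variable {l : ℕ}

/-- The bits `α_{l-1}, …, α_0`, listed from the innermost translation `Ω_{D/D_{l-1}}` outwards. -/
def bits (α : Fin l → Fin 2) (m : ℕ) : Fin 2 :=
  if h : m < l then α ⟨l - 1 - m, by omega⟩ else 0

theorem bits_of_add_eq (α : Fin l → Fin 2) (i : Fin l) {m : ℕ} (h : i + m + 1 = l) :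
    bits α m = α i := by
  rw [bits, dif_pos (by omega)]
  exact congrArg α (Fin.ext (by simp only; omega))

theorem exists_bits_eq (β : ℕ → Fin 2) : ∃ α : Fin l → Fin 2, ∀ m < l, bits α m = β m :=
  ⟨fun i => β (l - 1 - i), fun m hm => by
    rw [bits, dif_pos hm]
    exact congrArg β (by simp only; omega)⟩

theorem sum_bits (α : Fin l → Fin 2) (i : Fin l) {c : ℕ} (hc : c + (i + 1) = l) :
    ∑ t ∈ Finset.range (i + 1), (bits α (c + t) : ℕ) = ∑ j ∈ Finset.Iic i, (α j : ℕ) := by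
  rw [← Finset.sum_range_reflect]
  refine (Finset.sum_bij (fun (j : Fin l) _ => (j : ℕ)) (fun j hj => ?_) (fun _ _ _ _ h => Fin.ext h)
    (fun t ht => ?_) fun j hj => ?_).symm
  · have := Fin.le_def.1 (Finset.mem_Iic.1 hj)
    exact Finset.mem_range.2 (by omega)
  · have := Finset.mem_range.1 ht
    exact ⟨⟨t, by omega⟩, Finset.mem_Iic.2 (Fin.le_def.2 (by simp only; omega)), rfl⟩
  · have := Fin.le_def.1 (Finset.mem_Iic.1 hj)
    rw [bits_of_add_eq α j (by omega)]

theorem neg_one_pow_injective {a b : Fin 2} (h : (-1 : ℤˣ) ^ (a : ℕ) = (-1) ^ (b : ℕ)) : a = b := by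
  revert a b; decide

/-- The partial sums modulo two determine the bits, so all sign vectors occur. -/
theorem bijective_partialSigns : Function.Bijective
    fun (α : Fin l → Fin 2) (i : Fin l) => (-1 : ℤˣ) ^ (∑ j ∈ Finset.Iic i, (α j : ℕ)) := by
  rw [Fintype.bijective_iff_injective_and_card]
  refine ⟨fun α α' h => ?_, by simp⟩
  have hS : ∀ i, (-1 : ℤˣ) ^ (∑ j ∈ Finset.Iic i, (α j : ℕ)) =
      (-1) ^ (∑ j ∈ Finset.Iic i, (α' j : ℕ)) := fun i => congrFun h i
  funext i
  induction i using WellFoundedLT.induction with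
  | ind i ih =>
    have h1 := hS i
    rw [← Finset.Iio_insert, Finset.sum_insert (by simp), Finset.sum_insert (by simp),
      Finset.sum_congr rfl fun j hj => by rw [ih j (Finset.mem_Iio.1 hj)], pow_add, pow_add] at h1
    exact neg_one_pow_injective (mul_right_cancel h1)

end Bits

section Cyclic

variable {p l : ℕ} [Fact p.Prime] {D : Type v} [CommGroup D] {g : D}

theorem pow_mem_cycSubgroup_iff (hord : orderOf g = p ^ l) {i : ℕ} (hi : i ≤ l) (t : ℕ) :
    g ^ t ∈ cycSubgroup p D i ↔ p ^ (l - i) ∣ t := by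
  have hp : p.Prime := Fact.out
  rw [cycSubgroup, MonoidHom.mem_ker, powMonoidHom_apply, ← pow_mul, ← orderOf_dvd_iff_pow_eq_one,
    hord, ← Nat.sub_add_cancel hi, pow_add, Nat.add_sub_cancel]
  exact Nat.mul_dvd_mul_iff_right (pow_pos hp.pos i)

variable (hg : ∀ x, x ∈ Subgroup.zpowers g) (hord : orderOf g = p ^ l)

theorem stdRep_zero_equiv_trivial (k : Type u) [Field k] [CharP k p] (β : ℕ → Fin 2) :
    Nonempty ((stdRep k hg hord β (Nat.zero_le l)).Equiv (Representation.trivial k D k)) := by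
  have hg0 := orderOf_ne_zero_of_eq_pow hord
  obtain ⟨hf, ⟨e⟩⟩ := exists_equiv_cyclicRep hg hg0 (ρ := Representation.trivial k D k) 1 fun v =>
    ⟨C v, by simp⟩
  have hpoly := eq_X_sub_one_pow_of_dvd (LinearMap.charpoly_monic _) (hord ▸ hf)
  rw [LinearMap.charpoly_natDegree, Module.finrank_self, pow_one] at hpoly
  obtain ⟨e'⟩ := cyclicRep_equiv_of_eq (hg := hg) (hg0 := hg0)
    (hf := stdPolyIn_dvd_X_pow_orderOf hord β k (Nat.zero_le l)) (hf' := hf)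
    ((stdPolyIn_zero β k).trans hpoly.symm)
  exact ⟨e'.trans e⟩

/-- The modules `W_D(α)` are the standard modules. -/
theorem isWD_iff {k : Type u} [Field k] [CharP k p] (α : Fin l → Fin 2) {V : Type u}
    [AddCommGroup V] [Module k V] {ρ : Representation k D V} :
    IsWD p α ρ ↔ Nonempty ((stdRep k hg hord (bits α) le_rfl).Equiv ρ) := by
  have hp : p.Prime := Fact.out
  have hg0 := orderOf_ne_zero_of_eq_pow hord
  have : Finite D := by
    have := orderOf_pos_iff.1 (Nat.pos_of_ne_zero hg0)
    exact Nat.finite_of_card_ne_zero (by rwa [← orderOf_eq_card_of_forall_mem_zpowers hg])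
  obtain ⟨e0⟩ := stdRep_zero_equiv_trivial hg hord k (bits α)
  -- one step of the construction
  have hstep : ∀ (i : Fin l), α i = 1 → IsRelHeller (cycSubgroup p D i)
      (stdRep k hg hord (bits α) (m := l - i) (by omega))
      (stdRep k hg hord (bits α) (m := l - (i + 1)) (by omega)) := by
    intro i hi
    obtain ⟨c, hc⟩ : ∃ c, c + (i + 1) = l := ⟨l - (i + 1), by omega⟩
    have h1 : l - (i + 1) = c := by omega
    have h2 : l - i = c + 1 := by omega
    have hmul := stdPolyIn_mul_succ (p := p) (β := bits α) (m := c) k hp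
      (by rw [bits_of_add_eq α i (by omega), hi])
    refine isRelHeller_cyclicRep (m := l - i) (pow_mem_cycSubgroup_iff hord i.2.le)
      (monic_stdPolyIn _ k hp _) (monic_stdPolyIn _ k hp _) ?_ ?_
    · rw [h1, h2]; exact hmul
    · rw [eq_X_sub_one_pow_of_dvd (monic_stdPolyIn _ k hp _) (stdPolyIn_dvd (p := p) _ k hp _),
        natDegree_stdPolyIn _ k hp]
      exact dvd_pow_self _ (natDegree_stdPoly_pos hp _).ne'
  have hstep0 : ∀ (i : Fin l), α i = 0 → Nonempty (
      (stdRep k hg hord (bits α) (m := l - i) (by omega)).Equiv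
      (stdRep k hg hord (bits α) (m := l - (i + 1)) (by omega))) := by
    intro i hi
    obtain ⟨c, hc⟩ : ∃ c, c + (i + 1) = l := ⟨l - (i + 1), by omega⟩
    refine stdRep_equiv_of_eq hg hord _ _ ?_
    rw [show l - (i + 1) = c by omega, show l - i = c + 1 by omega]
    exact stdPolyIn_succ_of_eq_zero k (by rw [bits_of_add_eq α i (by omega), hi])
  constructor
  · rintro ⟨A, ⟨elast⟩, ⟨efirst⟩, hA⟩
    have key : ∀ i : Fin (l + 1), Nonempty
        ((stdRep k hg hord (bits α) (m := l - i) (by omega)).Equiv (A i).ρ) := by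
      intro i
      induction i using Fin.reverseInduction with
      | last =>
        obtain ⟨e1⟩ := stdRep_equiv_of_eq hg hord (β := bits α) (β' := bits α) (R := k)
          (m := l - (Fin.last l : Fin (l + 1))) (by omega) (Nat.zero_le l) (by simp)
        exact ⟨(e1.trans e0).trans elast.symm⟩
      | cast i ih =>
        have : Fintype (D ⧸ cycSubgroup p D i) := Fintype.ofFinite _
        obtain ⟨e1⟩ := ih
        rcases (show α i = 0 ∨ α i = 1 by omega) with h | h
        · obtain ⟨e2⟩ := (hA i).1 h
          obtain ⟨e3⟩ := hstep0 i h
          exact ⟨(e3.trans e1).trans e2.symm⟩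
        · exact (hstep i h).equiv ((hA i).2 h) e1
    obtain ⟨e1⟩ := key 0
    exact ⟨e1.trans efirst⟩
  · rintro ⟨e⟩
    refine ⟨fun i => Rep.of (stdRep k hg hord (bits α) (m := l - i) (by omega)), ?_, ⟨e⟩,
      fun i => ⟨hstep0 i, hstep i⟩⟩
    obtain ⟨e1⟩ := stdRep_equiv_of_eq hg hord (β := bits α) (β' := bits α) (R := k)
      (m := l - (Fin.last l : Fin (l + 1))) (by omega) (Nat.zero_le l) (by simp)
    exact ⟨e1.trans e0⟩

/-- The sign at a generator of the subgroup of order `p ^ (i + 1)`. -/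
theorem omega_generator (hp2 : p ≠ 2) {O : Type u} [CommRing O] [IsLocalRing O]
    [CharP (IsLocalRing.ResidueField O) p] (K : Type u) [Field K] [CharZero K] [Algebra O K]
    {V : Type u} [AddCommGroup V] [Module (IsLocalRing.ResidueField O) V]
    {ρ : Representation (IsLocalRing.ResidueField O) D V} {α : Fin l → Fin 2}
    (e : (stdRep (IsLocalRing.ResidueField O) hg hord (bits α) le_rfl).Equiv ρ) {x : Fin l → D}
    (hx : AreGenerators p x) (i : Fin l) :
    omega O K ρ (x i) = (-1) ^ (∑ j ∈ Finset.Iic i, (α j : ℕ)) := by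
  have hp : p.Prime := Fact.out
  have hg0 := orderOf_ne_zero_of_eq_pow hord
  obtain ⟨s, hs⟩ := exists_pow_of_mem_zpowers hg hg0 (x i)
  obtain ⟨c, hc⟩ : ∃ c, c + (i + 1) = l := ⟨l - (i + 1), by omega⟩
  have hmem : ∀ j ≤ l, x i ∈ cycSubgroup p D j ↔ p ^ (l - j) ∣ s := fun j hj => by
    rw [← hs]; exact pow_mem_cycSubgroup_iff hord hj s
  have hdvd : p ^ c ∣ s := by
    have := (hmem (i + 1) (by omega)).1 (by rw [← hx i]; exact Subgroup.mem_zpowers _)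
    rwa [show l - (i + 1) = c by omega] at this
  have hndvd : ¬ p ^ (c + 1) ∣ s := by
    intro hd
    have h1 : x i ∈ cycSubgroup p D i := (hmem i (by omega)).2 (by
      rwa [show l - i = c + 1 by omega])
    have h2 : g ^ p ^ c ∈ cycSubgroup p D i := by
      have h3 : Subgroup.zpowers (x i) ≤ cycSubgroup p D i := by
        rw [Subgroup.zpowers_le]; exact h1
      refine h3 ?_
      rw [hx i, pow_mem_cycSubgroup_iff hord (by omega), show l - (i + 1) = c by omega]
    rw [pow_mem_cycSubgroup_iff hord (by omega), show l - i = c + 1 by omega,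
      Nat.pow_dvd_pow_iff_le_right hp.one_lt] at h2
    omega
  rw [← hs, omega_stdRep hg hord K hp2 e s]
  have htr := stdTrace_add (β := bits α) hndvd (i + 1)
  rw [hc, stdTrace_eq_natDegree hp hdvd, sum_bits α i hc] at htr
  have hpos : (0 : ℤ) < (stdPoly p (bits α) c).natDegree := by
    exact_mod_cast natDegree_stdPoly_pos hp c
  rw [htr]
  rcases Nat.even_or_odd (∑ j ∈ Finset.Iic i, (α j : ℕ)) with h | h
  · rw [h.neg_one_pow, h.neg_one_pow, one_mul, if_pos hpos]
  · rw [h.neg_one_pow, h.neg_one_pow, if_neg (by omega)]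

end Cyclic

end CyclicDade

theorem lemma3p2 {p : ℕ} (hp : p.Prime) (hp2 : p ≠ 2) {l : ℕ} (hl : 1 ≤ l)
    -- the `p`-modular system `(K, O, k)`, where `k` is the residue field of `O`
    (O : Type u) [CommRing O] [IsDomain O] [IsDiscreteValuationRing O]
    [IsAdicComplete (IsLocalRing.maximalIdeal O) O]
    (K : Type u) [Field K] [CharZero K] [Algebra O K] [IsFractionRing O K]
    [IsAlgClosed (IsLocalRing.ResidueField O)] [CharP (IsLocalRing.ResidueField O) p]
    -- the cyclic group `D` of order `p ^ l`
    (D : Type v) [CommGroup D] [IsCyclic D] (hD : Nat.card D = p ^ l)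
    -- `K` is large enough for `D`
    (hK : ∃ ζ : K, IsPrimitiveRoot ζ (p ^ l)) :
    -- the signs are well defined: each `W` has a unique determinant-one lift, and its character
    -- takes nonzero integers as values
    (∀ W : Rep.{u} (IsLocalRing.ResidueField O) D, CyclicDade.IsDadeModule W.ρ →
      (∃ M : Rep.{u} O D, CyclicDade.IsDetOneLift M.ρ W.ρ) ∧
      (∀ M M' : Rep.{u} O D, CyclicDade.IsDetOneLift M.ρ W.ρ → CyclicDade.IsDetOneLift M'.ρ W.ρ →
        Nonempty (M.ρ.Equiv M'.ρ)) ∧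
      (∀ M : Rep.{u} O D, CyclicDade.IsDetOneLift M.ρ W.ρ →
        ∀ g : D, ∃ n : ℤ, n ≠ 0 ∧ (CyclicDade.baseChange K M.ρ).character g = n)) ∧
    -- bijectivity
    (∀ x : Fin l → D, CyclicDade.AreGenerators p x →
      Function.Bijective (CyclicDade.Psi O K (IsLocalRing.ResidueField O) x)) ∧
    -- independence of the generators
    (∀ x y : Fin l → D, CyclicDade.AreGenerators p x → CyclicDade.AreGenerators p y →
      CyclicDade.Psi O K (IsLocalRing.ResidueField O) x =
        CyclicDade.Psi O K (IsLocalRing.ResidueField O) y) ∧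
    -- the values on `W_D(α_0, …, α_{l-1})`
    (∀ α : Fin l → Fin 2,
      (∃ W : Rep.{u} (IsLocalRing.ResidueField O) D, CyclicDade.IsWD p α W.ρ) ∧
      ∀ W : Rep.{u} (IsLocalRing.ResidueField O) D, CyclicDade.IsWD p α W.ρ →
        CyclicDade.IsDadeModule W.ρ ∧
        ∀ x : Fin l → D, CyclicDade.AreGenerators p x →
          ∀ i : Fin l, CyclicDade.omega O K W.ρ (x i) =
            (-1) ^ (∑ j ∈ Finset.Iic i, (α j : ℕ))) := by
  have : Fact p.Prime := ⟨hp⟩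
  obtain ⟨g, hg⟩ := IsCyclic.exists_generator (α := D)
  have hord : orderOf g = p ^ l := by rw [← hD, orderOf_eq_card_of_forall_mem_zpowers hg]
  have hg0 := CyclicDade.orderOf_ne_zero_of_eq_pow hord
  have hclass : ∀ {V : Type u} [AddCommGroup V] [Module (IsLocalRing.ResidueField O) V]
      {ρ : Representation (IsLocalRing.ResidueField O) D V}, CyclicDade.IsDadeModule ρ →
      ∃ α : Fin l → Fin 2, Nonempty ((CyclicDade.stdRep (IsLocalRing.ResidueField O) hg hord
        (CyclicDade.bits α) le_rfl).Equiv ρ) := by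
    intro V _ _ ρ h
    obtain ⟨β, ⟨e⟩⟩ := h.exists_equiv_stdRep hg hord hl
    obtain ⟨α, hα⟩ := CyclicDade.exists_bits_eq (l := l) β
    obtain ⟨e'⟩ := CyclicDade.stdRep_equiv_of_eq (R := IsLocalRing.ResidueField O) hg hord
      (le_refl l) (le_refl l) (congrArg (Polynomial.map _) (CyclicDade.stdPoly_congr hα))
    exact ⟨α, ⟨e'.trans e⟩⟩
  refine ⟨fun W hW => ?_, fun x hx => ⟨?_, fun ε => ?_⟩, fun x y hx hy => ?_, fun α => ⟨?_, ?_⟩⟩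
  · obtain ⟨α, ⟨e⟩⟩ := hclass hW
    refine ⟨⟨Rep.of (CyclicDade.stdRep O hg hord (CyclicDade.bits α) le_rfl),
      CyclicDade.isDetOneLift_stdRep hg hord hp2 le_rfl e⟩, fun M M' hM hM' => ?_,
      fun M hM x => ?_⟩
    · obtain ⟨e₁⟩ := hM.nonempty_equiv_stdRep hg hord hp2 e
      obtain ⟨e₂⟩ := hM'.nonempty_equiv_stdRep hg hord hp2 e
      exact ⟨e₁.symm.trans e₂⟩
    · obtain ⟨s, rfl⟩ := CyclicDade.exists_pow_of_mem_zpowers hg hg0 x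
      exact ⟨_, CyclicDade.stdTrace_ne_zero hp s l, hM.character_eq hg hord K hp2 e s⟩
  · intro w w' h
    induction w using Quotient.inductionOn with | _ A
    induction w' using Quotient.inductionOn with | _ B
    obtain ⟨α, ⟨e⟩⟩ := hclass A.2
    obtain ⟨α', ⟨e'⟩⟩ := hclass B.2
    have hαα' : α = α' := CyclicDade.bijective_partialSigns.1 (funext fun i => by
      have h1 : CyclicDade.omega O K A.1.ρ (x i) = CyclicDade.omega O K B.1.ρ (x i) :=
        congrFun h i
      rwa [CyclicDade.omega_generator hg hord hp2 K e hx i,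
        CyclicDade.omega_generator hg hord hp2 K e' hx i] at h1)
    subst hαα'
    exact Quotient.sound ⟨e.symm.trans e'⟩
  · obtain ⟨α, rfl⟩ := CyclicDade.bijective_partialSigns.2 ε
    refine ⟨Quotient.mk _ ⟨Rep.of (CyclicDade.stdRep (IsLocalRing.ResidueField O) hg hord
      (CyclicDade.bits α) le_rfl), CyclicDade.isDadeModule_stdRep hg hord⟩, funext fun i => ?_⟩
    exact CyclicDade.omega_generator hg hord hp2 K (Representation.Equiv.refl _) hx i
  · funext w i
    induction w using Quotient.inductionOn with | _ A
    obtain ⟨α, ⟨e⟩⟩ := hclass A.2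
    exact (CyclicDade.omega_generator hg hord hp2 K e hx i).trans
      (CyclicDade.omega_generator hg hord hp2 K e hy i).symm
  · exact ⟨Rep.of (CyclicDade.stdRep (IsLocalRing.ResidueField O) hg hord
      (CyclicDade.bits α) le_rfl),
      (CyclicDade.isWD_iff hg hord α).2 ⟨Representation.Equiv.refl _⟩⟩
  · intro W hW
    obtain ⟨e⟩ := (CyclicDade.isWD_iff hg hord α).1 hW
    exact ⟨(CyclicDade.isDadeModule_stdRep hg hord).congr e, fun x hx i =>
      CyclicDade.omega_generator hg hord hp2 K e hx i⟩
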